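/- Let $N\ge 1$ and $1<p<\infty$. Let $W^{1,p}_+(\mathbb R^N)$ be the set of nonnegative functions of $W^{1,p}(\mathbb R^N)$, and let $u^*$ be the Schwarz symmetrization of $u$, that is, the radially nonincreasing function with $|\{u^*>t\}|=|\{u>t\}|$ for all $t>0$. For a closed half-space $H\subset\mathbb R^N$ with reflection $\sigma_H$ across $\partial H$, the polarization $u^H$ of $u$ is $\max\{u,u\circ\sigma_H\}$ on $H$ and $\min\{u,u\circ\sigma_H\}$ on $\mathbb R^N\setminus H$; we write $u^{H_1\cdots H_k}=(\cdots(u^{H_1})^{H_2}\cdots)^{H_k}$. Let $\varrho:[0,\infty)\times\mathbb R^N\to\mathbb R$ be Borel measurable and put $J(v)=\int_{\mathbb R^N}\varrho(v,\nabla v)\,dx\in[-\infty,\infty]$ (the integral of the positive part minus that of the negative part; by convention $-\infty$ if both are infinite). Let $(H_n)_{n\ge1}$ be a dense sequence in the set of closed half-spaces of $\mathbb R^N$ that contain $0$ in their interior. Let $u\in W^{1,p}_+(\mathbb R^N)$ and set $u_0=u$, $u_{n+1}=u_n^{H_1\cdots H_{n+1}}$. Assume that 1. $-\infty<J(u)<+\infty$;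 2. $\liminf_n J(u_n)\le J(u)$; 3. if $(u_n)$ converges weakly in $W^{1,p}(\mathbb R^N)$ to some $v\in W^{1,p}_+(\mathbb R^N)$, then $J(v)\le\liminf_n J(u_n)$; 4. for $(u_n)$ and each of its subsequences $(u_{n_k})$: if $J(u_{n_k})\to J(u^*)$ as $k\to\infty$, then $u_{n_k}\to u^*$ in $D^{1,p}(\mathbb R^N)$, i.e. $\|\nabla u_{n_k}-\nabla u^*\|_{L^p(\mathbb R^N)}\to0$. Then $u^*\in W^{1,p}_+(\mathbb R^N)$, and $$J(u)=J(u^*)\ \Longrightarrow\ \|\nabla u\|_{L^p(\mathbb R^N)}=\|\nabla u^*\|_{L^p(\mathbb R^N)}.$$ -/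

import Mathlib

open MeasureTheory Filter Topology
open scoped ENNReal NNReal ContDiff

noncomputable section

namespace PolyaSzego

/-- The Euclidean space of dimension `N`. -/
abbrev Space (N : ℕ) : Type := EuclideanSpace ℝ (Fin N)

/-! ### Closed half-spaces, reflections, polarization -/

/-- A closed half-space `{x | ⟪normal, x⟫ ≤ offset}`, where `normal` is the outer unit normal
(so that the pair `(normal, offset)` is determined by the half-space). -/
structure HalfSpace (N : ℕ) where
  normal : Space N
  offset : ℝ
  norm_normal : ‖normal‖ = 1

/-- The topology of the pairs `(normal, offset)`: `Hₙ → H` if and only if `Hₙ = iₙ(H)` for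
isometries `iₙ` that converge to the identity. -/
instance HalfSpace.instTopologicalSpace (N : ℕ) : TopologicalSpace (HalfSpace N) :=
  TopologicalSpace.induced (fun H : HalfSpace N => (H.normal, H.offset)) inferInstance

/-- The points of the half-space. -/
def HalfSpace.carrier {N : ℕ} (H : HalfSpace N) : Set (Space N) :=
  {x | inner ℝ H.normal x ≤ H.offset}

/-- The reflection with respect to the boundary hyperplane of `H`. -/
def HalfSpace.reflect {N : ℕ} (H : HalfSpace N) (x : Space N) : Space N :=
  x - (2 * (inner ℝ H.normal x - H.offset)) • H.normal

/-- The half-spaces that contain the origin in their interior. -/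
def originHalfSpaces (N : ℕ) : Set (HalfSpace N) :=
  {H | (0 : Space N) ∈ interior H.carrier}

/-- `(Hₙ)` is a dense sequence in the set of closed half-spaces whose interior contains `0`. -/
def IsDenseHalfSpaceSeq {N : ℕ} (H : ℕ → HalfSpace N) : Prop :=
  (∀ n, H n ∈ originHalfSpaces N) ∧ originHalfSpaces N ⊆ closure (Set.range H)

open Classical in
/-- The polarization (two-point rearrangement) `u^H`. -/
def polarize {N : ℕ} (H : HalfSpace N) (u : Space N → ℝ) (x : Space N) : ℝ :=
  if x ∈ H.carrier then max (u x) (u (H.reflect x)) else min (u x) (u (H.reflect x))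

/-- The iterated polarization `v^{H₁ ⋯ H_k}` (first `H₁`, last `H_k`). The half-space `H_{i+1}`
of the sequence is `H i`. -/
def polarizeUpTo {N : ℕ} (H : ℕ → HalfSpace N) (k : ℕ) (v : Space N → ℝ) : Space N → ℝ :=
  (List.range k).foldl (fun w i => polarize (H i) w) v

/-- The sequence `u₀ = u`, `u_{n+1} = u_n^{H₁ ⋯ H_{n+1}}`. -/
def polarizationSeq {N : ℕ} (H : ℕ → HalfSpace N) (u : Space N → ℝ) : ℕ → Space N → ℝ
  | 0 => u
  | n + 1 => polarizeUpTo H (n + 1) (polarizationSeq H u n)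

/-! ### Schwarz symmetrization -/

/-- The Schwarz symmetrization `u*` of a nonnegative function all of whose superlevel sets
`{u > t}`, `t > 0`, have finite measure: the radially nonincreasing function with
`{u* > t}` equal, up to a null set, to the ball centered at `0` of the same measure as `{u > t}`,
for every `t > 0`. -/
def schwarz {N : ℕ} (u : Space N → ℝ) (x : Space N) : ℝ :=
  sSup {t : ℝ | 0 ≤ t ∧ volume (Metric.ball (0 : Space N) ‖x‖) < volume {y | t < u y}}

/-! ### Sobolev functions -/

/-- `g` is a generalized (distributional) gradient of `u`. -/
def HasWeakGradient {N : ℕ} (u : Space N → ℝ) (g : Space N → Space N) : Prop :=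
  LocallyIntegrable u volume ∧ LocallyIntegrable g volume ∧
    ∀ φ : Space N → ℝ, ContDiff ℝ ∞ φ → HasCompactSupport φ → ∀ i : Fin N,
      ∫ x, u x * fderiv ℝ φ x (EuclideanSpace.single i 1) = -∫ x, g x i * φ x

open Classical in
/-- The generalized gradient `∇u`. It is unique up to null sets; the value is `0` for functions
that have no generalized gradient. -/
def weakGrad {N : ℕ} (u : Space N → ℝ) : Space N → Space N :=
  if h : ∃ g, HasWeakGradient u g then h.choose else 0

/-- `u ∈ W^{1,p}(ℝᴺ)`. -/
def MemW1p {N : ℕ} (p : ℝ) (u : Space N → ℝ) : Prop :=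
  MemLp u (ENNReal.ofReal p) volume ∧
    ∃ g, HasWeakGradient u g ∧ MemLp g (ENNReal.ofReal p) volume

/-- `u ∈ W^{1,p}_+(ℝᴺ)`: the nonnegative functions of `W^{1,p}(ℝᴺ)`. -/
def MemW1pPos {N : ℕ} (p : ℝ) (u : Space N → ℝ) : Prop :=
  MemW1p p u ∧ 0 ≤ᵐ[volume] u

/-- The norm `‖∇u‖_p`. -/
def gradNorm {N : ℕ} (p : ℝ) (u : Space N → ℝ) : ℝ≥0∞ :=
  eLpNorm (weakGrad u) (ENNReal.ofReal p) volume

/-- Weak convergence `w n ⇀ v` in `W^{1,p}(ℝᴺ)`, `1 < p < ∞`: the functions and their gradients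
converge weakly in `L^p`, tested against the dual space `L^{p'}`. -/
def WeakTendstoW1p {N : ℕ} (p : ℝ) (w : ℕ → Space N → ℝ) (v : Space N → ℝ) : Prop :=
  (∀ n, MemW1p p (w n)) ∧ MemW1p p v ∧
  (∀ h : Space N → ℝ, MemLp h (ENNReal.ofReal p.conjExponent) volume →
    Tendsto (fun n => ∫ x, w n x * h x) atTop (𝓝 (∫ x, v x * h x))) ∧
  (∀ h : Space N → Space N, MemLp h (ENNReal.ofReal p.conjExponent) volume →
    Tendsto (fun n => ∫ x, inner ℝ (weakGrad (w n) x) (h x)) atTop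
      (𝓝 (∫ x, inner ℝ (weakGrad v x) (h x))))

/-- Convergence `w n → v` in `D^{1,p}(ℝᴺ)`: the gradients converge in `L^p`. -/
def TendstoD1p {N : ℕ} (p : ℝ) (w : ℕ → Space N → ℝ) (v : Space N → ℝ) : Prop :=
  Tendsto (fun n => eLpNorm (weakGrad (w n) - weakGrad v) (ENNReal.ofReal p) volume)
    atTop (𝓝 0)

/-- The functional `J(u) = ∫ ϱ(u, ∇u) dx` with values in `[-∞, ∞]`: the integral of the positive
part minus the integral of the negative part. (If both are infinite, so that the integral does not
exist, the value is `⊥ = -∞`.) -/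
def energy {N : ℕ} (ϱ : ℝ≥0 × Space N → ℝ) (u : Space N → ℝ) : EReal :=
  ((∫⁻ x, ENNReal.ofReal (ϱ ((u x).toNNReal, weakGrad u x)) : ℝ≥0∞) : EReal) -
    ((∫⁻ x, ENNReal.ofReal (-ϱ ((u x).toNNReal, weakGrad u x)) : ℝ≥0∞) : EReal)

end PolyaSzego

end

/-!
Polarization does not change the norm of the gradient, and the polarization sequence converges to
`u*`, in `L^p` and weakly in `W^{1,p}`. So lower semicontinuity and `liminf J(uₙ) ≤ J(u)` give
`J(u*) ≤ liminf J(uₙ) ≤ J(u)`. If `J(u) = J(u*)`, the `lim inf` equals the finite number `J(u*)` and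
is attained along a subsequence; along it the gradients converge strongly to `∇u*`, and the
`L^p` norms of these gradients are all `‖∇u‖_p`.

*Convergence in `L^p`* (`tendsto_polarizationSeq_schwarz`). For `u` continuous with compact support
all `uₙ` share a modulus of continuity and a ball that contains their supports, so that
subsequences converge uniformly by Arzelà–Ascoli. The second moment `∫ u |x|²` decreases under each
polarization, strictly unless the function is fixed; since `u_{n+1}` arises from `uₙ` by polarizing
with `H₁, …, H_{n+1}`, a limit is fixed by every `H_m` (`polarize_eq_self_of_tendstoUniformly`),
hence, by density, radially nonincreasing, and it is equimeasurable with `u`. This determines it as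
`u*` (`ae_eq_schwarz`). The general case follows as polarizations contract `L^p`
(`eLpNorm_polarizationSeq_sub_le`).

*Gradients* (`HasWeakGradient.polarize`). `u^H = u ∘ τ`, where `τ` preserves the measure and is, at
each point, either the identity or the reflection `σ`. The expected gradient therefore has the same
norm as `∇u`. To see that it is the weak gradient, write `u^H = (u + u ∘ σ ± |w|) / 2` with
`w = u - u ∘ σ`, and the sign `+` on `H`, `-` outside. The jump of the sign is harmless because `w`
is odd under `σ`, so that its mollifications may be taken to vanish on `∂H`, and because `|t|` is a
limit of `C¹` functions that have a zero of second order at the origin.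

*Weak compactness* (`exists_hasWeakGradient_of_tendsto`). The gradients in `L^p` of functions within
`1 / (n + 1)` of `v` form decreasing convex sets; by uniform convexity, elements of almost minimal
norm converge, and the limit is a gradient of `v`. Weak convergence of the gradients then follows
by testing with smooth fields (`tendsto_integral_inner_of_tendsto`).
-/

noncomputable section

namespace PolyaSzego

variable {N : ℕ}

/-! ### Reflections and half-spaces -/

namespace HalfSpace

/-- The linear part of the reflection with respect to `∂H`. -/
def linearReflection (H : HalfSpace N) : Space N ≃ₗᵢ[ℝ] Space N :=
  (ℝ ∙ H.normal)ᗮ.reflection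

theorem linearReflection_apply (H : HalfSpace N) (x : Space N) :
    H.linearReflection x = x - (2 * inner ℝ H.normal x) • H.normal := by
  rw [linearReflection, Submodule.reflection_orthogonal_apply, Submodule.reflection_singleton_apply,
    H.norm_normal]
  simp [mul_smul, two_smul]

theorem linearReflection_linearReflection (H : HalfSpace N) (x : Space N) :
    H.linearReflection (H.linearReflection x) = x :=
  Submodule.reflection_reflection _ _

theorem inner_linearReflection (H : HalfSpace N) (x y : Space N) :
    inner ℝ (H.linearReflection x) y = inner ℝ x (H.linearReflection y) := by
  rw [← H.linearReflection.inner_map_map x, linearReflection_linearReflection]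

theorem reflect_eq (H : HalfSpace N) (x : Space N) :
    H.reflect x = H.linearReflection x + (2 * H.offset) • H.normal := by
  rw [reflect, linearReflection_apply]
  module

theorem inner_normal_self (H : HalfSpace N) : inner ℝ H.normal H.normal = (1 : ℝ) := by
  rw [real_inner_self_eq_norm_sq, H.norm_normal, one_pow]

theorem inner_reflect (H : HalfSpace N) (x : Space N) :
    inner ℝ H.normal (H.reflect x) = 2 * H.offset - inner ℝ H.normal x := by
  rw [reflect, inner_sub_right, inner_smul_right, inner_normal_self]
  ring

@[simp]
theorem reflect_reflect (H : HalfSpace N) (x : Space N) : H.reflect (H.reflect x) = x := by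
  rw [reflect, inner_reflect, reflect]
  module

theorem mem_carrier {H : HalfSpace N} {x : Space N} :
    x ∈ H.carrier ↔ inner ℝ H.normal x ≤ H.offset := Iff.rfl

theorem reflect_eq_self (H : HalfSpace N) {x : Space N} (h : inner ℝ H.normal x = H.offset) :
    H.reflect x = x := by
  simp [reflect, h]

theorem reflect_mem_carrier_of_notMem {H : HalfSpace N} {x : Space N} (h : x ∉ H.carrier) :
    H.reflect x ∈ H.carrier := by
  rw [mem_carrier] at h ⊢
  rw [inner_reflect]
  linarith

theorem reflect_eq_self_of_reflect_mem {H : HalfSpace N} {x : Space N} (hx : x ∈ H.carrier)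
    (h : H.reflect x ∈ H.carrier) : H.reflect x = x := by
  rw [mem_carrier] at h hx
  rw [inner_reflect] at h
  exact H.reflect_eq_self (by linarith)

theorem reflect_sub_reflect (H : HalfSpace N) (x y : Space N) :
    H.reflect x - H.reflect y = H.linearReflection (x - y) := by
  rw [reflect_eq, reflect_eq, map_sub]
  abel

theorem norm_reflect_sub_reflect (H : HalfSpace N) (x y : Space N) :
    ‖H.reflect x - H.reflect y‖ = ‖x - y‖ := by
  rw [reflect_sub_reflect, LinearIsometryEquiv.norm_map]

theorem norm_sq_reflect (H : HalfSpace N) (x : Space N) :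
    ‖H.reflect x‖ ^ 2 = ‖x‖ ^ 2 + 4 * H.offset * (H.offset - inner ℝ H.normal x) := by
  rw [reflect, norm_sub_sq_real, inner_smul_right, norm_smul, H.norm_normal, real_inner_comm,
    Real.norm_eq_abs, mul_one, sq_abs]
  ring

/-- Two points on the same side of `∂H` are at least as close as one of them and the reflection of
the other. -/
theorem norm_sub_le_norm_sub_reflect (H : HalfSpace N) {x y : Space N} (hx : x ∈ H.carrier)
    (hy : y ∈ H.carrier) : ‖x - y‖ ≤ ‖x - H.reflect y‖ := by
  rw [mem_carrier] at hx hy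
  have key : ‖x - H.reflect y‖ ^ 2 = ‖x - y‖ ^ 2 +
      4 * (H.offset - inner ℝ H.normal x) * (H.offset - inner ℝ H.normal y) := by
    have : x - H.reflect y = (x - y) + (2 * (inner ℝ H.normal y - H.offset)) • H.normal := by
      rw [reflect]; abel
    rw [this, norm_add_sq_real, inner_smul_right, norm_smul, H.norm_normal, real_inner_comm,
      Real.norm_eq_abs, mul_one, sq_abs, inner_sub_left, real_inner_comm x]
    ring
  refine le_of_sq_le_sq ?_ (norm_nonneg _)
  rw [key]
  nlinarith [mul_nonneg (sub_nonneg.2 hx) (sub_nonneg.2 hy)]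

@[fun_prop]
theorem continuous_reflect (H : HalfSpace N) : Continuous H.reflect := by
  unfold reflect
  fun_prop

theorem contDiff_reflect (H : HalfSpace N) {n : WithTop ℕ∞} : ContDiff ℝ n H.reflect := by
  rw [show H.reflect = fun x => H.linearReflection x + (2 * H.offset) • H.normal from
    funext H.reflect_eq]
  exact H.linearReflection.contDiff.add contDiff_const

theorem hasFDerivAt_reflect (H : HalfSpace N) (x : Space N) :
    HasFDerivAt H.reflect (H.linearReflection : Space N →L[ℝ] Space N) x := by
  have : H.reflect = fun x => H.linearReflection x + (2 * H.offset) • H.normal :=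
    funext H.reflect_eq
  rw [this]
  exact (H.linearReflection : Space N →L[ℝ] Space N).hasFDerivAt.add_const _

theorem measurePreserving_reflect (H : HalfSpace N) :
    MeasurePreserving H.reflect volume volume := by
  have : H.reflect = (fun x => x + (2 * H.offset) • H.normal) ∘ H.linearReflection :=
    funext H.reflect_eq
  rw [this]
  exact (measurePreserving_add_right volume _).comp H.linearReflection.measurePreserving

theorem measurableEmbedding_reflect (H : HalfSpace N) : MeasurableEmbedding H.reflect :=
  (Homeomorph.mk ⟨H.reflect, H.reflect, H.reflect_reflect, H.reflect_reflect⟩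
    H.continuous_reflect H.continuous_reflect).measurableEmbedding

theorem isClosed_carrier (H : HalfSpace N) : IsClosed H.carrier :=
  isClosed_le (by fun_prop) continuous_const

theorem measurableSet_carrier (H : HalfSpace N) : MeasurableSet H.carrier :=
  H.isClosed_carrier.measurableSet

end HalfSpace

theorem offset_pos_of_mem_originHalfSpaces {H : HalfSpace N} (h : H ∈ originHalfSpaces N) :
    0 < H.offset := by
  have h : (0 : Space N) ∈ interior H.carrier := h
  rw [mem_interior_iff_mem_nhds] at h
  have hc : Tendsto (fun t : ℝ => t • H.normal) (𝓝[>] 0) (𝓝 0) := by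
    have : Continuous fun t : ℝ => t • H.normal := by fun_prop
    simpa using (this.tendsto 0).mono_left nhdsWithin_le_nhds
  obtain ⟨t, ht, ht0⟩ := ((hc.eventually h).and self_mem_nhdsWithin).exists
  have ht : inner ℝ H.normal (t • H.normal) ≤ H.offset := ht
  rw [inner_smul_right, H.inner_normal_self, mul_one] at ht
  exact lt_of_lt_of_le ht0 ht

theorem mem_originHalfSpaces_of_offset_pos {H : HalfSpace N} (h : 0 < H.offset) :
    H ∈ originHalfSpaces N := by
  refine mem_interior.2 ⟨{x | inner ℝ H.normal x < H.offset}, fun x hx => le_of_lt (Set.mem_ofPred.1 hx),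
    isOpen_lt (by fun_prop) continuous_const, ?_⟩
  simpa using h

/-- If `0` lies in `H`, reflecting a point out of `H` increases its norm. -/
theorem norm_le_norm_reflect {H : HalfSpace N} (h : H ∈ originHalfSpaces N) {x : Space N}
    (hx : x ∈ H.carrier) : ‖x‖ ≤ ‖H.reflect x‖ := by
  refine le_of_sq_le_sq ?_ (norm_nonneg _)
  rw [H.norm_sq_reflect]
  have := offset_pos_of_mem_originHalfSpaces h
  rw [HalfSpace.mem_carrier] at hx
  nlinarith [mul_nonneg this.le (sub_nonneg.2 hx)]

/-! ### Polarization as composition with a measure-preserving involution -/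

/-- The set of points whose values are exchanged by the polarization. -/
def swapSet (H : HalfSpace N) (u : Space N → ℝ) : Set (Space N) :=
  {x | x ∈ H.carrier ∧ u x < u (H.reflect x) ∨ x ∉ H.carrier ∧ u (H.reflect x) < u x}

open Classical in
/-- The map `τ` with `u^H = u ∘ τ`: the reflection on `swapSet H u`, the identity elsewhere. -/
def swapMap (H : HalfSpace N) (u : Space N → ℝ) (x : Space N) : Space N :=
  if x ∈ swapSet H u then H.reflect x else x

theorem polarize_eq_comp_swapMap (H : HalfSpace N) (u : Space N → ℝ) :
    polarize H u = u ∘ swapMap H u := by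
  classical
  funext x
  by_cases hx : x ∈ H.carrier
  · by_cases h : u x < u (H.reflect x)
    · have : x ∈ swapSet H u := Or.inl ⟨hx, h⟩
      simp [polarize, swapMap, hx, this, h.le]
    · have : x ∉ swapSet H u := by simp [swapSet, hx, h]
      simp [polarize, swapMap, hx, this, not_lt.1 h]
  · by_cases h : u (H.reflect x) < u x
    · have : x ∈ swapSet H u := Or.inr ⟨hx, h⟩
      simp [polarize, swapMap, hx, this, h.le]
    · have : x ∉ swapSet H u := by simp [swapSet, hx, h]
      simp [polarize, swapMap, hx, this, not_lt.1 h]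

theorem reflect_mem_swapSet {H : HalfSpace N} {u : Space N → ℝ} {x : Space N}
    (h : x ∈ swapSet H u) : H.reflect x ∈ swapSet H u := by
  rcases h with ⟨hx, h⟩ | ⟨hx, h⟩
  · refine Or.inr ⟨fun hx' => ?_, by simpa using h⟩
    rw [HalfSpace.reflect_eq_self_of_reflect_mem hx hx'] at h
    exact lt_irrefl _ h
  · exact Or.inl ⟨HalfSpace.reflect_mem_carrier_of_notMem hx, by simpa using h⟩

theorem measurableSet_swapSet (H : HalfSpace N) {u : Space N → ℝ} (hu : Measurable u) :
    MeasurableSet (swapSet H u) := by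
  have h1 : Measurable fun x => u (H.reflect x) := hu.comp H.continuous_reflect.measurable
  exact (H.measurableSet_carrier.inter (measurableSet_lt hu h1)).union
    (H.measurableSet_carrier.compl.inter (measurableSet_lt h1 hu))

/-- `τ` is an involution that preserves the measure on `swapSet H u` and on its complement, both of
which it maps to themselves. -/
theorem measurePreserving_swapMap (H : HalfSpace N) {u : Space N → ℝ} (hu : Measurable u) :
    MeasurePreserving (swapMap H u) volume volume := by
  classical
  have hA := measurableSet_swapSet H hu
  have hm : Measurable (swapMap H u) :=
    Measurable.ite hA H.continuous_reflect.measurable measurable_id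
  refine ⟨hm, Measure.ext fun s hs => ?_⟩
  rw [Measure.map_apply hm hs, ← measure_inter_add_sdiff _ hA, ← measure_inter_add_sdiff s hA]
  congr 1
  · rw [← H.measurePreserving_reflect.measure_preimage (hs.inter hA).nullMeasurableSet]
    congr 1
    ext x
    constructor
    · rintro ⟨h1, h2⟩
      refine ⟨?_, reflect_mem_swapSet h2⟩
      simpa [swapMap, h2] using h1
    · rintro ⟨h1, h2⟩
      have h2 : x ∈ swapSet H u := by simpa using reflect_mem_swapSet h2
      exact ⟨by simpa [swapMap, h2] using h1, h2⟩
  · congr 1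
    ext x
    constructor
    · rintro ⟨h1, h2⟩
      exact ⟨by simpa [swapMap, h2] using h1, h2⟩
    · rintro ⟨h1, h2⟩
      exact ⟨by simpa [swapMap, h2] using h1, h2⟩

theorem polarize_of_mem {H : HalfSpace N} {u : Space N → ℝ} {x : Space N} (hx : x ∈ H.carrier) :
    polarize H u x = max (u x) (u (H.reflect x)) := if_pos hx

theorem polarize_of_notMem {H : HalfSpace N} {u : Space N → ℝ} {x : Space N}
    (hx : x ∉ H.carrier) : polarize H u x = min (u x) (u (H.reflect x)) := if_neg hx

theorem polarize_reflect_of_mem {H : HalfSpace N} {u : Space N → ℝ} {x : Space N}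
    (hx : x ∈ H.carrier) : polarize H u (H.reflect x) = min (u x) (u (H.reflect x)) := by
  by_cases h : H.reflect x ∈ H.carrier
  · have := HalfSpace.reflect_eq_self_of_reflect_mem hx h
    rw [this, polarize_of_mem hx, this, max_self, min_self]
  · rw [polarize_of_notMem h, H.reflect_reflect, min_comm]

theorem measurable_polarize (H : HalfSpace N) {u : Space N → ℝ} (hu : Measurable u) :
    Measurable (polarize H u) := by
  rw [polarize_eq_comp_swapMap]
  exact hu.comp (measurePreserving_swapMap H hu).measurable

theorem measure_lt_polarize (H : HalfSpace N) {u : Space N → ℝ} (hu : Measurable u) (t : ℝ) :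
    volume {x | t < polarize H u x} = volume {x | t < u x} := by
  rw [polarize_eq_comp_swapMap]
  exact (measurePreserving_swapMap H hu).measure_preimage
    (measurableSet_lt measurable_const hu).nullMeasurableSet

theorem polarize_nonneg (H : HalfSpace N) {u : Space N → ℝ} (hu : 0 ≤ u) : 0 ≤ polarize H u := by
  rw [polarize_eq_comp_swapMap]
  exact fun x => hu (swapMap H u x)

theorem memLp_polarize (H : HalfSpace N) {u : Space N → ℝ} (hu : Measurable u) {q : ℝ≥0∞}
    (h : MemLp u q volume) : MemLp (polarize H u) q volume := by
  rw [polarize_eq_comp_swapMap]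
  exact h.comp_measurePreserving (measurePreserving_swapMap H hu)

theorem polarize_congr_ae (H : HalfSpace N) {u v : Space N → ℝ} (h : u =ᵐ[volume] v) :
    polarize H u =ᵐ[volume] polarize H v := by
  have h' : u ∘ H.reflect =ᵐ[volume] v ∘ H.reflect :=
    H.measurePreserving_reflect.quasiMeasurePreserving.ae_eq_comp h
  filter_upwards [h, h'] with x hx hx'
  simp only [Function.comp_apply] at hx'
  simp [polarize, hx, hx']

/-! ### Properties inherited along the polarization sequence -/

theorem polarizeUpTo_succ (H : ℕ → HalfSpace N) (k : ℕ) (u : Space N → ℝ) :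
    polarizeUpTo H (k + 1) u = polarize (H k) (polarizeUpTo H k u) := by
  simp [polarizeUpTo, List.range_succ]

theorem polarizeUpTo_rel {H : ℕ → HalfSpace N}
    (R : (Space N → ℝ) → (Space N → ℝ) → Prop)
    (hR : ∀ n u v, R u v → R (polarize (H n) u) (polarize (H n) v)) {u v : Space N → ℝ}
    (h : R u v) (k : ℕ) : R (polarizeUpTo H k u) (polarizeUpTo H k v) := by
  induction k with
  | zero => exact h
  | succ k ih => rw [polarizeUpTo_succ, polarizeUpTo_succ]; exact hR _ _ _ ih

theorem polarizationSeq_rel {H : ℕ → HalfSpace N}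
    (R : (Space N → ℝ) → (Space N → ℝ) → Prop)
    (hR : ∀ n u v, R u v → R (polarize (H n) u) (polarize (H n) v)) {u v : Space N → ℝ}
    (h : R u v) (n : ℕ) : R (polarizationSeq H u n) (polarizationSeq H v n) := by
  induction n with
  | zero => exact h
  | succ n ih => exact polarizeUpTo_rel R hR ih (n + 1)

theorem polarizeUpTo_induction {H : ℕ → HalfSpace N} (P : (Space N → ℝ) → Prop)
    (hP : ∀ n u, P u → P (polarize (H n) u)) {u : Space N → ℝ} (h : P u) (k : ℕ) :
    P (polarizeUpTo H k u) :=
  polarizeUpTo_rel (fun u _ => P u) (fun n u _ => hP n u) (v := u) h k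

theorem polarizationSeq_induction {H : ℕ → HalfSpace N} (P : (Space N → ℝ) → Prop)
    (hP : ∀ n u, P u → P (polarize (H n) u)) {u : Space N → ℝ} (h : P u) (n : ℕ) :
    P (polarizationSeq H u n) :=
  polarizationSeq_rel (fun u _ => P u) (fun n u _ => hP n u) (v := u) h n

theorem polarizationSeq_congr_ae (H : ℕ → HalfSpace N) {u v : Space N → ℝ}
    (h : u =ᵐ[volume] v) (n : ℕ) :
    polarizationSeq H u n =ᵐ[volume] polarizationSeq H v n :=
  polarizationSeq_rel (fun u v => u =ᵐ[volume] v) (fun n _ _ => polarize_congr_ae (H n)) h n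

/-! ### Contraction of polarization in `L^p` -/

theorem ConvexOn.add_le_add_of_mem_Icc {f : ℝ → ℝ} (hf : ConvexOn ℝ Set.univ f) {a b c d : ℝ}
    (hab : a ≤ b) (hac : a ≤ c) (hsum : b + c = a + d) : f b + f c ≤ f a + f d := by
  rcases eq_or_lt_of_le (show a ≤ d by linarith) with had | had
  · have hb : b = a := by linarith
    have hc : c = d := by linarith
    rw [hb, hc]
  · have hpos : 0 < d - a := sub_pos.2 had
    have hl : 0 ≤ (d - b) / (d - a) := div_nonneg (by linarith) hpos.le
    have hr : 0 ≤ (b - a) / (d - a) := div_nonneg (by linarith) hpos.le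
    have e3 : (d - b) / (d - a) + (b - a) / (d - a) = 1 := by field_simp; ring
    have h1 := hf.2 (Set.mem_univ a) (Set.mem_univ d) hl hr e3
    have h2 := hf.2 (Set.mem_univ a) (Set.mem_univ d) hr hl (by rw [add_comm, e3])
    have e1 : ((d - b) / (d - a)) • a + ((b - a) / (d - a)) • d = b := by
      simp only [smul_eq_mul]; field_simp; ring
    have e2 : ((b - a) / (d - a)) • a + ((d - b) / (d - a)) • d = c := by
      have : c = a + d - b := by linarith
      simp only [smul_eq_mul, this]; field_simp; ring
    rw [e1] at h1
    rw [e2] at h2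
    simp only [smul_eq_mul] at h1 h2
    calc f b + f c ≤ ((d - b) / (d - a) + (b - a) / (d - a)) * f a
        + ((d - b) / (d - a) + (b - a) / (d - a)) * f d := by linarith
      _ = f a + f d := by rw [e3]; ring

theorem convexOn_abs_rpow {p : ℝ} (hp : 1 ≤ p) : ConvexOn ℝ Set.univ fun t : ℝ => |t| ^ p := by
  refine ⟨convex_univ, fun x _ y _ a b ha hb hab => ?_⟩
  have h := (convexOn_rpow hp).2 (Set.mem_Ici.2 (abs_nonneg x)) (Set.mem_Ici.2 (abs_nonneg y))
    ha hb hab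
  refine le_trans (Real.rpow_le_rpow (abs_nonneg _) ?_ (by linarith)) h
  refine (abs_add_le _ _).trans ?_
  simp [abs_mul, abs_of_nonneg ha, abs_of_nonneg hb]

/-- The two-point inequality: sorting both pairs in the same order decreases the `ℓ^p` distance. -/
theorem abs_max_sub_max_rpow_add_le {p : ℝ} (hp : 1 ≤ p) (a b c d : ℝ) :
    |max a b - max c d| ^ p + |min a b - min c d| ^ p ≤ |a - c| ^ p + |b - d| ^ p := by
  have hf := convexOn_abs_rpow hp
  rcases le_total a b with h1 | h1 <;> rcases le_total c d with h2 | h2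
  · rw [max_eq_right h1, min_eq_left h1, max_eq_right h2, min_eq_left h2, add_comm]
  · rw [max_eq_right h1, min_eq_left h1, max_eq_left h2, min_eq_right h2]
    exact ConvexOn.add_le_add_of_mem_Icc hf (by linarith) (by linarith) (by ring)
  · rw [max_eq_left h1, min_eq_right h1, max_eq_right h2, min_eq_left h2, add_comm (|a - c| ^ p)]
    exact ConvexOn.add_le_add_of_mem_Icc hf (by linarith) (by linarith) (by ring)
  · rw [max_eq_left h1, min_eq_right h1, max_eq_left h2, min_eq_right h2]

/-- Integral inequalities may be checked after summing over the orbits of the reflection. -/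
theorem lintegral_le_of_add_reflect_le (H : HalfSpace N) {F G : Space N → ℝ≥0∞}
    (hF : Measurable F) (hG : Measurable G)
    (h : ∀ x ∈ H.carrier, F x + F (H.reflect x) ≤ G x + G (H.reflect x)) :
    ∫⁻ x, F x ≤ ∫⁻ x, G x := by
  have hdouble : ∀ K : Space N → ℝ≥0∞, Measurable K →
      ∫⁻ x, (K x + K (H.reflect x)) = 2 * ∫⁻ x, K x := fun K hK => by
    rw [lintegral_add_left hK, H.measurePreserving_reflect.lintegral_comp hK, two_mul]
  have hle : ∫⁻ x, (F x + F (H.reflect x)) ≤ ∫⁻ x, (G x + G (H.reflect x)) := by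
    refine lintegral_mono fun x => ?_
    by_cases hx : x ∈ H.carrier
    · exact h x hx
    · have := h _ (HalfSpace.reflect_mem_carrier_of_notMem hx)
      rw [H.reflect_reflect] at this
      simpa only [add_comm] using this
  rw [hdouble F hF, hdouble G hG] at hle
  exact (ENNReal.mul_le_mul_iff_right two_ne_zero ENNReal.ofNat_ne_top).1 hle

theorem eLpNorm_polarize_sub_le (H : HalfSpace N) {p : ℝ} (hp : 1 ≤ p) {u v : Space N → ℝ}
    (hu : Measurable u) (hv : Measurable v) :
    eLpNorm (polarize H u - polarize H v) (ENNReal.ofReal p) volume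
      ≤ eLpNorm (u - v) (ENNReal.ofReal p) volume := by
  have hp0 : 0 < p := by linarith
  have hmeas : ∀ f : Space N → ℝ, Measurable f → Measurable fun x => ‖f x‖ₑ ^ p :=
    fun f hf => hf.enorm.pow_const p
  rw [eLpNorm_eq_lintegral_rpow_enorm_toReal (by simpa using hp0) ENNReal.ofReal_ne_top,
    eLpNorm_eq_lintegral_rpow_enorm_toReal (by simpa using hp0) ENNReal.ofReal_ne_top,
    ENNReal.toReal_ofReal hp0.le]
  refine ENNReal.rpow_le_rpow ?_ (by positivity)
  refine lintegral_le_of_add_reflect_le H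
    (hmeas _ ((measurable_polarize H hu).sub (measurable_polarize H hv)))
    (hmeas _ (hu.sub hv)) fun x hx => ?_
  have hofReal : ∀ t : ℝ, ‖t‖ₑ ^ p = ENNReal.ofReal (|t| ^ p) := fun t => by
    rw [← ofReal_norm, ENNReal.ofReal_rpow_of_nonneg (norm_nonneg _) hp0.le,
      Real.norm_eq_abs]
  simp only [Pi.sub_apply, hofReal]
  rw [polarize_of_mem hx, polarize_of_mem hx, polarize_reflect_of_mem hx,
    polarize_reflect_of_mem hx, ← ENNReal.ofReal_add (by positivity) (by positivity),
    ← ENNReal.ofReal_add (by positivity) (by positivity)]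
  exact ENNReal.ofReal_le_ofReal (abs_max_sub_max_rpow_add_le hp _ _ _ _)

theorem eLpNorm_polarizationSeq_sub_le (H : ℕ → HalfSpace N) {p : ℝ} (hp : 1 ≤ p)
    {u v : Space N → ℝ} (hu : Measurable u) (hv : Measurable v) (n : ℕ) :
    eLpNorm (polarizationSeq H u n - polarizationSeq H v n) (ENNReal.ofReal p) volume
      ≤ eLpNorm (u - v) (ENNReal.ofReal p) volume := by
  refine (polarizationSeq_rel (fun f g => (Measurable f ∧ Measurable g) ∧
    eLpNorm (f - g) (ENNReal.ofReal p) volume ≤ eLpNorm (u - v) (ENNReal.ofReal p) volume)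
    (fun k f g h => ⟨⟨measurable_polarize _ h.1.1, measurable_polarize _ h.1.2⟩, ?_⟩)
    ⟨⟨hu, hv⟩, le_rfl⟩ n).2
  exact (eLpNorm_polarize_sub_le _ hp h.1.1 h.1.2).trans h.2

/-! ### Uniform estimates for polarizations -/

theorem abs_polarize_sub_le (H : HalfSpace N) {u v : Space N → ℝ} {ε : ℝ}
    (h : ∀ x, |u x - v x| ≤ ε) (x : Space N) : |polarize H u x - polarize H v x| ≤ ε := by
  by_cases hx : x ∈ H.carrier
  · rw [polarize_of_mem hx, polarize_of_mem hx]
    exact (abs_max_sub_max_le_max _ _ _ _).trans (max_le (h _) (h _))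
  · rw [polarize_of_notMem hx, polarize_of_notMem hx]
    exact (abs_min_sub_min_le_max _ _ _ _).trans (max_le (h _) (h _))

/-- Polarization does not increase the modulus of continuity. -/
theorem abs_polarize_sub_polarize_le (H : HalfSpace N) {u : Space N → ℝ} {δ ε : ℝ}
    (h : ∀ x y, dist x y < δ → |u x - u y| ≤ ε) (x y : Space N) (hxy : dist x y < δ) :
    |polarize H u x - polarize H u y| ≤ ε := by
  have hσ : dist (H.reflect x) (H.reflect y) < δ := by
    rwa [dist_eq_norm, H.norm_reflect_sub_reflect, ← dist_eq_norm]
  -- the remaining case: the two points lie on different sides of the boundary of `H`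
  have mixed : ∀ x y, x ∈ H.carrier → y ∉ H.carrier → dist x y < δ →
      dist (H.reflect x) (H.reflect y) < δ → |polarize H u x - polarize H u y| ≤ ε := by
    intro x y hx hy h1 h2
    have hy' := HalfSpace.reflect_mem_carrier_of_notMem hy
    have h3 : dist x (H.reflect y) < δ := by
      have := H.norm_sub_le_norm_sub_reflect hx hy'
      rw [H.reflect_reflect, ← dist_eq_norm, ← dist_eq_norm] at this
      exact this.trans_lt h1
    have h4 : dist (H.reflect x) y < δ := by
      rwa [dist_eq_norm, ← H.norm_reflect_sub_reflect, H.reflect_reflect, ← dist_eq_norm]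
    have a1 := abs_le.1 (h _ _ h1)
    have a2 := abs_le.1 (h _ _ h2)
    have a3 := abs_le.1 (h _ _ h3)
    have a4 := abs_le.1 (h _ _ h4)
    rw [polarize_of_mem hx, polarize_of_notMem hy, abs_le]
    rcases max_cases (u x) (u (H.reflect x)) with ⟨e, _⟩ | ⟨e, _⟩ <;>
    rcases min_cases (u y) (u (H.reflect y)) with ⟨e', _⟩ | ⟨e', _⟩ <;> rw [e, e'] <;>
    constructor <;> linarith
  by_cases hx : x ∈ H.carrier <;> by_cases hy : y ∈ H.carrier
  · rw [polarize_of_mem hx, polarize_of_mem hy]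
    exact (abs_max_sub_max_le_max _ _ _ _).trans (max_le (h _ _ hxy) (h _ _ hσ))
  · exact mixed x y hx hy hxy hσ
  · rw [abs_sub_comm]
    exact mixed y x hy hx (by rwa [dist_comm]) (by rwa [dist_comm])
  · rw [polarize_of_notMem hx, polarize_of_notMem hy]
    exact (abs_min_sub_min_le_max _ _ _ _).trans (max_le (h _ _ hxy) (h _ _ hσ))

/-- Nonnegative functions, bounded by `C`, that vanish outside the closed ball of radius `R`. -/
structure IsBump (R C : ℝ) (u : Space N → ℝ) : Prop where
  nonneg : ∀ x, 0 ≤ u x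
  le : ∀ x, u x ≤ C
  eq_zero : ∀ x, R < ‖x‖ → u x = 0

theorem IsBump.abs_le {R C : ℝ} {u : Space N → ℝ} (h : IsBump R C u) (x : Space N) :
    |u x| ≤ C := by
  rw [abs_of_nonneg (h.nonneg x)]
  exact h.le x

theorem IsBump.support_subset {R C : ℝ} {u : Space N → ℝ} (h : IsBump R C u) :
    Function.support u ⊆ Metric.closedBall 0 R := fun x hx => by
  by_contra hxR
  exact hx (h.eq_zero x (by simpa using hxR))

theorem IsBump.hasCompactSupport {R C : ℝ} {u : Space N → ℝ} (h : IsBump R C u) :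
    HasCompactSupport u :=
  HasCompactSupport.of_support_subset_isCompact (isCompact_closedBall _ _) h.support_subset

theorem IsBump.polarize {H : HalfSpace N} (hH : H ∈ originHalfSpaces N) {R C : ℝ}
    {u : Space N → ℝ} (h : IsBump R C u) : IsBump R C (polarize H u) := by
  refine ⟨polarize_nonneg H h.nonneg, fun x => ?_, fun x hx => ?_⟩
  · rw [polarize_eq_comp_swapMap]
    exact h.le _
  · by_cases hxH : x ∈ H.carrier
    · rw [polarize_of_mem hxH, h.eq_zero x hx,
        h.eq_zero _ (hx.trans_le (norm_le_norm_reflect hH hxH)), max_self]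
    · rw [polarize_of_notMem hxH, h.eq_zero x hx, min_eq_left (h.nonneg _)]

/-- A common modulus of continuity, in `ε`-`δ` form: `δ` is the radius allowed for the
error `ε`. -/
def HasModulus (δ : ℝ → ℝ) (u : Space N → ℝ) : Prop :=
  ∀ ε > 0, ∀ x y, dist x y < δ ε → |u x - u y| ≤ ε

theorem HasModulus.polarize (H : HalfSpace N) {δ : ℝ → ℝ} {u : Space N → ℝ}
    (h : HasModulus δ u) : HasModulus δ (polarize H u) :=
  fun ε hε => abs_polarize_sub_polarize_le H (h ε hε)

theorem HasModulus.continuous {δ : ℝ → ℝ} (hδ : ∀ ε > 0, 0 < δ ε) {u : Space N → ℝ}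
    (h : HasModulus δ u) : Continuous u := by
  refine Metric.continuous_iff.2 fun x ε hε => ⟨δ (ε / 2), hδ _ (half_pos hε), fun y hy => ?_⟩
  exact (h _ (half_pos hε) y x hy).trans_lt (half_lt_self hε)

theorem exists_hasModulus {u : Space N → ℝ} (hu : UniformContinuous u) :
    ∃ δ : ℝ → ℝ, (∀ ε > 0, 0 < δ ε) ∧ HasModulus δ u := by
  have h : ∀ ε : ℝ, ∃ δ : ℝ, ε > 0 → 0 < δ ∧ ∀ x y, dist x y < δ → |u x - u y| ≤ ε := by
    intro ε
    by_cases hε : ε > 0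
    · obtain ⟨δ, hδ, h⟩ := Metric.uniformContinuous_iff.1 hu ε hε
      exact ⟨δ, fun _ => ⟨hδ, fun x y hxy => (h hxy).le⟩⟩
    · exact ⟨1, fun h => absurd h hε⟩
  choose δ hδ using h
  exact ⟨δ, fun ε hε => (hδ ε hε).1, fun ε hε => (hδ ε hε).2⟩

/-- The Arzelà–Ascoli theorem for functions supported in a fixed ball. -/
theorem exists_subseq_tendstoUniformly {R C : ℝ} {δ : ℝ → ℝ} (hδ : ∀ ε > 0, 0 < δ ε)
    {f : ℕ → Space N → ℝ} (hf : ∀ n, IsBump R C (f n)) (hmod : ∀ n, HasModulus δ (f n)) :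
    ∃ φ : ℕ → ℕ, StrictMono φ ∧ ∃ F : Space N → ℝ, TendstoUniformly (fun n => f (φ n)) F atTop := by
  classical
  let K := Metric.closedBall (0 : Space N) R
  have : CompactSpace K := isCompact_iff_compactSpace.1 (isCompact_closedBall _ _)
  let g : ℕ → BoundedContinuousFunction K ℝ := fun n =>
    BoundedContinuousFunction.mkOfCompact
      ⟨fun x : K => f n x, ((hmod n).continuous hδ).comp continuous_subtype_val⟩
  have hequi : Equicontinuous ((↑) : Set.range g → K → ℝ) := by
    refine UniformEquicontinuous.equicontinuous (Metric.uniformEquicontinuous_iff.2 fun ε hε =>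
      ⟨δ (ε / 2), hδ _ (half_pos hε), ?_⟩)
    rintro x y hxy ⟨_, n, rfl⟩
    exact (hmod n _ (half_pos hε) x y hxy).trans_lt (half_lt_self hε)
  have hcomp := BoundedContinuousFunction.arzela_ascoli (Set.Icc 0 C) isCompact_Icc (Set.range g)
    (by rintro _ x ⟨n, rfl⟩; exact ⟨(hf n).nonneg x, (hf n).le x⟩) hequi
  obtain ⟨G, -, φ, hφ, hG⟩ := hcomp.tendsto_subseq fun n => subset_closure (Set.mem_range_self n)
  refine ⟨φ, hφ, fun x => if h : x ∈ K then G ⟨x, h⟩ else 0, ?_⟩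
  rw [BoundedContinuousFunction.tendsto_iff_tendstoUniformly] at hG
  rw [Metric.tendstoUniformly_iff] at hG ⊢
  intro ε hε
  filter_upwards [hG ε hε] with n hn x
  by_cases hx : x ∈ K
  · simpa [hx, g] using! hn ⟨x, hx⟩
  · have : f (φ n) x = 0 := (hf _).eq_zero x (by simpa [K] using hx)
    simpa [hx, this] using hε

theorem tendstoUniformly_polarizeUpTo (H : ℕ → HalfSpace N) (k : ℕ) {f : ℕ → Space N → ℝ}
    {F : Space N → ℝ} (h : TendstoUniformly f F atTop) :
    TendstoUniformly (fun n => polarizeUpTo H k (f n)) (polarizeUpTo H k F) atTop := by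
  rw [Metric.tendstoUniformly_iff] at h ⊢
  intro ε hε
  filter_upwards [h (ε / 2) (half_pos hε)] with n hn x
  refine lt_of_le_of_lt ?_ (half_lt_self hε)
  exact polarizeUpTo_rel (fun u v => ∀ x, |u x - v x| ≤ ε / 2)
    (fun n u v h => abs_polarize_sub_le (H n) h) (fun x => (hn x).le) k x

theorem IsBump.of_tendstoUniformly {R C : ℝ} {f : ℕ → Space N → ℝ} {F : Space N → ℝ}
    (hf : ∀ n, IsBump R C (f n)) (h : TendstoUniformly f F atTop) : IsBump R C F :=
  ⟨fun x => ge_of_tendsto' (h.tendsto_at x) fun n => (hf n).nonneg x,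
    fun x => le_of_tendsto' (h.tendsto_at x) fun n => (hf n).le x,
    fun x hx => tendsto_nhds_unique (h.tendsto_at x)
      (by simp only [(hf _).eq_zero x hx]; exact tendsto_const_nhds)⟩

theorem tendsto_eLpNorm_of_tendstoUniformly {R C : ℝ} {f : ℕ → Space N → ℝ} {F : Space N → ℝ}
    (hf : ∀ n, IsBump R C (f n)) (h : TendstoUniformly f F atTop) {q : ℝ≥0∞} (hq : q ≠ ⊤) :
    Tendsto (fun n => eLpNorm (f n - F) q volume) atTop (𝓝 0) := by
  have hF := IsBump.of_tendstoUniformly hf h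
  set M := volume (Metric.closedBall (0 : Space N) R) ^ (1 / q.toReal) with hM
  have hMtop : M ≠ ⊤ :=
    ENNReal.rpow_ne_top_of_nonneg (one_div_nonneg.2 ENNReal.toReal_nonneg) (measure_closedBall_lt_top).ne
  rw [Metric.tendstoUniformly_iff] at h
  have hlim : Tendsto (fun c : ℝ => ENNReal.ofReal c * M) (𝓝 0) (𝓝 0) := by
    have := ENNReal.Tendsto.mul_const (b := M) (ENNReal.continuous_ofReal.tendsto 0)
      (Or.inr hMtop)
    simpa using this
  rw [ENNReal.tendsto_nhds_zero]
  intro ε hε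
  have hev := (hlim.mono_left (nhdsWithin_le_nhds (s := Set.Ioi 0))).eventually (ge_mem_nhds hε)
  obtain ⟨c, hc, hc0⟩ := (hev.and self_mem_nhdsWithin).exists
  filter_upwards [h c hc0] with n hn
  refine le_trans (eLpNorm_sub_le_of_dist_bdd volume hq Metric.isClosed_closedBall.measurableSet
    (le_of_lt hc0) (fun x => ?_) (hf n).support_subset hF.support_subset) hc
  rw [dist_comm]
  exact (hn x).le

/-! ### A functional that decreases strictly under polarization -/

/-- The second moment `∫ u |x|² dx`. -/
def secondMoment (u : Space N → ℝ) : ℝ := ∫ x, u x * ‖x‖ ^ 2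

theorem integrable_mul_norm_sq {u : Space N → ℝ} (hu : Continuous u) (h : HasCompactSupport u) :
    Integrable fun x => u x * ‖x‖ ^ 2 :=
  (hu.mul (by fun_prop)).integrable_of_hasCompactSupport h.mul_right

theorem tendsto_secondMoment {R C : ℝ} {f : ℕ → Space N → ℝ} {F : Space N → ℝ}
    (hc : ∀ n, Continuous (f n))
    (hf : ∀ n, IsBump R C (f n)) (h : TendstoUniformly f F atTop) :
    Tendsto (fun n => secondMoment (f n)) atTop (𝓝 (secondMoment F)) := by
  refine tendsto_integral_of_dominated_convergence
    ((Metric.closedBall (0 : Space N) R).indicator fun _ => C * R ^ 2)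
    (fun n => ((hc n).mul (by fun_prop)).aestronglyMeasurable) ?_ (fun n => ?_) ?_
  · refine IntegrableOn.integrable_indicator ?_ Metric.isClosed_closedBall.measurableSet
    exact integrableOn_const measure_closedBall_lt_top.ne
  · refine Eventually.of_forall fun x => ?_
    by_cases hx : x ∈ Metric.closedBall (0 : Space N) R
    · rw [Set.indicator_of_mem hx, norm_mul, Real.norm_eq_abs, norm_pow, norm_norm]
      have hxR : ‖x‖ ≤ R := by simpa using hx
      exact mul_le_mul ((hf n).abs_le x) (by gcongr) (by positivity)
        ((abs_nonneg _).trans ((hf n).abs_le x))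
    · rw [Set.indicator_of_notMem hx, (hf n).eq_zero x (by simpa using hx)]
      simp
  · exact Eventually.of_forall fun x => (h.tendsto_at x).mul_const _

theorem polarize_mul_norm_sq_add_reflect_le {H : HalfSpace N} (hH : H ∈ originHalfSpaces N)
    (u : Space N → ℝ) {x : Space N} (hx : x ∈ H.carrier) :
    polarize H u x * ‖x‖ ^ 2 + polarize H u (H.reflect x) * ‖H.reflect x‖ ^ 2
      ≤ u x * ‖x‖ ^ 2 + u (H.reflect x) * ‖H.reflect x‖ ^ 2 := by
  have hle : ‖x‖ ^ 2 ≤ ‖H.reflect x‖ ^ 2 := by gcongr; exact norm_le_norm_reflect hH hx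
  rw [polarize_of_mem hx, polarize_reflect_of_mem hx]
  rcases le_total (u x) (u (H.reflect x)) with h | h
  · rw [max_eq_right h, min_eq_left h]
    nlinarith [mul_nonneg (sub_nonneg.2 h) (sub_nonneg.2 hle)]
  · rw [max_eq_left h, min_eq_right h]

theorem integral_add_reflect (H : HalfSpace N) {G : Space N → ℝ} (hG : Integrable G) :
    Integrable (fun x => G x + G (H.reflect x)) ∧
      ∫ x, (G x + G (H.reflect x)) = 2 * ∫ x, G x := by
  have hi : Integrable fun x => G (H.reflect x) :=
    H.measurePreserving_reflect.integrable_comp_of_integrable hG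
  refine ⟨hG.add hi, ?_⟩
  rw [integral_add hG hi, H.measurePreserving_reflect.integral_comp H.measurableEmbedding_reflect, two_mul]

theorem integral_le_of_add_reflect_le (H : HalfSpace N) {F G : Space N → ℝ}
    (hF : Integrable F) (hG : Integrable G)
    (h : ∀ x ∈ H.carrier, F x + F (H.reflect x) ≤ G x + G (H.reflect x)) :
    ∫ x, F x ≤ ∫ x, G x ∧ (Continuous F → Continuous G → ∫ x, F x = ∫ x, G x →
      ∀ x, F x + F (H.reflect x) = G x + G (H.reflect x)) := by
  obtain ⟨iF, eF⟩ := integral_add_reflect H hF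
  obtain ⟨iG, eG⟩ := integral_add_reflect H hG
  have hpt : ∀ x, F x + F (H.reflect x) ≤ G x + G (H.reflect x) := fun x => by
    by_cases hx : x ∈ H.carrier
    · exact h x hx
    · have := h _ (HalfSpace.reflect_mem_carrier_of_notMem hx)
      rw [H.reflect_reflect] at this
      linarith
  refine ⟨?_, fun cF cG heq => ?_⟩
  · have := integral_mono iF iG hpt
    rw [eF, eG] at this
    exact le_of_mul_le_mul_left this two_pos
  · have hae := (integral_eq_iff_of_ae_le iF iG (Eventually.of_forall hpt)).1 (by
      rw [eF, eG, heq])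
    exact congrFun ((Continuous.ae_eq_iff_eq volume
      (cF.add (cF.comp H.continuous_reflect)) (cG.add (cG.comp H.continuous_reflect))).1 hae)

/-- Polarization moves the larger of two values to the point closer to the origin, so that the
second moment decreases, strictly if a value is moved. -/
theorem secondMoment_polarize_le {H : HalfSpace N} (hH : H ∈ originHalfSpaces N)
    {u : Space N → ℝ} (hu : Continuous u) (hs : HasCompactSupport u)
    (hu' : Continuous (polarize H u)) (hs' : HasCompactSupport (polarize H u)) :
    secondMoment (polarize H u) ≤ secondMoment u ∧
      (secondMoment (polarize H u) = secondMoment u → polarize H u = u) := by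
  obtain ⟨hle, heq⟩ := integral_le_of_add_reflect_le H (integrable_mul_norm_sq hu' hs')
    (integrable_mul_norm_sq hu hs) fun x hx => polarize_mul_norm_sq_add_reflect_le hH u hx
  refine ⟨hle, fun h => ?_⟩
  have hall := heq (by fun_prop) (by fun_prop) h
  have hmem : ∀ x ∈ H.carrier, polarize H u x = u x ∧
      polarize H u (H.reflect x) = u (H.reflect x) := by
    intro x hx
    have hx' := hall x
    rw [polarize_of_mem hx, polarize_reflect_of_mem hx] at hx' ⊢
    rcases le_total (u (H.reflect x)) (u x) with h | h
    · rw [max_eq_left h, min_eq_right h]; simp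
    · rw [max_eq_right h, min_eq_left h] at hx' ⊢
      rcases eq_or_lt_of_le (HalfSpace.mem_carrier.1 hx) with ho | ho
      · rw [H.reflect_eq_self ho]; simp
      · have hnorm := H.norm_sq_reflect x
        have hpos : 0 < 4 * H.offset * (H.offset - inner ℝ H.normal x) :=
          mul_pos (mul_pos four_pos (offset_pos_of_mem_originHalfSpaces hH)) (sub_pos.2 ho)
        have hz : (u (H.reflect x) - u x) *
            (4 * H.offset * (H.offset - inner ℝ H.normal x)) = 0 := by
          rw [hnorm] at hx'
          linarith
        have := (mul_eq_zero.1 hz).resolve_right hpos.ne'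
        constructor <;> linarith
  funext x
  by_cases hx : x ∈ H.carrier
  · exact (hmem x hx).1
  · have := (hmem _ (HalfSpace.reflect_mem_carrier_of_notMem hx)).2
    rwa [H.reflect_reflect] at this

/-! ### Characterization of the Schwarz symmetrization -/

/-- `v` is radially nonincreasing up to a null set. -/
def AERadiallyAntitone (v : Space N → ℝ) : Prop :=
  ∃ E : Set (Space N), (∀ᵐ x, x ∈ E) ∧ ∀ x ∈ E, ∀ y ∈ E, ‖x‖ ≤ ‖y‖ → v y ≤ v x

theorem AERadiallyAntitone.congr {v w : Space N → ℝ} (h : AERadiallyAntitone v)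
    (hvw : v =ᵐ[volume] w) : AERadiallyAntitone w := by
  obtain ⟨E, hE, hmono⟩ := h
  refine ⟨E ∩ {x | v x = w x}, by filter_upwards [hE, hvw] with x h1 h2 using ⟨h1, h2⟩, ?_⟩
  rintro x ⟨hx, hx'⟩ y ⟨hy, hy'⟩ hxy
  rw [← show v x = w x from hx', ← show v y = w y from hy']
  exact hmono x hx y hy hxy

theorem AERadiallyAntitone.of_tendsto_ae {f : ℕ → Space N → ℝ} {v : Space N → ℝ}
    (hf : ∀ n, AERadiallyAntitone (f n))
    (h : ∀ᵐ x, Tendsto (fun n => f n x) atTop (𝓝 (v x))) : AERadiallyAntitone v := by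
  choose E hE hmono using hf
  refine ⟨{x | (∀ n, x ∈ E n) ∧ Tendsto (fun n => f n x) atTop (𝓝 (v x))}, ?_, ?_⟩
  · filter_upwards [ae_all_iff.2 hE, h] with x h1 h2 using ⟨h1, h2⟩
  · rintro x ⟨hx, hx'⟩ y ⟨hy, hy'⟩ hxy
    exact le_of_tendsto_of_tendsto' hy' hx' fun n => hmono n x (hx n) y (hy n) hxy

/-- `u` and `v` have the same distribution function on `(0, ∞)`, up to a countable set of levels:
the distribution functions interlace at levels `0 ≤ s < t`. -/
def Equimeasurable (u v : Space N → ℝ) : Prop :=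
  ∀ s t : ℝ, 0 ≤ s → s < t →
    volume {x | t < v x} ≤ volume {x | s < u x} ∧ volume {x | t < u x} ≤ volume {x | s < v x}

theorem volume_ball_lt_volume_ball (hN : 1 ≤ N) {r s : ℝ} (hr : 0 ≤ r) (hrs : r < s) :
    volume (Metric.ball (0 : Space N) r) < volume (Metric.ball (0 : Space N) s) := by
  have : Nonempty (Fin N) := ⟨⟨0, hN⟩⟩
  rw [Measure.addHaar_ball _ _ hr, Measure.addHaar_ball _ _ (hr.trans hrs.le)]
  refine ENNReal.mul_lt_mul_left (Metric.measure_ball_pos _ _ one_pos).ne' measure_ball_lt_top.ne ?_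
  rw [ENNReal.ofReal_lt_ofReal_iff (by have := hr.trans_lt hrs; positivity)]
  refine pow_lt_pow_left₀ hrs hr ?_
  simpa using (show N ≠ 0 by omega)

theorem volume_norm_eq_zero (hN : 1 ≤ N) (r : ℝ) : volume {x : Space N | ‖x‖ = r} = 0 := by
  have : Nonempty (Fin N) := ⟨⟨0, hN⟩⟩
  have h := Measure.addHaar_sphere volume (0 : Space N) r
  rwa [show Metric.sphere (0 : Space N) r = {x | ‖x‖ = r} by ext; simp] at h

/-- A radially nonincreasing function with the distribution function of `u` is `u*`. -/
theorem ae_eq_schwarz (hN : 1 ≤ N) {u v : Space N → ℝ} (hv0 : 0 ≤ᵐ[volume] v)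
    (hv : AERadiallyAntitone v) (huv : Equimeasurable u v) : v =ᵐ[volume] schwarz u := by
  have : Nonempty (Fin N) := ⟨⟨0, hN⟩⟩
  obtain ⟨E, hE, hmono⟩ := hv
  -- almost every `x` avoids the countably many spheres bounding a ball of the measure of `{v > q}`,
  -- `q` rational
  have hsphere : ∀ᵐ x : Space N, ∀ q : ℚ,
      volume (Metric.ball (0 : Space N) ‖x‖) ≠ volume {y | (q : ℝ) < v y} := by
    refine ae_all_iff.2 fun q => ?_
    by_cases h : ∃ x₀ : Space N, volume (Metric.ball (0 : Space N) ‖x₀‖) = volume {y | (q : ℝ) < v y}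
    · obtain ⟨x₀, hx₀⟩ := h
      have h0 : ∀ᵐ x : Space N, ‖x‖ ≠ ‖x₀‖ :=
        measure_eq_zero_iff_ae_notMem.1 (volume_norm_eq_zero hN ‖x₀‖)
      filter_upwards [h0] with x hx heq
      rw [← hx₀] at heq
      rcases lt_or_gt_of_ne hx with h | h
      · exact (volume_ball_lt_volume_ball hN (norm_nonneg _) h).ne heq
      · exact (volume_ball_lt_volume_ball hN (norm_nonneg _) h).ne' heq
    · push Not at h
      exact Eventually.of_forall h
  have hE0 : volume Eᶜ = 0 := hE
  filter_upwards [hE, hv0, hsphere] with x hxE hx0 hxs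
  have hx0 : 0 ≤ v x := hx0
  -- `v x` is an upper bound of the set that defines `u* x`
  have hub : ∀ t ∈ {t : ℝ | 0 ≤ t ∧ volume (Metric.ball (0 : Space N) ‖x‖) < volume {y | t < u y}},
      t ≤ v x := by
    rintro t ⟨ht0, ht⟩
    refine le_of_forall_lt fun s hst => ?_
    rcases lt_or_ge s 0 with hs | hs
    · exact hs.trans_le hx0
    have hlt := ht.trans_le (huv s t hs hst).2
    have hnot : ¬ {y | s < v y} ∩ E ⊆ Metric.ball 0 ‖x‖ := by
      intro hsub
      refine absurd (measure_mono (μ := volume) hsub) (not_le.2 ?_)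
      rwa [measure_inter_conull hE0]
    obtain ⟨y, ⟨hy, hyE⟩, hyx⟩ := Set.not_subset.1 hnot
    exact lt_of_lt_of_le hy (hmono x hxE y hyE (by simpa using hyx))
  have hstar0 : 0 ≤ schwarz u x := Real.sSup_nonneg fun t ht => ht.1
  refine le_antisymm (not_lt.1 fun hlt => ?_) (Real.sSup_le hub hx0)
  obtain ⟨r, hr1, hr2⟩ := exists_between hlt
  obtain ⟨q, hq1, hq2⟩ := exists_rat_btwn hr2
  have hr0 : 0 ≤ r := hstar0.trans hr1.le
  have hur : volume {y | r < u y} ≤ volume (Metric.ball (0 : Space N) ‖x‖) := by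
    by_contra hcon
    exact absurd (le_csSup ⟨v x, hub⟩ ⟨hr0, not_le.1 hcon⟩) (not_le.2 hr1)
  refine hxs q (le_antisymm ?_ (((huv r q hr0 hq1).1).trans hur))
  rw [← measure_inter_conull (s := Metric.ball (0 : Space N) ‖x‖) hE0]
  refine measure_mono fun y hy => ?_
  have hyx : ‖y‖ < ‖x‖ := by simpa using hy.1
  exact lt_of_lt_of_le hq2 (hmono y hy.2 x hxE hyx.le)

theorem equimeasurable_of_tendsto_eLpNorm {q : ℝ≥0∞} (hq : q ≠ 0) {f : ℕ → Space N → ℝ}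
    {u v : Space N → ℝ} (hf : ∀ n, AEStronglyMeasurable (f n) volume)
    (hv : AEStronglyMeasurable v volume)
    (hfu : ∀ n t, volume {x | t < f n x} = volume {x | t < u x})
    (h : Tendsto (fun n => eLpNorm (f n - v) q volume) atTop (𝓝 0)) : Equimeasurable u v := by
  intro s t _ hst
  have hm := tendstoInMeasure_iff_dist.1 (tendstoInMeasure_of_tendsto_eLpNorm hq hf hv h)
    (t - s) (sub_pos.2 hst)
  constructor
  · have hle : ∀ n, volume {x | t < v x} ≤
        volume {x | s < u x} + volume {x | t - s ≤ dist (f n x) (v x)} := fun n => by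
      rw [← hfu n s]
      refine (measure_mono fun x hx => ?_).trans (measure_union_le _ _)
      by_cases hx' : s < f n x
      · exact Or.inl hx'
      · refine Or.inr ?_
        have hx : t < v x := hx
        show t - s ≤ dist (f n x) (v x)
        rw [dist_comm, Real.dist_eq]
        exact le_trans (by linarith) (le_abs_self _)
    simpa using ge_of_tendsto' (tendsto_const_nhds.add hm) hle
  · have hle : ∀ n, volume {x | t < u x} ≤
        volume {x | s < v x} + volume {x | t - s ≤ dist (f n x) (v x)} := fun n => by
      rw [← hfu n t]
      refine (measure_mono fun x hx => ?_).trans (measure_union_le _ _)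
      by_cases hx' : s < v x
      · exact Or.inl hx'
      · refine Or.inr ?_
        have hx : t < f n x := hx
        show t - s ≤ dist (f n x) (v x)
        rw [Real.dist_eq]
        exact le_trans (by linarith) (le_abs_self _)
    simpa using ge_of_tendsto' (tendsto_const_nhds.add hm) hle

/-! ### Functions fixed by all polarizations -/

/-- For `|x| < |y|`, the half-space whose boundary is the perpendicular bisector of `x` and `y`
contains `0` in its interior. -/
theorem exists_halfSpace_reflect_eq {x y : Space N} (h : ‖x‖ < ‖y‖) :
    ∃ H ∈ originHalfSpaces N, y ∉ H.carrier ∧ H.reflect y = x := by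
  have hne : y - x ≠ 0 := fun h0 => by rw [sub_eq_zero.1 h0] at h; exact lt_irrefl _ h
  have hpos : 0 < ‖y - x‖ := norm_pos_iff.2 hne
  have hsq : ‖y - x‖ ^ 2 = ‖y‖ ^ 2 - 2 * inner ℝ y x + ‖x‖ ^ 2 := norm_sub_sq_real y x
  have hin : inner ℝ (y - x) y = ‖y‖ ^ 2 - inner ℝ y x := by
    rw [inner_sub_left, real_inner_self_eq_norm_sq, real_inner_comm]
  let H : HalfSpace N := ⟨‖y - x‖⁻¹ • (y - x), (‖y‖ ^ 2 - ‖x‖ ^ 2) / (2 * ‖y - x‖), by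
    rw [norm_smul, norm_inv, norm_norm, inv_mul_cancel₀ hpos.ne']⟩
  have hd : inner ℝ H.normal y - H.offset = ‖y - x‖ / 2 := by
    show inner ℝ (‖y - x‖⁻¹ • (y - x)) y - (‖y‖ ^ 2 - ‖x‖ ^ 2) / (2 * ‖y - x‖) = _
    rw [real_inner_smul_left, hin]
    field_simp
    linarith
  refine ⟨H, mem_originHalfSpaces_of_offset_pos ?_, fun hy => ?_, ?_⟩
  · refine div_pos (sub_pos.2 ?_) (by positivity)
    gcongr
  · rw [HalfSpace.mem_carrier] at hy
    linarith
  · rw [HalfSpace.reflect, hd]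
    show y - (2 * (‖y - x‖ / 2)) • (‖y - x‖⁻¹ • (y - x)) = x
    rw [smul_smul, show 2 * (‖y - x‖ / 2) * ‖y - x‖⁻¹ = 1 by field_simp, one_smul]
    abel

/-- If `F y > F x` for some `|x| < |y|`, polarization exchanges the two values for half-spaces close
to the one that reflects `y` to `x`; the dense sequence contains such a half-space. -/
theorem antitone_of_polarize_eq_self {H : ℕ → HalfSpace N} (hH : IsDenseHalfSpaceSeq H)
    {F : Space N → ℝ} (hF : Continuous F) (hfix : ∀ n, polarize (H n) F = F) {x y : Space N}
    (hxy : ‖x‖ ≤ ‖y‖) : F y ≤ F x := by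
  have hstrict : ∀ x y : Space N, ‖x‖ < ‖y‖ → F y ≤ F x := by
    intro x y hxy
    by_contra! hlt
    obtain ⟨H₀, hH₀, hy, hr⟩ := exists_halfSpace_reflect_eq hxy
    have hpair : Continuous fun K : HalfSpace N => (K.normal, K.offset) := continuous_induced_dom
    have hn : Continuous fun K : HalfSpace N => K.normal := continuous_fst.comp hpair
    have ho : Continuous fun K : HalfSpace N => K.offset := continuous_snd.comp hpair
    have hin : Continuous fun K : HalfSpace N => (inner ℝ K.normal y : ℝ) :=
      hn.inner continuous_const
    have hrefl : Continuous fun K : HalfSpace N => K.reflect y :=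
      continuous_const.sub ((continuous_const.mul (hin.sub ho)).smul hn)
    have hopen : IsOpen {K : HalfSpace N | K.offset < inner ℝ K.normal y ∧ F (K.reflect y) < F y} :=
      (isOpen_lt ho hin).inter (isOpen_lt (hF.comp hrefl) continuous_const)
    obtain ⟨_, ⟨h1, h2⟩, m, rfl⟩ := mem_closure_iff.1 (hH.2 hH₀) _ hopen
      ⟨not_le.1 hy, by rw [hr]; exact hlt⟩
    have := congrFun (hfix m) y
    rw [polarize_of_notMem (not_le.2 h1), min_eq_right h2.le] at this
    exact h2.ne this
  rcases eq_or_ne x 0 with rfl | hx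
  · rcases eq_or_ne y 0 with rfl | hy
    · exact le_rfl
    · exact hstrict _ _ (by simpa using hy)
  have hlim : Tendsto (fun t : ℝ => F (t • x)) (𝓝[<] 1) (𝓝 (F x)) := by
    have hc : Continuous fun t : ℝ => F (t • x) := by fun_prop
    simpa using (hc.tendsto 1).mono_left nhdsWithin_le_nhds
  refine ge_of_tendsto hlim ?_
  filter_upwards [self_mem_nhdsWithin, nhdsWithin_le_nhds (Ioi_mem_nhds (zero_lt_one' ℝ))]
    with t ht1 ht0
  refine hstrict _ _ (lt_of_lt_of_le ?_ hxy)
  rw [norm_smul, Real.norm_eq_abs, abs_of_pos ht0]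
  exact mul_lt_of_lt_one_left (norm_pos_iff.2 hx) ht1

/-! ### Convergence of the polarization sequence to the Schwarz symmetrization -/

theorem volume_lt_polarizationSeq (H : ℕ → HalfSpace N) {u : Space N → ℝ} (hu : Measurable u)
    (n : ℕ) (t : ℝ) : volume {x | t < polarizationSeq H u n x} = volume {x | t < u x} :=
  (polarizationSeq_induction (fun f => Measurable f ∧
    volume {x | t < f x} = volume {x | t < u x})
    (fun k _ h => ⟨measurable_polarize _ h.1, (measure_lt_polarize (H k) h.1 t).trans h.2⟩)
    ⟨hu, rfl⟩ n).2

theorem measurable_polarizationSeq (H : ℕ → HalfSpace N) {u : Space N → ℝ} (hu : Measurable u)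
    (n : ℕ) : Measurable (polarizationSeq H u n) :=
  polarizationSeq_induction Measurable (fun k _ h => measurable_polarize (H k) h) hu n

/-- A uniform limit of a subsequence of the polarization sequence is fixed by every `H m`: the
second moments decrease along the sequence of all successive polarizations, hence the limit has the
same second moment as its polarizations. -/
theorem polarize_eq_self_of_tendstoUniformly {H : ℕ → HalfSpace N}
    (hH : ∀ n, H n ∈ originHalfSpaces N) {R C : ℝ} {δ : ℝ → ℝ} (hδ : ∀ ε > 0, 0 < δ ε)
    {f : Space N → ℝ} (hf : IsBump R C f) (hmod : HasModulus δ f) {φ : ℕ → ℕ} (hφ : StrictMono φ)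
    {F : Space N → ℝ} (hF : TendstoUniformly (fun n => polarizationSeq H f (φ n)) F atTop) (m : ℕ) :
    polarize (H m) F = F := by
  let P : (Space N → ℝ) → Prop := fun g => IsBump R C g ∧ HasModulus δ g
  have hP : ∀ n g, P g → P (polarize (H n) g) := fun n g h => ⟨h.1.polarize (hH n), h.2.polarize _⟩
  have hPn : ∀ n, P (polarizationSeq H f n) := polarizationSeq_induction P hP ⟨hf, hmod⟩
  have hcont : ∀ {g}, P g → Continuous g := fun h => h.2.continuous hδ
  have hFbump : IsBump R C F := IsBump.of_tendstoUniformly (fun n => (hPn (φ n)).1) hF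
  have hstep : ∀ n g, P g → secondMoment (polarize (H n) g) ≤ secondMoment g := fun n g h =>
    (secondMoment_polarize_le (hH n) (hcont h) h.1.hasCompactSupport (hcont (hP n g h))
      (hP n g h).1.hasCompactSupport).1
  have hupTo : ∀ g, P g → Antitone fun k => secondMoment (polarizeUpTo H k g) := fun g h => by
    refine antitone_nat_of_succ_le fun k => ?_
    rw [polarizeUpTo_succ]
    exact hstep _ _ (polarizeUpTo_induction P hP h k)
  have hanti : Antitone fun n => secondMoment (polarizationSeq H f n) := by
    refine antitone_nat_of_succ_le fun n => ?_
    exact hupTo _ (hPn n) (Nat.zero_le (n + 1))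
  have hlimF := tendsto_secondMoment (fun n => hcont (hPn (φ n))) (fun n => (hPn (φ n)).1) hF
  have hFle : ∀ n, secondMoment F ≤ secondMoment (polarizationSeq H f n) := fun n => by
    refine le_of_tendsto hlimF ?_
    filter_upwards [hφ.tendsto_atTop.eventually_ge_atTop n] with k hk using hanti hk
  have hFcont : Continuous F :=
    hF.continuous (Frequently.of_forall fun n => hcont (hPn (φ n)))
  have hFmod : HasModulus δ F := fun ε hε x y hxy =>
    le_of_tendsto' ((hF.tendsto_at x).sub (hF.tendsto_at y)).abs fun n =>
      (hPn (φ n)).2 ε hε x y hxy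
  have hPF : P F := ⟨hFbump, hFmod⟩
  induction m using Nat.strong_induction_on with
  | _ m ih =>
    have hfix : ∀ k ≤ m, polarizeUpTo H k F = F := by
      intro k
      induction k with
      | zero => exact fun _ => rfl
      | succ k ihk => intro hk; rw [polarizeUpTo_succ, ihk (by omega), ih k (by omega)]
    have hlim := tendsto_secondMoment
      (fun n => hcont (polarizeUpTo_induction P hP (hPn (φ n)) (m + 1)))
      (fun n => (polarizeUpTo_induction P hP (hPn (φ n)) (m + 1)).1)
      (tendstoUniformly_polarizeUpTo H (m + 1) hF)
    -- for `n ≥ m` the polarizations with `H 0, …, H m` are the first steps from `uₙ` to `u_{n + 1}`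
    have hge : secondMoment F ≤ secondMoment (polarizeUpTo H (m + 1) F) := by
      refine ge_of_tendsto hlim ?_
      filter_upwards [hφ.tendsto_atTop.eventually_ge_atTop m] with n hn
      exact (hFle (φ n + 1)).trans (hupTo _ (hPn (φ n)) (by omega))
    rw [polarizeUpTo_succ, hfix m le_rfl] at hge
    exact (secondMoment_polarize_le (hH m) hFcont hFbump.hasCompactSupport
      (hcont (hP m F hPF)) (hP m F hPF).1.hasCompactSupport).2 (le_antisymm (hstep m F hPF) hge)

/-- Every subsequence of `(fₙ)` has a uniformly convergent subsequence, whose limit is `f*`. -/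
theorem tendsto_polarizationSeq_of_hasCompactSupport (hN : 1 ≤ N) {H : ℕ → HalfSpace N}
    (hH : IsDenseHalfSpaceSeq H) {q : ℝ≥0∞} (hq0 : q ≠ 0) (hq : q ≠ ⊤) {f : Space N → ℝ}
    (hfc : Continuous f) (hfs : HasCompactSupport f) (hf0 : ∀ x, 0 ≤ f x) :
    AEStronglyMeasurable (schwarz f) volume ∧
      Tendsto (fun n => eLpNorm (polarizationSeq H f n - schwarz f) q volume) atTop (𝓝 0) ∧
      AERadiallyAntitone (schwarz f) := by
  obtain ⟨R, hR⟩ := hfs.isCompact.isBounded.subset_closedBall 0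
  obtain ⟨C, hC⟩ := hfc.bounded_above_of_compact_support hfs
  have hbump : IsBump R C f := ⟨hf0, fun x => (le_abs_self _).trans (hC x), fun x hx => by
    by_contra h0
    have := hR (subset_tsupport f h0)
    rw [mem_closedBall_zero_iff] at this
    linarith⟩
  obtain ⟨δ, hδ, hmod⟩ := exists_hasModulus (hfs.uniformContinuous_of_continuous hfc)
  have hP : ∀ n, IsBump R C (polarizationSeq H f n) ∧ HasModulus δ (polarizationSeq H f n) :=
    polarizationSeq_induction (fun g => IsBump R C g ∧ HasModulus δ g)
      (fun n g h => ⟨h.1.polarize (hH.1 n), h.2.polarize _⟩) ⟨hbump, hmod⟩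
  have key : ∀ φ : ℕ → ℕ, StrictMono φ → ∃ ψ : ℕ → ℕ,
      Tendsto (fun n => eLpNorm (polarizationSeq H f (φ (ψ n)) - schwarz f) q volume)
        atTop (𝓝 0) ∧ AEStronglyMeasurable (schwarz f) volume ∧
        AERadiallyAntitone (schwarz f) := by
    intro φ hφ
    obtain ⟨ψ, hψ, F, hF⟩ := exists_subseq_tendstoUniformly hδ
      (f := fun n => polarizationSeq H f (φ n)) (fun n => (hP _).1) (fun n => (hP _).2)
    have hfix := polarize_eq_self_of_tendstoUniformly hH.1 hδ hbump hmod (hφ.comp hψ) hF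
    have hFc : Continuous F :=
      hF.continuous (Frequently.of_forall fun n => (hP _).2.continuous hδ)
    have hlim := tendsto_eLpNorm_of_tendstoUniformly (fun n => (hP _).1) hF hq
    have hFb : IsBump R C F := IsBump.of_tendstoUniformly (fun n => (hP _).1) hF
    have hanti : AERadiallyAntitone F := ⟨Set.univ, Eventually.of_forall fun _ => trivial,
      fun x _ y _ hxy => antitone_of_polarize_eq_self hH hFc hfix hxy⟩
    have heq : F =ᵐ[volume] schwarz f := ae_eq_schwarz hN (Eventually.of_forall hFb.nonneg) hanti
      (equimeasurable_of_tendsto_eLpNorm hq0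
        (fun n => ((hP _).2.continuous hδ).aestronglyMeasurable) hFc.aestronglyMeasurable
        (fun n t => volume_lt_polarizationSeq H hfc.measurable _ t) hlim)
    refine ⟨ψ, ?_, hFc.aestronglyMeasurable.congr heq, hanti.congr heq⟩
    refine hlim.congr fun n => eLpNorm_congr_ae ?_
    filter_upwards [heq] with x hx
    simp [hx]
  obtain ⟨-, -, hsm, hanti⟩ := key id strictMono_id
  refine ⟨hsm, tendsto_of_subseq_tendsto fun ns hns => ?_, hanti⟩
  obtain ⟨φ, hφ, hnsφ⟩ := strictMono_subseq_of_tendsto_atTop hns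
  obtain ⟨ψ, hψ, -⟩ := key _ hnsφ
  exact ⟨fun n => φ (ψ n), hψ⟩

theorem MemLp.exists_nonneg_hasCompactSupport_eLpNorm_sub_le {q : ℝ≥0∞} (hq : q ≠ ⊤)
    {u : Space N → ℝ} (hu : MemLp u q volume) (hu0 : ∀ x, 0 ≤ u x) {ε : ℝ≥0∞} (hε : ε ≠ 0) :
    ∃ f : Space N → ℝ, Continuous f ∧ HasCompactSupport f ∧ (∀ x, 0 ≤ f x) ∧ MemLp f q volume ∧
      eLpNorm (u - f) q volume ≤ ε := by
  obtain ⟨g, hgs, hg, hgc, hgm⟩ := hu.exists_hasCompactSupport_eLpNorm_sub_le hq hε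
  have hs : HasCompactSupport fun x => max (g x) 0 := hgs.comp_left (g := fun t => max t 0) (by simp)
  have hc : Continuous fun x => max (g x) 0 := hgc.max continuous_const
  refine ⟨_, hc, hs, fun x => le_max_right _ _, hc.memLp_of_hasCompactSupport hs,
    (eLpNorm_mono fun x => ?_).trans hg⟩
  simp only [Pi.sub_apply, Real.norm_eq_abs]
  have := abs_max_sub_max_le_abs (u x) (g x) 0
  rwa [max_eq_left (hu0 x)] at this

/-- Convergence for `u ∈ L^p`: polarizations contract `L^p`, so the convergence for continuous
functions with compact support carries over by density. -/
theorem tendsto_polarizationSeq_schwarz (hN : 1 ≤ N) {H : ℕ → HalfSpace N}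
    (hH : IsDenseHalfSpaceSeq H) {p : ℝ} (hp : 1 ≤ p) {u : Space N → ℝ} (hum : Measurable u)
    (hu0 : ∀ x, 0 ≤ u x) (hu : MemLp u (ENNReal.ofReal p) volume) :
    MemLp (schwarz u) (ENNReal.ofReal p) volume ∧ 0 ≤ᵐ[volume] schwarz u ∧
      Tendsto (fun n => eLpNorm (polarizationSeq H u n - schwarz u) (ENNReal.ofReal p) volume)
        atTop (𝓝 0) := by
  set q := ENNReal.ofReal p with hq
  have hq0 : q ≠ 0 := by simp [hq]; linarith
  have hq1 : 1 ≤ q := by rw [hq, ← ENNReal.ofReal_one]; exact ENNReal.ofReal_le_ofReal hp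
  have hqt : q ≠ ⊤ := ENNReal.ofReal_ne_top
  have : Fact (1 ≤ q) := ⟨hq1⟩
  have hmem : ∀ n, MemLp (polarizationSeq H u n) q volume := fun n =>
    (polarizationSeq_induction (fun f => Measurable f ∧ MemLp f q volume)
      (fun k f h => ⟨measurable_polarize _ h.1, memLp_polarize _ h.1 h.2⟩) ⟨hum, hu⟩ n).2
  have hmeas := fun n => (hmem n).aestronglyMeasurable
  -- for a continuous `f` close to `u`, the tails of the sequence of `u` are close to `f*`
  have happrox : ∀ ε : ℝ≥0∞, ε ≠ 0 → ∃ f : Space N → ℝ, AERadiallyAntitone f ∧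
      AEStronglyMeasurable f volume ∧
      ∀ᶠ n in atTop, eLpNorm (polarizationSeq H u n - f) q volume ≤ ε := by
    intro ε hε
    have hε2 : ε / 2 ≠ 0 := by simpa using hε
    obtain ⟨f, hfc, hfs, hf0, hfm, hf⟩ :=
      MemLp.exists_nonneg_hasCompactSupport_eLpNorm_sub_le hqt hu hu0 hε2
    obtain ⟨hsm, hlim, hanti⟩ :=
      tendsto_polarizationSeq_of_hasCompactSupport hN hH hq0 hqt hfc hfs hf0
    have hfn : ∀ n, AEStronglyMeasurable (polarizationSeq H f n) volume := fun n =>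
      (measurable_polarizationSeq H hfc.measurable n).aestronglyMeasurable
    refine ⟨schwarz f, hanti, hsm, ?_⟩
    filter_upwards [hlim.eventually (ge_mem_nhds (pos_iff_ne_zero.2 hε2))] with n hn
    calc eLpNorm (polarizationSeq H u n - schwarz f) q volume
        = eLpNorm ((polarizationSeq H u n - polarizationSeq H f n) +
            (polarizationSeq H f n - schwarz f)) q volume := by rw [sub_add_sub_cancel]
      _ ≤ _ := eLpNorm_add_le ((hmeas n).sub (hfn n)) ((hfn n).sub hsm) hq1
      _ ≤ ε / 2 + ε / 2 := add_le_add
          ((eLpNorm_polarizationSeq_sub_le H hp hum hfc.measurable n).trans hf) hn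
      _ = ε := ENNReal.add_halves ε
  have hcauchy : CauchySeq fun n => (hmem n).toLp (polarizationSeq H u n) := by
    refine EMetric.cauchySeq_iff.2 fun ε hε => ?_
    obtain ⟨δ, hδ0, hδ⟩ := exists_between hε
    obtain ⟨f, -, hfm, hf⟩ := happrox (δ / 2) (by simpa using hδ0.ne')
    obtain ⟨n₀, hn₀⟩ := eventually_atTop.1 hf
    refine ⟨n₀, fun m hm n hn => ?_⟩
    rw [Lp.edist_toLp_toLp]
    refine lt_of_le_of_lt ?_ hδ
    calc eLpNorm (polarizationSeq H u m - polarizationSeq H u n) q volume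
        = eLpNorm ((polarizationSeq H u m - f) - (polarizationSeq H u n - f)) q volume := by
          rw [sub_sub_sub_cancel_right]
      _ ≤ _ := eLpNorm_sub_le ((hmeas m).sub hfm) ((hmeas n).sub hfm) hq1
      _ ≤ δ / 2 + δ / 2 := add_le_add (hn₀ m hm) (hn₀ n hn)
      _ = δ := ENNReal.add_halves δ
  obtain ⟨w, hw⟩ := cauchySeq_tendsto_of_complete hcauchy
  set v : Space N → ℝ := ⇑w with hv
  have hvm : MemLp v q volume := Lp.memLp w
  have hlim : Tendsto (fun n => eLpNorm (polarizationSeq H u n - v) q volume) atTop (𝓝 0) := by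
    refine (tendsto_iff_edist_tendsto_0.1 hw).congr fun n => ?_
    rw [Lp.edist_def]
    refine eLpNorm_congr_ae ?_
    filter_upwards [(hmem n).coeFn_toLp] with x hx
    simp [hx, hv]
  obtain ⟨φ, -, hφ⟩ :=
    (tendstoInMeasure_of_tendsto_eLpNorm hq0 hmeas hvm.1 hlim).exists_seq_tendsto_ae
  have hv0 : 0 ≤ᵐ[volume] v := by
    filter_upwards [hφ] with x hx
    refine ge_of_tendsto' hx fun n => ?_
    exact polarizationSeq_induction (fun f : Space N → ℝ => 0 ≤ f)
      (fun k f h => polarize_nonneg _ h) hu0 (φ n) x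
  have hvanti : AERadiallyAntitone v := by
    have hex : ∀ k : ℕ, ∃ f : Space N → ℝ, AERadiallyAntitone f ∧ AEStronglyMeasurable f volume ∧
        eLpNorm (f - v) q volume ≤ (k + 1 : ℝ≥0∞)⁻¹ := by
      intro k
      have hk : (k + 1 : ℝ≥0∞)⁻¹ ≠ 0 := by simp
      have hk2 : (k + 1 : ℝ≥0∞)⁻¹ / 2 ≠ 0 := by simp
      obtain ⟨f, hfa, hfm, hf⟩ := happrox _ hk2
      refine ⟨f, hfa, hfm, ?_⟩
      obtain ⟨n, hn1, hn2⟩ :=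
        (hf.and (hlim.eventually (ge_mem_nhds (pos_iff_ne_zero.2 hk2)))).exists
      calc eLpNorm (f - v) q volume
          = eLpNorm ((polarizationSeq H u n - v) - (polarizationSeq H u n - f)) q volume := by
            rw [sub_sub_sub_cancel_left]
        _ ≤ _ := eLpNorm_sub_le ((hmeas n).sub hvm.1) ((hmeas n).sub hfm) hq1
        _ ≤ _ := add_le_add hn2 hn1
        _ = _ := ENNReal.add_halves _
    choose f hfa hfm hf using hex
    have hf0 : Tendsto (fun k => eLpNorm (f k - v) q volume) atTop (𝓝 0) := by
      refine tendsto_of_tendsto_of_tendsto_of_le_of_le tendsto_const_nhds ?_ (fun _ => zero_le) hf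
      have := (tendsto_add_atTop_iff_nat 1).2 ENNReal.tendsto_inv_nat_nhds_zero
      simpa using this
    obtain ⟨ψ, -, hψ⟩ :=
      (tendstoInMeasure_of_tendsto_eLpNorm hq0 hfm hvm.1 hf0).exists_seq_tendsto_ae
    exact AERadiallyAntitone.of_tendsto_ae (fun k => hfa (ψ k)) hψ
  have heq : v =ᵐ[volume] schwarz u := ae_eq_schwarz hN hv0 hvanti
    (equimeasurable_of_tendsto_eLpNorm hq0 hmeas hvm.1
      (fun n t => volume_lt_polarizationSeq H hum n t) hlim)
  refine ⟨hvm.ae_eq heq, ?_, hlim.congr fun n => eLpNorm_congr_ae ?_⟩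
  · filter_upwards [hv0, heq] with x h1 h2
    rwa [← h2]
  · filter_upwards [heq] with x hx
    simp [hx]

/-! ### Weak directional derivatives -/

/-- `h` is the weak derivative of `u` in the direction `e`. -/
def HasWeakDeriv (u : Space N → ℝ) (e : Space N) (h : Space N → ℝ) : Prop :=
  LocallyIntegrable u volume ∧ LocallyIntegrable h volume ∧
    ∀ φ : Space N → ℝ, ContDiff ℝ ∞ φ → HasCompactSupport φ →
      ∫ x, u x * fderiv ℝ φ x e = -∫ x, h x * φ x

theorem integrable_mul_of_hasCompactSupport {u φ : Space N → ℝ} (hu : LocallyIntegrable u volume)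
    (hφ : Continuous φ) (hs : HasCompactSupport φ) : Integrable fun x => u x * φ x := by
  simpa only [smul_eq_mul] using hu.integrable_smul_right_of_hasCompactSupport hφ hs

theorem continuous_fderiv_apply {φ : Space N → ℝ} {n : WithTop ℕ∞} (hn : n ≠ 0)
    (hφ : ContDiff ℝ n φ) (e : Space N) :
    Continuous fun x => fderiv ℝ φ x e :=
  (hφ.continuous_fderiv hn).clm_apply continuous_const

theorem integrable_mul_fderiv {u φ : Space N → ℝ} (hu : LocallyIntegrable u volume)
    (hφ : ContDiff ℝ ∞ φ) (hs : HasCompactSupport φ) (e : Space N) :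
    Integrable fun x => u x * fderiv ℝ φ x e :=
  integrable_mul_of_hasCompactSupport hu (continuous_fderiv_apply (by simp) hφ e)
    (hs.fderiv_apply ℝ e)

theorem HasWeakDeriv.congr_ae {u u' h h' : Space N → ℝ} {e : Space N} (H : HasWeakDeriv u e h)
    (hu : u =ᵐ[volume] u') (hh : h =ᵐ[volume] h') : HasWeakDeriv u' e h' := by
  refine ⟨H.1.congr hu, H.2.1.congr hh, fun φ hφ hs => ?_⟩
  have e1 : ∫ x, u' x * fderiv ℝ φ x e = ∫ x, u x * fderiv ℝ φ x e :=
    integral_congr_ae (hu.mono fun x hx => by simp only [hx])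
  have e2 : ∫ x, h' x * φ x = ∫ x, h x * φ x :=
    integral_congr_ae (hh.mono fun x hx => by simp only [hx])
  rw [e1, e2, H.2.2 φ hφ hs]

theorem HasWeakDeriv.add {u v h k : Space N → ℝ} {e : Space N} (hu : HasWeakDeriv u e h)
    (hv : HasWeakDeriv v e k) : HasWeakDeriv (fun x => u x + v x) e (fun x => h x + k x) := by
  refine ⟨hu.1.add hv.1, hu.2.1.add hv.2.1, fun φ hφ hs => ?_⟩
  simp only [add_mul]
  rw [integral_add (integrable_mul_fderiv hu.1 hφ hs e) (integrable_mul_fderiv hv.1 hφ hs e),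
    integral_add (integrable_mul_of_hasCompactSupport hu.2.1 hφ.continuous hs)
      (integrable_mul_of_hasCompactSupport hv.2.1 hφ.continuous hs),
    hu.2.2 φ hφ hs, hv.2.2 φ hφ hs, neg_add]

theorem HasWeakDeriv.const_mul {u h : Space N → ℝ} {e : Space N} (hu : HasWeakDeriv u e h)
    (c : ℝ) : HasWeakDeriv (fun x => c * u x) e (fun x => c * h x) := by
  refine ⟨hu.1.smul c, hu.2.1.smul c, fun φ hφ hs => ?_⟩
  simp only [mul_assoc]
  rw [integral_const_mul, integral_const_mul, hu.2.2 φ hφ hs, mul_neg]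

theorem HasWeakDeriv.sub {u v h k : Space N → ℝ} {e : Space N} (hu : HasWeakDeriv u e h)
    (hv : HasWeakDeriv v e k) : HasWeakDeriv (fun x => u x - v x) e (fun x => h x - k x) := by
  have := hu.add (hv.const_mul (-1))
  simpa only [neg_one_mul, ← sub_eq_add_neg] using this

theorem HasWeakDeriv.unique {u h k : Space N → ℝ} {e : Space N} (hh : HasWeakDeriv u e h)
    (hk : HasWeakDeriv u e k) : h =ᵐ[volume] k := by
  refine ae_eq_of_integral_contDiff_smul_eq hh.2.1 hk.2.1 fun φ hφ hs => ?_
  have := neg_injective ((hh.2.2 φ hφ hs).symm.trans (hk.2.2 φ hφ hs))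
  simpa only [smul_eq_mul, mul_comm] using this

theorem LocallyIntegrable.inner_const {g : Space N → Space N} (hg : LocallyIntegrable g volume)
    (e : Space N) : LocallyIntegrable (fun x => (inner ℝ (g x) e : ℝ)) volume := by
  rw [locallyIntegrable_iff] at hg ⊢
  exact fun K hK => (hg K hK).inner_const e

/-- A weak gradient yields the weak derivatives in all directions. -/
theorem HasWeakGradient.hasWeakDeriv {u : Space N → ℝ} {g : Space N → Space N}
    (h : HasWeakGradient u g) (e : Space N) : HasWeakDeriv u e fun x => inner ℝ (g x) e := by
  refine ⟨h.1, LocallyIntegrable.inner_const h.2.1 e, fun φ hφ hs => ?_⟩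
  have hgi : ∀ i, LocallyIntegrable (fun x => g x i) volume := fun i => by
    simpa [EuclideanSpace.inner_single_right] using
      LocallyIntegrable.inner_const h.2.1 (EuclideanSpace.single i (1 : ℝ))
  have he : e = ∑ i, e i • EuclideanSpace.single i (1 : ℝ) := by
    have := ((EuclideanSpace.basisFun (Fin N) ℝ).sum_repr e).symm
    simpa using this
  have e1 : ∀ x, u x * fderiv ℝ φ x e =
      ∑ i, e i * (u x * fderiv ℝ φ x (EuclideanSpace.single i 1)) := fun x => by
    conv_lhs => rw [he]
    rw [map_sum, Finset.mul_sum]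
    refine Finset.sum_congr rfl fun i _ => ?_
    rw [map_smul, smul_eq_mul]
    ring
  have e2 : ∀ x, (inner ℝ (g x) e : ℝ) * φ x = ∑ i, e i * (g x i * φ x) := fun x => by
    rw [PiLp.inner_apply, Finset.sum_mul]
    refine Finset.sum_congr rfl fun i _ => ?_
    simp only [RCLike.inner_apply, conj_trivial]
    ring
  simp only [e1, e2]
  rw [integral_finsetSum _ fun i _ => (integrable_mul_fderiv h.1 hφ hs _).const_mul _,
    integral_finsetSum _ fun i _ =>
      (integrable_mul_of_hasCompactSupport (hgi i) hφ.continuous hs).const_mul _,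
    ← Finset.sum_neg_distrib]
  refine Finset.sum_congr rfl fun i _ => ?_
  rw [integral_const_mul, integral_const_mul, h.2.2 φ hφ hs i, mul_neg]

theorem hasWeakGradient_of_hasWeakDeriv {u : Space N → ℝ} {g : Space N → Space N}
    (hu : LocallyIntegrable u volume) (hg : LocallyIntegrable g volume)
    (h : ∀ e, HasWeakDeriv u e fun x => inner ℝ (g x) e) : HasWeakGradient u g := by
  refine ⟨hu, hg, fun φ hφ hs i => ?_⟩
  simpa [EuclideanSpace.inner_single_right] using
    (h (EuclideanSpace.single i (1 : ℝ))).2.2 φ hφ hs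

theorem HasWeakGradient.unique {u : Space N → ℝ} {g g' : Space N → Space N}
    (h : HasWeakGradient u g) (h' : HasWeakGradient u g') : g =ᵐ[volume] g' := by
  have := ae_all_iff.2 fun i : Fin N =>
    (h.hasWeakDeriv (EuclideanSpace.single i (1 : ℝ))).unique (h'.hasWeakDeriv _)
  filter_upwards [this] with x hx
  ext i
  simpa [EuclideanSpace.inner_single_right] using hx i

theorem HasWeakGradient.congr_ae {u u' : Space N → ℝ} {g g' : Space N → Space N}
    (h : HasWeakGradient u g) (hu : u =ᵐ[volume] u') (hg : g =ᵐ[volume] g') :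
    HasWeakGradient u' g' :=
  hasWeakGradient_of_hasWeakDeriv (h.1.congr hu) (h.2.1.congr hg) fun e =>
    (h.hasWeakDeriv e).congr_ae hu (hg.mono fun x hx => by simp only [hx])

theorem HasWeakGradient.weakGrad_ae_eq {u : Space N → ℝ} {g : Space N → Space N}
    (h : HasWeakGradient u g) : weakGrad u =ᵐ[volume] g := by
  have hex : ∃ g, HasWeakGradient u g := ⟨g, h⟩
  rw [weakGrad, dif_pos hex]
  exact hex.choose_spec.unique h

/-! ### Mollification -/

/-- Convergence in `L^1` on compact sets. -/
def TendstoL1Loc (a : ℕ → Space N → ℝ) (a₀ : Space N → ℝ) : Prop :=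
  ∀ K : Set (Space N), IsCompact K →
    Tendsto (fun n => ∫⁻ x in K, ‖a n x - a₀ x‖ₑ) atTop (𝓝 0)

/-- The bump functions used for mollification: the support shrinks to the origin. -/
def mollifier (N : ℕ) (k : ℕ) : ContDiffBump (0 : Space N) :=
  ⟨1 / (2 * (k + 1)), 1 / (k + 1), by positivity, by
    rw [one_div_lt_one_div (by positivity) (by positivity)]
    have : (0 : ℝ) ≤ k := k.cast_nonneg
    linarith⟩

theorem mollifier_rOut_le_one (k : ℕ) : (mollifier N k).rOut ≤ 1 := by
  show 1 / ((k : ℝ) + 1) ≤ 1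
  rw [div_le_one (by positivity)]
  have : (0 : ℝ) ≤ k := k.cast_nonneg
  linarith

theorem tendsto_mollifier_rOut : Tendsto (fun k => (mollifier N k).rOut) atTop (𝓝 0) :=
  tendsto_one_div_add_atTop_nhds_zero_nat

/-- The mollification of `u`. -/
def mollify (k : ℕ) (u : Space N → ℝ) : Space N → ℝ :=
  convolution ((mollifier N k).normed volume) u (ContinuousLinearMap.lsmul ℝ ℝ) volume

theorem contDiff_mollify (k : ℕ) {u : Space N → ℝ} (hu : LocallyIntegrable u volume) :
    ContDiff ℝ ∞ (mollify k u) :=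
  HasCompactSupport.contDiff_convolution_left _ (mollifier N k).hasCompactSupport_normed
    (mollifier N k).contDiff_normed hu

theorem tendsto_mollify_ae {u : Space N → ℝ} (hu : LocallyIntegrable u volume) :
    ∀ᵐ x, Tendsto (fun k => mollify k u x) atTop (𝓝 (u x)) := by
  refine ContDiffBump.ae_convolution_tendsto_right_of_locallyIntegrable (K := 2)
    tendsto_mollifier_rOut (Eventually.of_forall fun k => ?_) hu
  show 1 / ((k : ℝ) + 1) ≤ 2 * (1 / (2 * (k + 1)))
  rw [← mul_one_div, ← one_div_mul_one_div]
  apply le_of_eq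
  ring

/-- Mollification commutes with weak derivatives. -/
theorem HasWeakDeriv.fderiv_mollify {u h : Space N → ℝ} {e : Space N} (H : HasWeakDeriv u e h)
    (k : ℕ) (x : Space N) : fderiv ℝ (mollify k u) x e = mollify k h x := by
  set ρ := (mollifier N k).normed volume with hρ
  have hρs : HasCompactSupport ρ := (mollifier N k).hasCompactSupport_normed
  have hρc : ContDiff ℝ ∞ ρ := (mollifier N k).contDiff_normed
  have hder := (HasCompactSupport.hasFDerivAt_convolution_left (𝕜 := ℝ) (μ := volume)
    (ContinuousLinearMap.lsmul ℝ ℝ) hρs (hρc.of_le (by simp)) H.1 x).fderiv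
  have hψ : ContDiff ℝ ∞ fun y => ρ (x - y) := hρc.comp (contDiff_const.sub contDiff_id)
  have hψs : HasCompactSupport fun y => ρ (x - y) :=
    hρs.comp_homeomorph (Homeomorph.subLeft x)
  have hψd : ∀ y, fderiv ℝ (fun y => ρ (x - y)) y e = -fderiv ℝ ρ (x - y) e := fun y => by
    have h1 : HasFDerivAt (fun y => x - y) (-ContinuousLinearMap.id ℝ (Space N)) y :=
      (hasFDerivAt_id y).const_sub x
    have h2 : HasFDerivAt ρ (fderiv ℝ ρ (x - y)) (x - y) :=
      ((hρc.differentiable (by simp)) _).hasFDerivAt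
    have h3 : HasFDerivAt (fun y => ρ (x - y)) _ y := h2.comp y h1
    rw [h3.fderiv]
    simp
  have hint := H.2.2 _ hψ hψs
  simp only [hψd, mul_neg, integral_neg, neg_inj] at hint
  have hmain : fderiv ℝ (mollify k u) x e = ∫ y, u y * fderiv ℝ ρ (x - y) e := by
    rw [mollify, hder, convolution_eq_swap, ContinuousLinearMap.integral_apply]
    · simp [ContinuousLinearMap.precompL_apply, mul_comm]
    · have := (hρs.fderiv (𝕜 := ℝ)).convolutionExists_left
        (ContinuousLinearMap.precompL (Space N) (ContinuousLinearMap.lsmul ℝ ℝ))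
        (hρc.continuous_fderiv (by simp)) H.1 x
      exact this.integrable_swap
  rw [hmain, hint, mollify, convolution_eq_swap]
  simp [hρ, mul_comm]

theorem lintegral_enorm_mollify_le (k : ℕ) {u : Space N → ℝ} (hu : Integrable u) :
    ∫⁻ x, ‖mollify k u x‖ₑ ≤ ∫⁻ x, ‖u x‖ₑ := by
  set ρ := (mollifier N k).normed volume with hρ
  have hρm : AEStronglyMeasurable ρ volume :=
    ((mollifier N k).contDiff_normed (n := 0)).continuous.aestronglyMeasurable
  have hρ1 : ∫⁻ t, ‖ρ t‖ₑ = 1 := by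
    rw [← ofReal_integral_norm_eq_lintegral_enorm (mollifier N k).integrable_normed]
    simp only [Real.norm_of_nonneg ((mollifier N k).nonneg_normed _)]
    rw [(mollifier N k).integral_normed, ENNReal.ofReal_one]
  have hprod := (AEStronglyMeasurable.convolution_integrand (μ := volume) (ν := volume)
    (ContinuousLinearMap.lsmul ℝ ℝ) hρm hu.aestronglyMeasurable).enorm
  calc ∫⁻ x, ‖mollify k u x‖ₑ
      ≤ ∫⁻ x, ∫⁻ t, ‖ContinuousLinearMap.lsmul ℝ ℝ (ρ t) (u (x - t))‖ₑ :=
        lintegral_mono fun x => enorm_integral_le_lintegral_enorm _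
    _ = ∫⁻ t, ∫⁻ x, ‖ContinuousLinearMap.lsmul ℝ ℝ (ρ t) (u (x - t))‖ₑ :=
        lintegral_lintegral_swap hprod
    _ = ∫⁻ t, ‖ρ t‖ₑ * ∫⁻ x, ‖u x‖ₑ := by
        refine lintegral_congr fun t => ?_
        simp only [ContinuousLinearMap.lsmul_apply, smul_eq_mul, enorm_mul]
        rw [lintegral_const_mul' _ _ enorm_ne_top,
          lintegral_sub_right_eq_self (fun x => ‖u x‖ₑ) t]
    _ = ∫⁻ x, ‖u x‖ₑ := by
        rw [lintegral_mul_const'' _ hρm.enorm, hρ1, one_mul]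

theorem continuous_mollify (k : ℕ) {u : Space N → ℝ} (hu : LocallyIntegrable u volume) :
    Continuous (mollify k u) := (contDiff_mollify k hu).continuous

theorem convolutionExists_mollifier (k : ℕ) {u : Space N → ℝ} (hu : LocallyIntegrable u volume) :
    ConvolutionExists ((mollifier N k).normed volume) u (ContinuousLinearMap.lsmul ℝ ℝ) volume :=
  (mollifier N k).hasCompactSupport_normed.convolutionExists_left _
    ((mollifier N k).contDiff_normed (n := 0)).continuous hu

theorem mollify_sub (k : ℕ) {u v : Space N → ℝ} (hu : LocallyIntegrable u volume)
    (hv : LocallyIntegrable v volume) (x : Space N) :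
    mollify k (fun y => u y - v y) x = mollify k u x - mollify k v x := by
  simp only [mollify, convolution_def, map_sub]
  exact integral_sub (convolutionExists_mollifier k hu x) (convolutionExists_mollifier k hv x)

theorem tendsto_lintegral_mollify_sub_of_hasCompactSupport {c : Space N → ℝ} (hc : Continuous c)
    (hs : HasCompactSupport c) :
    Tendsto (fun k => ∫⁻ x, ‖mollify k c x - c x‖ₑ) atTop (𝓝 0) := by
  obtain ⟨R, hR⟩ := hs.isCompact.isBounded.subset_closedBall 0
  have hsupp : Function.support c ⊆ Metric.closedBall 0 R := (subset_tsupport c).trans hR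
  have hsuppm : ∀ k, Function.support (mollify k c) ⊆ Metric.closedBall 0 (R + 1) := fun k => by
    refine (support_convolution_subset _).trans ?_
    rw [(mollifier N k).support_normed_eq]
    rintro _ ⟨a, ha, b, hb, rfl⟩
    have ha : ‖a‖ < (mollifier N k).rOut := by simpa using ha
    have hb : ‖b‖ ≤ R := by simpa using hsupp hb
    have := mollifier_rOut_le_one (N := N) k
    rw [mem_closedBall_zero_iff]
    exact (norm_add_le a b).trans (by linarith)
  set M := volume (Metric.closedBall (0 : Space N) (R + 1)) ^ (1 / (1 : ℝ≥0∞).toReal)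
  have hM : M ≠ ⊤ := ENNReal.rpow_ne_top_of_nonneg (by simp) measure_closedBall_lt_top.ne
  have hlim : Tendsto (fun ε : ℝ => ENNReal.ofReal ε * M) (𝓝[>] 0) (𝓝 0) := by
    have := ENNReal.Tendsto.mul_const (b := M) (ENNReal.continuous_ofReal.tendsto 0) (Or.inr hM)
    simp only [ENNReal.ofReal_zero, zero_mul] at this
    exact this.mono_left nhdsWithin_le_nhds
  rw [ENNReal.tendsto_nhds_zero]
  intro η hη
  obtain ⟨ε, hε, hε0⟩ := ((hlim.eventually (ge_mem_nhds hη)).and self_mem_nhdsWithin).exists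
  have hε0 : 0 < ε := hε0
  obtain ⟨δ, hδ, huc⟩ :=
    Metric.uniformContinuous_iff.1 (hs.uniformContinuous_of_continuous hc) ε hε0
  filter_upwards [tendsto_mollifier_rOut.eventually (gt_mem_nhds hδ)] with k hk
  have := eLpNorm_sub_le_of_dist_bdd volume (p := 1) ENNReal.one_ne_top
    Metric.isClosed_closedBall.measurableSet hε0.le (f := mollify k c) (g := c) (fun x => ?_)
    (hsuppm k) (hsupp.trans (Metric.closedBall_subset_closedBall (by linarith)))
  · rw [eLpNorm_one_eq_lintegral_enorm] at this
    exact this.trans hε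
  · refine ContDiffBump.dist_normed_convolution_le hc.aestronglyMeasurable fun y hy => ?_
    exact (huc ((Metric.mem_ball.1 hy).trans hk)).le

theorem tendsto_lintegral_mollify_sub {u : Space N → ℝ} (hu : Integrable u) :
    Tendsto (fun k => ∫⁻ x, ‖mollify k u x - u x‖ₑ) atTop (𝓝 0) := by
  rw [ENNReal.tendsto_nhds_zero]
  intro ε hε
  have hε3 : ε / 3 ≠ 0 := (ENNReal.div_pos hε.ne' (by simp)).ne'
  obtain ⟨c, hcs, hc, hcc, hcm⟩ :=
    (memLp_one_iff_integrable.2 hu).exists_hasCompactSupport_eLpNorm_sub_le ENNReal.one_ne_top hε3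
  rw [eLpNorm_one_eq_lintegral_enorm] at hc
  have hci : Integrable c := memLp_one_iff_integrable.1 hcm
  have hmeas : ∀ k, Measurable fun x => ‖mollify k c x - c x‖ₑ := fun k =>
    ((continuous_mollify k hci.locallyIntegrable).sub hcc).measurable.enorm
  have hmeas' : ∀ k, Measurable fun x => ‖mollify k (fun y => u y - c y) x‖ₑ := fun k =>
    (continuous_mollify k (hu.sub hci).locallyIntegrable).measurable.enorm
  filter_upwards [(tendsto_lintegral_mollify_sub_of_hasCompactSupport hcc hcs).eventually
    (ge_mem_nhds (pos_iff_ne_zero.2 hε3))] with k hk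
  have hpt : ∀ x, ‖mollify k u x - u x‖ₑ ≤
      ‖mollify k (fun y => u y - c y) x‖ₑ + ‖mollify k c x - c x‖ₑ + ‖(u - c) x‖ₑ := fun x => by
    rw [mollify_sub k hu.locallyIntegrable hci.locallyIntegrable]
    have : mollify k u x - u x =
        (mollify k u x - mollify k c x) + (mollify k c x - c x) - (u - c) x := by
      simp only [Pi.sub_apply]; ring
    rw [this]
    exact (enorm_sub_le).trans (add_le_add (enorm_add_le _ _) le_rfl)
  calc ∫⁻ x, ‖mollify k u x - u x‖ₑ ≤ _ := lintegral_mono hpt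
    _ = (∫⁻ x, ‖mollify k (fun y => u y - c y) x‖ₑ) + (∫⁻ x, ‖mollify k c x - c x‖ₑ)
        + ∫⁻ x, ‖(u - c) x‖ₑ := by
      have hm : Measurable fun x => ‖mollify k (fun y => u y - c y) x‖ₑ +
        ‖mollify k c x - c x‖ₑ := (hmeas' k).add (hmeas k)
      rw [lintegral_add_left hm, lintegral_add_left (hmeas' k)]
    _ ≤ ε / 3 + ε / 3 + ε / 3 := by
      gcongr
      exact (lintegral_enorm_mollify_le k (hu.sub hci)).trans hc
    _ = ε := ENNReal.add_thirds ε

theorem tendstoL1Loc_mollify {u : Space N → ℝ} (hu : LocallyIntegrable u volume) :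
    TendstoL1Loc (fun k => mollify k u) u := by
  intro K hK
  have hK' : IsCompact (Metric.cthickening 1 K) := hK.cthickening
  set v := (Metric.cthickening 1 K).indicator u with hv
  have hvi : Integrable v :=
    (hu.integrableOn_isCompact hK').integrable_indicator hK'.measurableSet
  refine tendsto_of_tendsto_of_tendsto_of_le_of_le tendsto_const_nhds
    (tendsto_lintegral_mollify_sub hvi) (fun _ => zero_le) fun k => ?_
  refine le_trans (le_of_eq ?_) (setLIntegral_le_lintegral K _)
  refine setLIntegral_congr_fun hK.measurableSet fun x hx => ?_
  have h1 : v x = u x := Set.indicator_of_mem (Metric.self_subset_cthickening K hx) u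
  -- only the values of `u` at distance less than `1` from `x` matter
  have h2 : mollify k v x = mollify k u x := by
    simp only [mollify, convolution_def]
    refine integral_congr_ae (Eventually.of_forall fun t => ?_)
    by_cases ht : (mollifier N k).normed volume t = 0
    · simp [ht]
    · have ht : ‖t‖ < (mollifier N k).rOut := by
        have : t ∈ Function.support ((mollifier N k).normed volume) := ht
        rw [(mollifier N k).support_normed_eq] at this
        simpa using this
      have hmem : x - t ∈ Metric.cthickening 1 K := by
        refine Metric.mem_cthickening_of_dist_le _ x 1 K hx ?_
        rw [dist_eq_norm, sub_sub_cancel_left, norm_neg]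
        exact ht.le.trans (mollifier_rOut_le_one k)
      simp only [hv, Set.indicator_of_mem hmem]
  simp only [h1, h2]

/-! ### The chain rule across a hyperplane -/

theorem TendstoL1Loc.sub {a b : ℕ → Space N → ℝ} {a₀ b₀ : Space N → ℝ}
    (ha : TendstoL1Loc a a₀) (hb : TendstoL1Loc b b₀)
    (hm : ∀ n, AEStronglyMeasurable (fun x => a n x - a₀ x) volume) :
    TendstoL1Loc (fun n x => a n x - b n x) fun x => a₀ x - b₀ x := by
  intro K hK
  have hsum := (ha K hK).add (hb K hK)
  rw [add_zero] at hsum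
  refine tendsto_of_tendsto_of_tendsto_of_le_of_le tendsto_const_nhds hsum
    (fun _ => zero_le) fun n => ?_
  rw [← lintegral_add_left' (hm n).restrict.enorm]
  refine lintegral_mono fun x => ?_
  rw [show a n x - b n x - (a₀ x - b₀ x) = (a n x - a₀ x) - (b n x - b₀ x) by ring]
  exact enorm_sub_le

theorem TendstoL1Loc.comp_reflect {a : ℕ → Space N → ℝ} {a₀ : Space N → ℝ}
    (ha : TendstoL1Loc a a₀) (H : HalfSpace N) :
    TendstoL1Loc (fun n x => a n (H.reflect x)) fun x => a₀ (H.reflect x) := by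
  intro K hK
  have hK' : IsCompact (H.reflect '' K) := hK.image H.continuous_reflect
  have hpre : H.reflect ⁻¹' (H.reflect '' K) = K :=
    Set.preimage_image_eq _ H.measurableEmbedding_reflect.injective
  refine (ha _ hK').congr fun n => ?_
  have := H.measurePreserving_reflect.setLIntegral_comp_preimage_emb H.measurableEmbedding_reflect
    (fun x => ‖a n x - a₀ x‖ₑ) (H.reflect '' K)
  rw [hpre] at this
  exact this.symm

theorem LocallyIntegrable.comp_reflect {E : Type*} [NormedAddCommGroup E] {u : Space N → E}
    (hu : LocallyIntegrable u volume) (H : HalfSpace N) :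
    LocallyIntegrable (fun x => u (H.reflect x)) volume := by
  rw [locallyIntegrable_iff] at hu ⊢
  intro K hK
  have := (H.measurePreserving_reflect.integrableOn_comp_preimage H.measurableEmbedding_reflect).2
    (hu _ (hK.image H.continuous_reflect))
  rwa [Set.preimage_image_eq _ H.measurableEmbedding_reflect.injective] at this

/-- Products of a sequence converging in `L^1` on compact sets with a bounded sequence converging
almost everywhere, all supported in one compact set. -/
theorem TendstoL1Loc.tendsto_integral_mul {a b : ℕ → Space N → ℝ} {a₀ b₀ : Space N → ℝ}
    (ha : TendstoL1Loc a a₀) (hai : ∀ n, LocallyIntegrable (a n) volume)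
    (ha₀ : LocallyIntegrable a₀ volume) (hbm : ∀ n, AEStronglyMeasurable (b n) volume)
    {B : ℝ} (hB : ∀ n x, |b n x| ≤ B) {K : Set (Space N)} (hK : IsCompact K)
    (hbK : ∀ n x, x ∉ K → b n x = 0)
    (hb : ∀ᵐ x, Tendsto (fun n => b n x) atTop (𝓝 (b₀ x))) :
    Tendsto (fun n => ∫ x, a n x * b n x) atTop (𝓝 (∫ x, a₀ x * b₀ x)) := by
  have hprod : ∀ {c : Space N → ℝ}, LocallyIntegrable c volume → ∀ n,
      Integrable fun x => c x * b n x := fun {c} hc n => by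
    have hcK : Integrable (K.indicator c) :=
      (hc.integrableOn_isCompact hK).integrable_indicator hK.measurableSet
    have := hcK.mul_bdd (c := B) (hbm n) (Eventually.of_forall fun x => hB n x)
    refine this.congr (Eventually.of_forall fun x => ?_)
    by_cases hx : x ∈ K
    · simp [hx]
    · simp [hx, hbK n x hx]
  have hB0 : 0 ≤ B := (abs_nonneg _).trans (hB 0 0)
  have h1 : Tendsto (fun n => ∫ x, (a n x - a₀ x) * b n x) atTop (𝓝 0) := by
    have hlim : Tendsto (fun n => ∫⁻ x, ‖(a n x - a₀ x) * b n x‖ₑ) atTop (𝓝 0) := by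
      have := ENNReal.Tendsto.mul_const (b := ENNReal.ofReal B) (ha K hK)
        (Or.inr ENNReal.ofReal_ne_top)
      rw [zero_mul] at this
      refine tendsto_of_tendsto_of_tendsto_of_le_of_le tendsto_const_nhds this
        (fun _ => zero_le) fun n => ?_
      rw [← lintegral_mul_const' _ _ ENNReal.ofReal_ne_top, ← lintegral_indicator hK.measurableSet]
      refine lintegral_mono fun x => ?_
      by_cases hx : x ∈ K
      · rw [Set.indicator_of_mem hx, enorm_mul]
        gcongr
        rw [← ofReal_norm]
        exact ENNReal.ofReal_le_ofReal (hB n x)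
      · simp [hx, hbK n x hx]
    have := tendsto_integral_of_L1 (fun _ : Space N => (0 : ℝ)) aestronglyMeasurable_const
      (Eventually.of_forall fun n => hprod ((hai n).sub ha₀) n) (by simpa using hlim)
    simpa using this
  have h2 : Tendsto (fun n => ∫ x, a₀ x * b n x) atTop (𝓝 (∫ x, a₀ x * b₀ x)) := by
    refine tendsto_integral_of_dominated_convergence (K.indicator fun x => ‖a₀ x‖ * B)
      (fun n => (hprod ha₀ n).aestronglyMeasurable)
      ((integrable_indicator_iff hK.measurableSet).2
        ((ha₀.integrableOn_isCompact hK).norm.mul_const B))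
      (fun n => Eventually.of_forall fun x => ?_) (hb.mono fun x hx => hx.const_mul _)
    by_cases hx : x ∈ K
    · rw [Set.indicator_of_mem hx, norm_mul]
      exact mul_le_mul_of_nonneg_left (hB n x) (norm_nonneg _)
    · simp [hx, hbK n x hx]
  have := h1.add h2
  rw [zero_add] at this
  refine this.congr fun n => ?_
  have hi : Integrable fun x => (a n x - a₀ x) * b n x := hprod ((hai n).sub ha₀) n
  rw [← integral_add hi (hprod ha₀ n)]
  exact integral_congr_ae (Eventually.of_forall fun x => by simp only; ring)

open Classical in
/-- The function equal to `1` on `H` and to `c` outside of `H`. -/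
def sideFactor (H : HalfSpace N) (c : ℝ) (x : Space N) : ℝ := if x ∈ H.carrier then 1 else c

theorem abs_sideFactor_le (H : HalfSpace N) (c : ℝ) (x : Space N) :
    |sideFactor H c x| ≤ max 1 |c| := by
  unfold sideFactor
  split_ifs <;> simp

theorem measurable_sideFactor (H : HalfSpace N) (c : ℝ) : Measurable (sideFactor H c) :=
  Measurable.ite H.measurableSet_carrier measurable_const measurable_const

/-- A `C^1` function `f` with derivative bounded by `1` and a zero of second order at the origin. -/
structure IsFlatAtZero (f f' : ℝ → ℝ) : Prop where
  hasDerivAt : ∀ t, HasDerivAt f (f' t) t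
  continuous_deriv : Continuous f'
  abs_deriv_le : ∀ t, |f' t| ≤ 1
  map_zero : f 0 = 0
  deriv_zero : f' 0 = 0

theorem IsFlatAtZero.abs_sub_le {f f' : ℝ → ℝ} (hf : IsFlatAtZero f f') (s t : ℝ) :
    |f s - f t| ≤ |s - t| := by
  have := Convex.norm_image_sub_le_of_norm_hasDerivWithin_le (s := Set.univ) (C := 1) (x := t)
    (y := s) (fun x _ => (hf.hasDerivAt x).hasDerivWithinAt) (fun x _ => hf.abs_deriv_le x)
    convex_univ trivial trivial
  simpa using this

theorem IsFlatAtZero.abs_le {f f' : ℝ → ℝ} (hf : IsFlatAtZero f f') (t : ℝ) : |f t| ≤ |t| := by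
  simpa [hf.map_zero] using hf.abs_sub_le t 0

theorem IsFlatAtZero.continuous {f f' : ℝ → ℝ} (hf : IsFlatAtZero f f') : Continuous f :=
  continuous_iff_continuousAt.2 fun t => (hf.hasDerivAt t).continuousAt

/-- If `W` vanishes on `∂H` and `f` has a zero of second order at the origin, then `f ∘ W` remains
differentiable after multiplication with the discontinuous factor `sideFactor H c`. -/
theorem IsFlatAtZero.hasFDerivAt_sideFactor_mul {f f' : ℝ → ℝ} (hf : IsFlatAtZero f f')
    (H : HalfSpace N) (c : ℝ) {W : Space N → ℝ} (hW : Differentiable ℝ W)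
    (hW0 : ∀ x, inner ℝ H.normal x = H.offset → W x = 0) (x : Space N) :
    HasFDerivAt (fun y => sideFactor H c y * f (W y))
      ((sideFactor H c x * f' (W x)) • fderiv ℝ W x) x := by
  have hcomp : HasFDerivAt (fun y => f (W y)) (f' (W x) • fderiv ℝ W x) x :=
    (hf.hasDerivAt (W x)).comp_hasFDerivAt x (hW x).hasFDerivAt
  have hin : Continuous fun y : Space N => (inner ℝ H.normal y : ℝ) := by fun_prop
  rcases lt_trichotomy (inner ℝ H.normal x : ℝ) H.offset with h | h | h
  · have hx : sideFactor H c x = 1 := if_pos h.le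
    rw [hx, one_mul]
    refine hcomp.congr_of_eventuallyEq ?_
    filter_upwards [(isOpen_lt hin continuous_const).mem_nhds h] with y hy
    rw [show sideFactor H c y = 1 from if_pos (le_of_lt hy), one_mul]
  -- on `∂H` the derivative of `f ∘ W` is `0`, which a bounded factor does not change
  · rw [hW0 x h, hf.deriv_zero, zero_smul] at hcomp
    rw [hW0 x h, hf.deriv_zero, mul_zero, zero_smul]
    rw [hasFDerivAt_iff_isLittleO] at hcomp ⊢
    simp only [hW0 x h, hf.map_zero, mul_zero, sub_zero, zero_apply] at hcomp ⊢
    refine Asymptotics.IsBigO.trans_isLittleO (Asymptotics.IsBigO.of_bound (max 1 |c|) ?_) hcomp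
    refine Eventually.of_forall fun y => ?_
    rw [norm_mul]
    exact mul_le_mul_of_nonneg_right (abs_sideFactor_le H c y) (norm_nonneg _)
  · have hx : sideFactor H c x = c := if_neg (not_le.2 h)
    rw [hx, mul_smul]
    refine (hcomp.const_mul c).congr_of_eventuallyEq ?_
    filter_upwards [(isOpen_lt continuous_const hin).mem_nhds h] with y hy
    rw [show sideFactor H c y = c from if_neg (not_le.2 hy)]

theorem IsFlatAtZero.integral_sideFactor_mul_fderiv {f f' : ℝ → ℝ} (hf : IsFlatAtZero f f')
    (H : HalfSpace N) (c : ℝ) {W : Space N → ℝ} (hW : ContDiff ℝ 1 W)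
    (hW0 : ∀ x, inner ℝ H.normal x = H.offset → W x = 0) (e : Space N) {φ : Space N → ℝ}
    (hφ : ContDiff ℝ ∞ φ) (hs : HasCompactSupport φ) :
    ∫ x, f (W x) * (sideFactor H c x * fderiv ℝ φ x e) =
      -∫ x, fderiv ℝ W x e * (sideFactor H c x * f' (W x) * φ x) := by
  have hder := hf.hasFDerivAt_sideFactor_mul H c (hW.differentiable one_ne_zero) hW0
  have hZc : Continuous fun y => sideFactor H c y * f (W y) :=
    continuous_iff_continuousAt.2 fun x => (hder x).continuousAt
  have hfd : ∀ x, fderiv ℝ (fun y => sideFactor H c y * f (W y)) x e =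
      sideFactor H c x * (f' (W x) * fderiv ℝ W x e) := fun x => by
    rw [(hder x).fderiv]
    simp [mul_assoc]
  have hWe := continuous_fderiv_apply one_ne_zero hW e
  have hi1 : Integrable fun x => sideFactor H c x * ((f' (W x) * fderiv ℝ W x e) * φ x) := by
    refine Integrable.bdd_mul (c := max 1 |c|) ?_
      (measurable_sideFactor H c).aestronglyMeasurable
      (Eventually.of_forall fun x => abs_sideFactor_le H c x)
    exact (((hf.continuous_deriv.comp hW.continuous).mul hWe).mul
      hφ.continuous).integrable_of_hasCompactSupport hs.mul_left
  have := integral_mul_fderiv_eq_neg_fderiv_mul_of_integrable (μ := volume) (v := e)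
    (f := fun y => sideFactor H c y * f (W y)) (g := φ)
    (by simpa only [hfd, mul_assoc] using hi1)
    (integrable_mul_fderiv hZc.locallyIntegrable hφ hs e)
    (integrable_mul_of_hasCompactSupport hZc.locallyIntegrable hφ.continuous hs)
    (fun x _ => (hder x).differentiableAt) (fun x _ => hφ.differentiable (by simp) x)
  simp only [hfd] at this
  calc ∫ x, f (W x) * (sideFactor H c x * fderiv ℝ φ x e)
      = ∫ x, sideFactor H c x * f (W x) * fderiv ℝ φ x e := by
        congr 1; funext x; ring
    _ = _ := this
    _ = -∫ x, fderiv ℝ W x e * (sideFactor H c x * f' (W x) * φ x) := by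
        congr 2; funext x; ring

/-- `w` and its derivative `h` in direction `e` are limits of `C^1` functions that vanish on `∂H`
and of their derivatives. -/
def HasApproxVanishing (H : HalfSpace N) (w : Space N → ℝ) (e : Space N) (h : Space N → ℝ) : Prop :=
  ∃ W : ℕ → Space N → ℝ, (∀ k, ContDiff ℝ 1 (W k)) ∧
    (∀ k x, inner ℝ H.normal x = H.offset → W k x = 0) ∧
    (∀ᵐ x, Tendsto (fun k => W k x) atTop (𝓝 (w x))) ∧ TendstoL1Loc W w ∧
    TendstoL1Loc (fun k x => fderiv ℝ (W k) x e) h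

theorem IsFlatAtZero.hasWeakDeriv_sideFactor_mul {f f' : ℝ → ℝ} (hf : IsFlatAtZero f f')
    (H : HalfSpace N) (c : ℝ) {w h : Space N → ℝ} {e : Space N}
    (hw : LocallyIntegrable w volume) (hh : LocallyIntegrable h volume)
    (happ : HasApproxVanishing H w e h) :
    HasWeakDeriv (fun x => sideFactor H c x * f (w x)) e
      fun x => sideFactor H c x * f' (w x) * h x := by
  obtain ⟨W, hW, hW0, hae, hL, hL'⟩ := happ
  have hs := (measurable_sideFactor H c).aestronglyMeasurable (μ := (volume : Measure (Space N)))
  have hfw : LocallyIntegrable (fun x => f (w x)) volume :=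
    hw.mono (hf.continuous.comp_aestronglyMeasurable hw.aestronglyMeasurable)
      (Eventually.of_forall fun x => hf.abs_le _)
  have hf'w : AEStronglyMeasurable (fun x => f' (w x)) volume :=
    hf.continuous_deriv.comp_aestronglyMeasurable hw.aestronglyMeasurable
  refine ⟨?_, ?_, fun φ hφ hφs => ?_⟩
  · refine (hfw.smul (max 1 |c|)).mono (hs.mul hfw.aestronglyMeasurable)
      (Eventually.of_forall fun x => ?_)
    rw [norm_mul, Pi.smul_apply, norm_smul, Real.norm_of_nonneg (le_max_of_le_left zero_le_one)]
    exact mul_le_mul_of_nonneg_right (abs_sideFactor_le H c x) (norm_nonneg _)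
  · refine (hh.smul (max 1 |c|)).mono ((hs.mul hf'w).mul hh.aestronglyMeasurable)
      (Eventually.of_forall fun x => ?_)
    rw [norm_mul, Pi.smul_apply, norm_smul, Real.norm_of_nonneg (le_max_of_le_left zero_le_one),
      norm_mul]
    refine mul_le_mul_of_nonneg_right ?_ (norm_nonneg _)
    refine (mul_le_mul (abs_sideFactor_le H c x) (hf.abs_deriv_le _) (abs_nonneg _)
      (le_max_of_le_left zero_le_one)).trans (mul_one _).le
  · obtain ⟨B, hB⟩ := (continuous_fderiv_apply (by simp) hφ e).bounded_above_of_compact_support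
      (hφs.fderiv_apply ℝ e)
    obtain ⟨B', hB'⟩ := hφ.continuous.bounded_above_of_compact_support hφs
    have hLf : TendstoL1Loc (fun k x => f (W k x)) fun x => f (w x) := fun K hK => by
      refine tendsto_of_tendsto_of_tendsto_of_le_of_le tendsto_const_nhds (hL K hK)
        (fun _ => zero_le) fun k => lintegral_mono fun x => ?_
      rw [← ofReal_norm, ← ofReal_norm]
      exact ENNReal.ofReal_le_ofReal (hf.abs_sub_le _ _)
    have hM : (0 : ℝ) ≤ max 1 |c| := le_max_of_le_left zero_le_one
    have lim1 := hLf.tendsto_integral_mul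
      (b := fun _ x => sideFactor H c x * fderiv ℝ φ x e)
      (b₀ := fun x => sideFactor H c x * fderiv ℝ φ x e)
      (fun k => (hf.continuous.comp (hW k).continuous).locallyIntegrable) hfw
      (fun _ => hs.mul (continuous_fderiv_apply (by simp) hφ e).aestronglyMeasurable)
      (B := max 1 |c| * B) (fun _ x => by
        rw [abs_mul]
        exact mul_le_mul (abs_sideFactor_le H c x) (hB x) (abs_nonneg _) hM)
      (hφs.fderiv_apply ℝ e).isCompact
      (fun _ x hx => by rw [image_eq_zero_of_notMem_tsupport hx, mul_zero])
      (Eventually.of_forall fun x => tendsto_const_nhds)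
    have lim2 := hL'.tendsto_integral_mul
      (b := fun k x => sideFactor H c x * f' (W k x) * φ x)
      (b₀ := fun x => sideFactor H c x * f' (w x) * φ x)
      (fun k => (continuous_fderiv_apply one_ne_zero (hW k) e).locallyIntegrable) hh
      (fun k => (hs.mul (hf.continuous_deriv.comp (hW k).continuous).aestronglyMeasurable).mul
        hφ.continuous.aestronglyMeasurable)
      (B := max 1 |c| * 1 * B') (fun k x => by
        rw [abs_mul, abs_mul]
        exact mul_le_mul (mul_le_mul (abs_sideFactor_le H c x) (hf.abs_deriv_le _)
          (abs_nonneg _) hM) (hB' x) (abs_nonneg _) (mul_nonneg hM zero_le_one))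
      hφs.isCompact
      (fun _ x hx => by rw [image_eq_zero_of_notMem_tsupport hx, mul_zero])
      (hae.mono fun x hx =>
        (((hf.continuous_deriv.tendsto _).comp hx).const_mul _).mul_const _)
    have heq := tendsto_nhds_unique lim1 (lim2.neg.congr fun k =>
      (hf.integral_sideFactor_mul_fderiv H c (hW k) (hW0 k) e hφ hφs).symm)
    convert heq using 1
    · exact integral_congr_ae (Eventually.of_forall fun x => by ring)
    · congr 1
      exact integral_congr_ae (Eventually.of_forall fun x => by ring)

/-- Weak derivatives pass to dominated limits. -/
theorem HasWeakDeriv.of_tendsto {u h : ℕ → Space N → ℝ} {u₀ h₀ U D : Space N → ℝ} {e : Space N}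
    (H : ∀ n, HasWeakDeriv (u n) e (h n)) (hU : LocallyIntegrable U volume)
    (hD : LocallyIntegrable D volume) (huU : ∀ n x, |u n x| ≤ |U x|) (hhD : ∀ n x, |h n x| ≤ |D x|)
    (hu : ∀ x, Tendsto (fun n => u n x) atTop (𝓝 (u₀ x)))
    (hh : ∀ x, Tendsto (fun n => h n x) atTop (𝓝 (h₀ x))) : HasWeakDeriv u₀ e h₀ := by
  have hum := aestronglyMeasurable_of_tendsto_ae atTop
    (fun n => (H n).1.aestronglyMeasurable) (Eventually.of_forall hu)
  have hhm := aestronglyMeasurable_of_tendsto_ae atTop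
    (fun n => (H n).2.1.aestronglyMeasurable) (Eventually.of_forall hh)
  refine ⟨hU.mono hum (Eventually.of_forall fun x =>
      le_of_tendsto' (hu x).abs fun n => huU n x),
    hD.mono hhm (Eventually.of_forall fun x => le_of_tendsto' (hh x).abs fun n => hhD n x),
    fun φ hφ hs => ?_⟩
  have lim : ∀ {a : ℕ → Space N → ℝ} {a₀ A ψ : Space N → ℝ}, LocallyIntegrable A volume →
      (∀ n, LocallyIntegrable (a n) volume) →
      (∀ n x, |a n x| ≤ |A x|) → (∀ x, Tendsto (fun n => a n x) atTop (𝓝 (a₀ x))) →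
      Continuous ψ → HasCompactSupport ψ →
      Tendsto (fun n => ∫ x, a n x * ψ x) atTop (𝓝 (∫ x, a₀ x * ψ x)) := by
    intro a a₀ A ψ hA ha haA hlim hψ hψs
    refine tendsto_integral_of_dominated_convergence (fun x => ‖A x * ψ x‖)
      (fun n => (integrable_mul_of_hasCompactSupport (ha n) hψ hψs).aestronglyMeasurable)
      (integrable_mul_of_hasCompactSupport hA hψ hψs).norm
      (fun n => Eventually.of_forall fun x => ?_)
      (Eventually.of_forall fun x => (hlim x).mul_const _)
    rw [norm_mul, norm_mul]
    exact mul_le_mul_of_nonneg_right (haA n x) (norm_nonneg _)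
  have l1 := lim hU (fun n => (H n).1) huU hu (continuous_fderiv_apply (by simp) hφ e)
    (hs.fderiv_apply ℝ e)
  have l2 := lim hD (fun n => (H n).2.1) hhD hh hφ.continuous hs
  exact tendsto_nhds_unique l1 (l2.neg.congr fun n => ((H n).2.2 φ hφ hs).symm)

theorem hasWeakDeriv_sideFactor_mul_of_tendsto {f f' : ℕ → ℝ → ℝ} {F F' : ℝ → ℝ}
    (hf : ∀ j, IsFlatAtZero (f j) (f' j)) (hF : ∀ t, Tendsto (fun j => f j t) atTop (𝓝 (F t)))
    (hF' : ∀ t, Tendsto (fun j => f' j t) atTop (𝓝 (F' t)))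
    (H : HalfSpace N) (c : ℝ) {w h : Space N → ℝ} {e : Space N}
    (hw : LocallyIntegrable w volume) (hh : LocallyIntegrable h volume)
    (happ : HasApproxVanishing H w e h) :
    HasWeakDeriv (fun x => sideFactor H c x * F (w x)) e
      fun x => sideFactor H c x * F' (w x) * h x := by
  have hM : (0 : ℝ) ≤ max 1 |c| := le_max_of_le_left zero_le_one
  refine HasWeakDeriv.of_tendsto
    (fun j => (hf j).hasWeakDeriv_sideFactor_mul H c hw hh happ)
    (hw.smul (max 1 |c|)) (hh.smul (max 1 |c|)) (fun j x => ?_) (fun j x => ?_)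
    (fun x => (hF _).const_mul _) (fun x => ((hF' _).const_mul _).mul_const _)
  · rw [Pi.smul_apply, smul_eq_mul, abs_mul, abs_mul, abs_of_nonneg hM]
    exact mul_le_mul (abs_sideFactor_le H c x) ((hf j).abs_le _) (abs_nonneg _) hM
  · rw [Pi.smul_apply, smul_eq_mul, abs_mul, abs_mul, abs_mul, abs_of_nonneg hM]
    refine mul_le_mul_of_nonneg_right ?_ (abs_nonneg _)
    exact (mul_le_mul (abs_sideFactor_le H c x) ((hf j).abs_deriv_le _) (abs_nonneg _) hM).trans
      (mul_one _).le

/-- A smooth regularization of `|t|`; the limit of the derivatives is `t / |t|`, which is `0` at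
`t = 0`. -/
theorem isFlatAtZero_sqrt {ε : ℝ} (hε : 0 < ε) :
    IsFlatAtZero (fun t => √(t ^ 2 + ε ^ 2) - ε) fun t => t / √(t ^ 2 + ε ^ 2) := by
  have hpos : ∀ t : ℝ, 0 < t ^ 2 + ε ^ 2 := fun t => by positivity
  refine ⟨fun t => ?_, ?_, fun t => ?_, ?_, by simp⟩
  · have h1 : HasDerivAt (fun t : ℝ => t ^ 2 + ε ^ 2) (2 * t) t := by
      simpa using (hasDerivAt_pow 2 t).add_const (ε ^ 2)
    have h2 := (h1.sqrt (hpos t).ne').sub_const ε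
    rwa [mul_div_mul_left _ _ two_ne_zero] at h2
  · exact continuous_id.div (by fun_prop) fun t => (Real.sqrt_pos.2 (hpos t)).ne'
  · rw [abs_div, abs_of_pos (Real.sqrt_pos.2 (hpos t)), div_le_one (Real.sqrt_pos.2 (hpos t))]
    exact Real.abs_le_sqrt (by nlinarith [sq_nonneg ε])
  · simp [Real.sqrt_sq hε.le]

/-- A smooth regularization of `t` that is flat at the origin; the limit of the derivatives is
`t / t`, which is `0` at `t = 0`. -/
theorem isFlatAtZero_sub_arctan {ε : ℝ} (hε : 0 < ε) :
    IsFlatAtZero (fun t => t - ε * Real.arctan (t / ε)) fun t => t ^ 2 / (t ^ 2 + ε ^ 2) := by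
  have hpos : ∀ t : ℝ, 0 < t ^ 2 + ε ^ 2 := fun t => by positivity
  refine ⟨fun t => ?_, ?_, fun t => ?_, by simp, by simp⟩
  · have h1 : HasDerivAt (fun t : ℝ => t / ε) (1 / ε) t := (hasDerivAt_id t).div_const ε
    have h2 : HasDerivAt (fun t => t - ε * Real.arctan (t / ε)) _ t :=
      (hasDerivAt_id t).sub ((h1.arctan).const_mul ε)
    have e : 1 - ε * (1 / (1 + (t / ε) ^ 2) * (1 / ε)) = t ^ 2 / (t ^ 2 + ε ^ 2) := by
      have h3 := (hpos t).ne'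
      have h4 : 1 + (t / ε) ^ 2 = (t ^ 2 + ε ^ 2) / ε ^ 2 := by field_simp; ring
      rw [h4]
      field_simp
      ring
    rwa [e] at h2
  · exact (by fun_prop : Continuous fun t : ℝ => t ^ 2).div (by fun_prop) fun t => (hpos t).ne'
  · rw [abs_of_nonneg (by positivity), div_le_one (hpos t)]
    nlinarith [sq_nonneg ε]

theorem hasWeakDeriv_sideFactor_mul_abs (H : HalfSpace N) (c : ℝ) {w h : Space N → ℝ} {e : Space N}
    (hw : LocallyIntegrable w volume) (hh : LocallyIntegrable h volume)
    (happ : HasApproxVanishing H w e h) :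
    HasWeakDeriv (fun x => sideFactor H c x * |w x|) e
      fun x => sideFactor H c x * (w x / |w x|) * h x := by
  have hlim := tendsto_one_div_add_atTop_nhds_zero_nat (𝕜 := ℝ)
  have hsqrt : ∀ t : ℝ, Tendsto (fun j : ℕ => √(t ^ 2 + (1 / ((j : ℝ) + 1)) ^ 2)) atTop (𝓝 |t|) :=
    fun t => by
      have hc : Continuous fun ε : ℝ => √(t ^ 2 + ε ^ 2) := by fun_prop
      simpa [Function.comp_def, Real.sqrt_sq_eq_abs] using (hc.tendsto 0).comp hlim
  refine hasWeakDeriv_sideFactor_mul_of_tendsto (F := fun t => |t|) (F' := fun t => t / |t|)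
    (fun j => isFlatAtZero_sqrt (Nat.one_div_pos_of_nat (n := j)))
    (fun t => ?_) (fun t => ?_) H c hw hh happ
  · simpa using (hsqrt t).sub hlim
  · rcases eq_or_ne t 0 with rfl | ht
    · simp
    · exact tendsto_const_nhds.div (hsqrt t) (abs_ne_zero.2 ht)

/-- A weak derivative of `w` vanishes almost everywhere on `{w = 0}`: the factor `w / w` is the
indicator function of `{w ≠ 0}`. -/
theorem hasWeakDeriv_div_self_mul (H : HalfSpace N) {w h : Space N → ℝ} {e : Space N}
    (hw : LocallyIntegrable w volume) (hh : LocallyIntegrable h volume)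
    (happ : HasApproxVanishing H w e h) :
    HasWeakDeriv w e fun x => w x / w x * h x := by
  have hlim := tendsto_one_div_add_atTop_nhds_zero_nat (𝕜 := ℝ)
  have := hasWeakDeriv_sideFactor_mul_of_tendsto (F := fun t => t) (F' := fun t => t / t)
    (fun j => isFlatAtZero_sub_arctan (Nat.one_div_pos_of_nat (n := j)))
    (fun t => ?_) (fun t => ?_) H 1 hw hh happ
  · simpa [sideFactor] using this
  · have hb : ∀ j : ℕ, |1 / ((j : ℝ) + 1) * Real.arctan (t / (1 / ((j : ℝ) + 1)))| ≤
        1 / ((j : ℝ) + 1) * (Real.pi / 2) := fun j => by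
      rw [abs_mul, abs_of_pos (Nat.one_div_pos_of_nat (n := j))]
      exact mul_le_mul_of_nonneg_left (abs_le.2
        ⟨(Real.neg_pi_div_two_lt_arctan _).le, (Real.arctan_lt_pi_div_two _).le⟩)
        (Nat.one_div_pos_of_nat (n := j)).le
    have hr := hlim.mul_const (Real.pi / 2)
    rw [zero_mul] at hr
    simpa only [sub_zero] using (tendsto_const_nhds (x := t)).sub (squeeze_zero_norm hb hr)
  · rcases eq_or_ne t 0 with rfl | ht
    · simp
    · have hc : Tendsto (fun j : ℕ => t ^ 2 + (1 / ((j : ℝ) + 1)) ^ 2) atTop (𝓝 (t ^ 2)) := by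
        simpa using tendsto_const_nhds.add (hlim.pow 2)
      have := (tendsto_const_nhds (x := t ^ 2)).div hc (pow_ne_zero 2 ht)
      rw [div_self (pow_ne_zero 2 ht)] at this
      rw [div_self ht]
      exact this

/-! ### The weak gradient of a polarization -/

theorem HasWeakGradient.hasWeakDeriv_comp_reflect {u : Space N → ℝ} {g : Space N → Space N}
    (h : HasWeakGradient u g) (H : HalfSpace N) (e : Space N) :
    HasWeakDeriv (fun x => u (H.reflect x)) e
      fun x => inner ℝ (g (H.reflect x)) (H.linearReflection e) := by
  have hR := h.hasWeakDeriv (H.linearReflection e)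
  refine ⟨LocallyIntegrable.comp_reflect h.1 H, LocallyIntegrable.comp_reflect hR.2.1 H,
    fun φ hφ hs => ?_⟩
  have hψ : ContDiff ℝ ∞ fun x => φ (H.reflect x) := hφ.comp H.contDiff_reflect
  have hψs : HasCompactSupport fun x => φ (H.reflect x) :=
    hs.comp_homeomorph (Homeomorph.mk ⟨H.reflect, H.reflect, H.reflect_reflect, H.reflect_reflect⟩
      H.continuous_reflect H.continuous_reflect)
  have hd : ∀ x, fderiv ℝ (fun x => φ (H.reflect x)) x (H.linearReflection e) =
      fderiv ℝ φ (H.reflect x) e := fun x => by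
    have h1 : HasFDerivAt (fun x => φ (H.reflect x)) _ x :=
      ((hφ.differentiable (by simp)) _).hasFDerivAt.comp x (H.hasFDerivAt_reflect x)
    rw [h1.fderiv]
    simp [H.linearReflection_linearReflection]
  have := hR.2.2 _ hψ hψs
  simp only [hd] at this
  rw [← H.measurePreserving_reflect.integral_comp H.measurableEmbedding_reflect,
    ← H.measurePreserving_reflect.integral_comp H.measurableEmbedding_reflect
      (fun x => inner ℝ (g (H.reflect x)) (H.linearReflection e) * φ x)]
  simpa only [H.reflect_reflect] using this

/-- The functions `u_k - u_k ∘ σ`, with the mollifications `u_k` of `u`, vanish on `∂H`. -/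
theorem HasWeakGradient.hasApproxVanishing {u : Space N → ℝ} {g : Space N → Space N}
    (h : HasWeakGradient u g) (H : HalfSpace N) (e : Space N) :
    HasApproxVanishing H (fun x => u x - u (H.reflect x)) e fun x =>
      inner ℝ (g x) e - inner ℝ (g (H.reflect x)) (H.linearReflection e) := by
  have hc := fun k => contDiff_mollify k h.1
  have he := h.hasWeakDeriv e
  have hR := h.hasWeakDeriv (H.linearReflection e)
  have hd : ∀ k x, fderiv ℝ (fun x => mollify k u x - mollify k u (H.reflect x)) x e =
      mollify k (fun x => inner ℝ (g x) e) x -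
        mollify k (fun x => inner ℝ (g x) (H.linearReflection e)) (H.reflect x) := fun k x => by
    have hdiff := (hc k).differentiable (by simp)
    have h1 : HasFDerivAt (fun x => mollify k u (H.reflect x)) _ x :=
      (hdiff _).hasFDerivAt.comp x (H.hasFDerivAt_reflect x)
    have h2 : HasFDerivAt (fun x => mollify k u x - mollify k u (H.reflect x)) _ x :=
      (hdiff x).hasFDerivAt.sub h1
    rw [h2.fderiv, ← he.fderiv_mollify, ← hR.fderiv_mollify]
    simp
  refine ⟨fun k x => mollify k u x - mollify k u (H.reflect x), fun k => ?_, fun k x hx => ?_,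
    ?_, ?_, ?_⟩
  · exact ((hc k).sub ((hc k).comp H.contDiff_reflect)).of_le (by simp)
  · simp only [H.reflect_eq_self hx, sub_self]
  · have hae := tendsto_mollify_ae h.1
    filter_upwards [hae, H.measurePreserving_reflect.quasiMeasurePreserving.ae hae] with x h1 h2
    exact h1.sub h2
  · exact (tendstoL1Loc_mollify h.1).sub ((tendstoL1Loc_mollify h.1).comp_reflect H) fun k =>
      (continuous_mollify k h.1).aestronglyMeasurable.sub h.1.aestronglyMeasurable
  · simp only [hd]
    exact (tendstoL1Loc_mollify he.2.1).sub ((tendstoL1Loc_mollify hR.2.1).comp_reflect H) fun k =>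
      (continuous_mollify k he.2.1).aestronglyMeasurable.sub he.2.1.aestronglyMeasurable

open Classical in
/-- The gradient of `u^H = u ∘ τ` for `∇u = g`. -/
def polarizeGrad (H : HalfSpace N) (u : Space N → ℝ) (g : Space N → Space N) (x : Space N) :
    Space N :=
  if x ∈ swapSet H u then H.linearReflection (g (H.reflect x)) else g x

theorem norm_polarizeGrad (H : HalfSpace N) (u : Space N → ℝ) (g : Space N → Space N)
    (x : Space N) : ‖polarizeGrad H u g x‖ = ‖g (swapMap H u x)‖ := by
  unfold polarizeGrad swapMap
  split_ifs <;> simp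

theorem aestronglyMeasurable_polarizeGrad (H : HalfSpace N) {u : Space N → ℝ} (hu : Measurable u)
    {g : Space N → Space N} (hg : AEStronglyMeasurable g volume) :
    AEStronglyMeasurable (polarizeGrad H u g) volume := by
  classical
  have h1 : AEStronglyMeasurable (fun x => H.linearReflection (g (H.reflect x))) volume :=
    H.linearReflection.continuous.comp_aestronglyMeasurable
      (hg.comp_measurePreserving H.measurePreserving_reflect)
  exact AEStronglyMeasurable.piecewise (measurableSet_swapSet H hu) h1.restrict hg.restrict

theorem eLpNorm_polarizeGrad (H : HalfSpace N) {u : Space N → ℝ} (hu : Measurable u)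
    {g : Space N → Space N} (hg : AEStronglyMeasurable g volume) (q : ℝ≥0∞) :
    eLpNorm (polarizeGrad H u g) q volume = eLpNorm g q volume := by
  rw [← eLpNorm_comp_measurePreserving hg (measurePreserving_swapMap H hu)]
  exact eLpNorm_congr_norm_ae (Eventually.of_forall (norm_polarizeGrad H u g))

/-- With `w = u - u ∘ σ`, the polarization is `(u + u ∘ σ ± |w|) / 2`, with the sign `+` on `H` and
`-` outside; moreover `∇w = 0` almost everywhere on `{w = 0}`. -/
theorem HasWeakGradient.polarize {u : Space N → ℝ} {g : Space N → Space N}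
    (h : HasWeakGradient u g) (H : HalfSpace N) (hu : Measurable u) :
    HasWeakGradient (polarize H u) (polarizeGrad H u g) := by
  have hpol : ∀ x, PolyaSzego.polarize H u x = 1 / 2 * (u x + u (H.reflect x)) +
      1 / 2 * (sideFactor H (-1) x * |u x - u (H.reflect x)|) := fun x => by
    by_cases hx : x ∈ H.carrier
    · rw [polarize_of_mem hx, sideFactor, if_pos hx, max_def']
      split_ifs with hle
      · rw [abs_of_nonneg (sub_nonneg.2 hle)]; ring
      · rw [abs_of_neg (sub_neg.2 (not_le.1 hle))]; ring
    · rw [polarize_of_notMem hx, sideFactor, if_neg hx, min_def]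
      split_ifs with hle
      · rw [abs_of_nonpos (sub_nonpos.2 hle)]; ring
      · rw [abs_of_pos (sub_pos.2 (not_le.1 hle))]; ring
  have hGm := aestronglyMeasurable_polarizeGrad H hu h.2.1.aestronglyMeasurable
  have hG : LocallyIntegrable (polarizeGrad H u g) volume := by
    have hnorm : LocallyIntegrable (fun x => ‖g x‖) volume :=
      h.2.1.mono h.2.1.aestronglyMeasurable.norm (Eventually.of_forall fun x => by simp)
    have hdom : LocallyIntegrable (fun x => ‖g x‖ + ‖g (H.reflect x)‖) volume :=
      hnorm.add (LocallyIntegrable.comp_reflect hnorm H)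
    refine hdom.mono hGm (Eventually.of_forall fun x => ?_)
    rw [Real.norm_of_nonneg (by positivity)]
    unfold polarizeGrad
    split_ifs <;> simp
  have key : ∀ e, HasWeakDeriv (PolyaSzego.polarize H u) e
      fun x => inner ℝ (polarizeGrad H u g x) e := by
    intro e
    have he := h.hasWeakDeriv e
    have hσ := h.hasWeakDeriv_comp_reflect H e
    have hw := he.sub hσ
    have happ := h.hasApproxVanishing H e
    have hzero := hw.unique (hasWeakDeriv_div_self_mul H hw.1 hw.2.1 happ)
    have habs := hasWeakDeriv_sideFactor_mul_abs H (-1) hw.1 hw.2.1 happ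
    have htot := ((he.add hσ).const_mul (1 / 2)).add (habs.const_mul (1 / 2))
    refine htot.congr_ae (Eventually.of_forall fun x => (hpol x).symm) ?_
    filter_upwards [hzero] with x hx
    have hR := H.inner_linearReflection (g (H.reflect x)) e
    rcases lt_trichotomy (u x) (u (H.reflect x)) with hlt | heq | hgt
    · have hneg : u x - u (H.reflect x) < 0 := sub_neg.2 hlt
      rw [abs_of_neg hneg, div_neg, div_self hneg.ne]
      by_cases hxH : x ∈ H.carrier
      · have : x ∈ swapSet H u := Or.inl ⟨hxH, hlt⟩
        rw [polarizeGrad, if_pos this, hR, sideFactor, if_pos hxH]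
        ring
      · have : x ∉ swapSet H u := by
          rintro (⟨h1, -⟩ | ⟨-, h1⟩)
          exacts [hxH h1, lt_asymm hlt h1]
        rw [polarizeGrad, if_neg this, sideFactor, if_neg hxH]
        ring
    · have : x ∉ swapSet H u := by
        rintro (⟨-, h1⟩ | ⟨-, h1⟩)
        exacts [h1.ne heq, h1.ne' heq]
      rw [sub_eq_zero.2 heq] at hx ⊢
      rw [div_zero, zero_mul] at hx
      rw [polarizeGrad, if_neg this, abs_zero, div_zero]
      linarith
    · have hpos : 0 < u x - u (H.reflect x) := sub_pos.2 hgt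
      rw [abs_of_pos hpos, div_self hpos.ne']
      by_cases hxH : x ∈ H.carrier
      · have : x ∉ swapSet H u := by
          rintro (⟨-, h1⟩ | ⟨h1, -⟩)
          exacts [lt_asymm hgt h1, h1 hxH]
        rw [polarizeGrad, if_neg this, sideFactor, if_pos hxH]
        ring
      · have : x ∈ swapSet H u := Or.inr ⟨hxH, hgt⟩
        rw [polarizeGrad, if_pos this, hR, sideFactor, if_neg hxH]
        ring
  have hu' : LocallyIntegrable (PolyaSzego.polarize H u) volume := (key 0).1
  exact hasWeakGradient_of_hasWeakDeriv hu' hG key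

/-- Polarizations have gradients of the same `L^q` norm. -/
theorem exists_hasWeakGradient_polarizationSeq (H : ℕ → HalfSpace N) {u : Space N → ℝ}
    (hu : Measurable u) {g : Space N → Space N} (h : HasWeakGradient u g) (q : ℝ≥0∞) (n : ℕ) :
    ∃ G, HasWeakGradient (polarizationSeq H u n) G ∧ eLpNorm G q volume = eLpNorm g q volume :=
  (polarizationSeq_induction (fun f => Measurable f ∧ ∃ G, HasWeakGradient f G ∧
    eLpNorm G q volume = eLpNorm g q volume)
    (fun k f ⟨hf, G, hG, hGn⟩ => ⟨measurable_polarize _ hf, polarizeGrad (H k) f G,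
      hG.polarize (H k) hf,
      (eLpNorm_polarizeGrad (H k) hf hG.2.1.aestronglyMeasurable q).trans hGn⟩)
    ⟨hu, g, h, rfl⟩ n).2

/-! ### Uniform convexity of `L^p` -/

theorem norm_prod_rpow_le {E : Type*} [NormedAddCommGroup E] {p : ℝ} (a b : E) :
    ‖(a, b)‖ ^ p ≤ ‖a‖ ^ p + ‖b‖ ^ p := by
  have ha := Real.rpow_nonneg (norm_nonneg a) p
  have hb := Real.rpow_nonneg (norm_nonneg b) p
  rw [Prod.norm_mk]
  rcases max_choice ‖a‖ ‖b‖ with h | h <;> rw [h] <;> linarith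

section UniformConvexity

variable {E : Type*} [NormedAddCommGroup E] [InnerProductSpace ℝ E]

/-- The defect in the midpoint convexity of `‖·‖ ^ p`. -/
def midpointDefect (p : ℝ) (a b : E) : ℝ :=
  (‖a‖ ^ p + ‖b‖ ^ p) / 2 - ‖(1 / 2 : ℝ) • (a + b)‖ ^ p

theorem midpointDefect_pos {p : ℝ} (hp : 1 < p) {a b : E} (hab : a ≠ b) :
    0 < midpointDefect p a b := by
  have hp0 : 0 < p := by linarith
  refine sub_pos.2 ?_
  by_cases h : ‖a‖ = ‖b‖
  · have hlt := (norm_midpoint_lt_iff h).2 hab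
    calc ‖(1 / 2 : ℝ) • (a + b)‖ ^ p < ‖a‖ ^ p := Real.rpow_lt_rpow (norm_nonneg _) hlt hp0
      _ = (‖a‖ ^ p + ‖b‖ ^ p) / 2 := by rw [← h]; ring
  · have hle : ‖(1 / 2 : ℝ) • (a + b)‖ ≤ (1 / 2 : ℝ) • ‖a‖ + (1 / 2 : ℝ) • ‖b‖ := by
      rw [norm_smul, ← smul_add, smul_eq_mul, Real.norm_of_nonneg (by norm_num)]
      exact mul_le_mul_of_nonneg_left (norm_add_le _ _) (by norm_num)
    have hlt := (strictConvexOn_rpow hp).2 (Set.mem_Ici.2 (norm_nonneg a))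
      (Set.mem_Ici.2 (norm_nonneg b)) h (by norm_num : (0 : ℝ) < 1 / 2)
      (by norm_num : (0 : ℝ) < 1 / 2) (by norm_num)
    calc ‖(1 / 2 : ℝ) • (a + b)‖ ^ p ≤ ((1 / 2 : ℝ) • ‖a‖ + (1 / 2 : ℝ) • ‖b‖) ^ p :=
          Real.rpow_le_rpow (norm_nonneg _) hle hp0.le
      _ < _ := hlt
      _ = (‖a‖ ^ p + ‖b‖ ^ p) / 2 := by simp only [smul_eq_mul]; ring

theorem midpointDefect_nonneg {p : ℝ} (hp : 1 < p) (a b : E) : 0 ≤ midpointDefect p a b := by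
  by_cases hab : a = b
  · subst hab
    rw [midpointDefect, ← two_smul ℝ a, smul_smul]
    norm_num
  · exact (midpointDefect_pos hp hab).le

theorem continuous_midpointDefect {p : ℝ} (hp : 1 < p) :
    Continuous fun z : E × E => midpointDefect p z.1 z.2 := by
  have h : Continuous fun t : ℝ => t ^ p :=
    Real.continuous_rpow_const (by linarith)
  unfold midpointDefect
  exact (((h.comp continuous_fst.norm).add (h.comp continuous_snd.norm)).div_const 2).sub
    (h.comp (by fun_prop : Continuous fun z : E × E => ‖(1 / 2 : ℝ) • (z.1 + z.2)‖))

theorem midpointDefect_smul {p : ℝ} {r : ℝ} (hr : 0 ≤ r) (a b : E) :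
    midpointDefect p (r • a) (r • b) = r ^ p * midpointDefect p a b := by
  have h : ∀ c : E, ‖r • c‖ ^ p = r ^ p * ‖c‖ ^ p := fun c => by
    rw [norm_smul, Real.norm_of_nonneg hr, Real.mul_rpow hr (norm_nonneg _)]
  rw [midpointDefect, midpointDefect, ← smul_add, smul_comm, h, h, h]
  ring

/-- Pairs at relative distance at least `ε` have a definite midpoint defect: by homogeneity this is
a statement on a compact set. -/
theorem exists_mul_le_midpointDefect [FiniteDimensional ℝ E] {p : ℝ} (hp : 1 < p) {ε : ℝ}
    (hε : 0 < ε) : ∃ δ > 0, ∀ a b : E, ε * ‖(a, b)‖ ≤ ‖a - b‖ →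
      δ * ‖(a, b)‖ ^ p ≤ midpointDefect p a b := by
  have hp0 : p ≠ 0 := by linarith
  have := FiniteDimensional.proper ℝ E
  let K : Set (E × E) := Metric.sphere 0 1 ∩ {z | ε ≤ ‖z.1 - z.2‖}
  have hK : IsCompact K := (isCompact_sphere _ _).inter_right
    (isClosed_le continuous_const (by fun_prop))
  have hmin : ∃ δ > 0, ∀ z ∈ K, δ ≤ midpointDefect p z.1 z.2 := by
    rcases K.eq_empty_or_nonempty with h | h
    · exact ⟨1, one_pos, fun z hz => absurd hz (by simp [h])⟩
    · obtain ⟨z, hz, hzmin⟩ := hK.exists_isMinOn h (continuous_midpointDefect hp).continuousOn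
      refine ⟨_, midpointDefect_pos hp fun heq => ?_, fun w hw => hzmin hw⟩
      have : ε ≤ ‖z.1 - z.2‖ := hz.2
      rw [heq, sub_self, norm_zero] at this
      linarith
  obtain ⟨δ, hδ, hδK⟩ := hmin
  refine ⟨δ, hδ, fun a b hab => ?_⟩
  rcases eq_or_ne (a, b) 0 with h0 | h0
  · rw [h0, norm_zero, Real.zero_rpow hp0, mul_zero]
    exact midpointDefect_nonneg hp a b
  · set r := ‖(a, b)‖ with hr
    have hr0 : 0 < r := norm_pos_iff.2 h0
    have hmem : (r⁻¹ • a, r⁻¹ • b) ∈ K := by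
      constructor
      · rw [mem_sphere_zero_iff_norm, ← Prod.smul_mk, norm_smul, norm_inv, Real.norm_of_nonneg hr0.le,
          ← hr, inv_mul_cancel₀ hr0.ne']
      · show ε ≤ ‖r⁻¹ • a - r⁻¹ • b‖
        rw [← smul_sub, norm_smul, norm_inv, Real.norm_of_nonneg hr0.le, le_inv_mul_iff₀ hr0,
          mul_comm]
        exact hab
    have h1 := hδK _ hmem
    have h2 := midpointDefect_smul (p := p) hr0.le (r⁻¹ • a) (r⁻¹ • b)
    rw [smul_inv_smul₀ hr0.ne', smul_inv_smul₀ hr0.ne'] at h2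
    rw [h2, mul_comm]
    exact mul_le_mul_of_nonneg_left h1 (Real.rpow_nonneg hr0.le _)

/-- Uniform convexity in additive form, which can be integrated without normalization. -/
theorem exists_norm_sub_rpow_le [FiniteDimensional ℝ E] {p : ℝ} (hp : 1 < p) {ε : ℝ}
    (hε : 0 < ε) : ∃ C > 0, ∀ a b : E, ‖a - b‖ ^ p ≤
      ε * (‖a‖ ^ p + ‖b‖ ^ p) + C * midpointDefect p a b := by
  have hp0 : 0 < p := by linarith
  have hη : 0 < ε ^ p⁻¹ := Real.rpow_pos_of_pos hε _
  obtain ⟨δ, hδ, h⟩ := exists_mul_le_midpointDefect (E := E) hp hη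
  refine ⟨2 ^ p / δ, by positivity, fun a b => ?_⟩
  have hd := midpointDefect_nonneg hp a b
  have hC : 0 ≤ 2 ^ p / δ * midpointDefect p a b := by positivity
  have hs : 0 ≤ ε * (‖a‖ ^ p + ‖b‖ ^ p) := by positivity
  by_cases hab : ε ^ p⁻¹ * ‖(a, b)‖ ≤ ‖a - b‖
  · have h1 : ‖a - b‖ ≤ 2 * ‖(a, b)‖ := by
      have e1 := norm_sub_le a b
      have e2 : ‖a‖ ≤ ‖(a, b)‖ := norm_fst_le (a, b)
      have e3 : ‖b‖ ≤ ‖(a, b)‖ := norm_snd_le (a, b)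
      linarith
    calc ‖a - b‖ ^ p ≤ (2 * ‖(a, b)‖) ^ p := Real.rpow_le_rpow (norm_nonneg _) h1 hp0.le
      _ = 2 ^ p / δ * (δ * ‖(a, b)‖ ^ p) := by
        rw [Real.mul_rpow two_pos.le (norm_nonneg _)]
        field_simp
      _ ≤ 2 ^ p / δ * midpointDefect p a b :=
        mul_le_mul_of_nonneg_left (h a b hab) (by positivity)
      _ ≤ _ := by linarith
  · calc ‖a - b‖ ^ p ≤ (ε ^ p⁻¹ * ‖(a, b)‖) ^ p :=
          Real.rpow_le_rpow (norm_nonneg _) (not_le.1 hab).le hp0.le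
      _ = ε * ‖(a, b)‖ ^ p := by
        rw [Real.mul_rpow hη.le (norm_nonneg _), ← Real.rpow_mul hε.le, inv_mul_cancel₀ hp0.ne',
          Real.rpow_one]
      _ ≤ ε * (‖a‖ ^ p + ‖b‖ ^ p) :=
        mul_le_mul_of_nonneg_left (norm_prod_rpow_le a b) hε.le
      _ ≤ _ := by linarith

end UniformConvexity

/-- A decreasing sequence of midpoint convex sets of `L^p` functions, each of which meets a fixed
ball: elements of almost minimal norm form a Cauchy sequence. -/
theorem exists_tendsto_of_antitone_midpointConvex {p : ℝ} (hp : 1 < p)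
    {S : ℕ → Set (Space N → Space N)} (hanti : Antitone S)
    (hmid : ∀ n, ∀ g ∈ S n, ∀ h ∈ S n, (fun x => (1 / 2 : ℝ) • (g x + h x)) ∈ S n)
    (hmem : ∀ n, ∀ g ∈ S n, MemLp g (ENNReal.ofReal p) volume) {M : ℝ}
    (hne : ∀ n, ∃ g ∈ S n, ∫ x, ‖g x‖ ^ p ≤ M) :
    ∃ x : ℕ → Space N → Space N, (∀ n, x n ∈ S n) ∧ ∃ g, MemLp g (ENNReal.ofReal p) volume ∧
      Tendsto (fun n => eLpNorm (x n - g) (ENNReal.ofReal p) volume) atTop (𝓝 0) := by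
  have hp0 : 0 < p := by linarith
  set q := ENNReal.ofReal p with hq
  have hq0 : q ≠ 0 := by simpa [hq] using hp0
  have hqt : q ≠ ⊤ := ENNReal.ofReal_ne_top
  have hqr : q.toReal = p := ENNReal.toReal_ofReal hp0.le
  have : Fact (1 ≤ q) :=
    ⟨by rw [hq, ← ENNReal.ofReal_one]; exact ENNReal.ofReal_le_ofReal hp.le⟩
  let I : (Space N → Space N) → ℝ := fun g => ∫ x, ‖g x‖ ^ p
  have hI0 : ∀ g, 0 ≤ I g := fun g => integral_nonneg fun x => Real.rpow_nonneg (norm_nonneg _) _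
  have hint : ∀ {g : Space N → Space N}, MemLp g q volume → Integrable fun x => ‖g x‖ ^ p :=
    fun {g} hg => by
      have := hg.integrable_norm_rpow hq0 hqt
      rwa [hqr] at this
  have hbdd : ∀ n, BddBelow (I '' S n) := fun n => ⟨0, by rintro _ ⟨g, -, rfl⟩; exact hI0 g⟩
  have hnonempty : ∀ n, (I '' S n).Nonempty := fun n =>
    let ⟨g, hg, _⟩ := hne n
    ⟨_, g, hg, rfl⟩
  set d : ℕ → ℝ := fun n => sInf (I '' S n) with hd
  have hdmono : Monotone d := fun m n hmn =>
    csInf_le_csInf (hbdd m) (hnonempty n) (Set.image_mono (hanti hmn))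
  have hdM : ∀ n, d n ≤ M := fun n =>
    let ⟨g, hg, hgM⟩ := hne n
    (csInf_le (hbdd n) ⟨g, hg, rfl⟩).trans hgM
  have hdlim := tendsto_atTop_ciSup hdmono ⟨M, by rintro _ ⟨n, rfl⟩; exact hdM n⟩
  set D := ⨆ n, d n
  have hdD : ∀ n, d n ≤ D := hdmono.ge_of_tendsto hdlim
  have hDM : D ≤ M := ciSup_le hdM
  have hex : ∀ n : ℕ, ∃ g ∈ S n, I g < d n + 1 / ((n : ℝ) + 1) := fun n => by
    obtain ⟨_, ⟨g, hg, rfl⟩, hlt⟩ := exists_lt_of_csInf_lt (hnonempty n)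
      (lt_add_of_pos_right (d n) (Nat.one_div_pos_of_nat (n := n)))
    exact ⟨g, hg, hlt⟩
  choose x hxS hxI using hex
  refine ⟨x, hxS, ?_⟩
  have hxm : ∀ n, MemLp (x n) q volume := fun n => hmem n _ (hxS n)
  have hIx : ∀ {k n : ℕ}, k ≤ n → I (x n) ≤ D + 1 / ((k : ℝ) + 1) := fun {k n} hkn =>
    (hxI n).le.trans (add_le_add (hdD n) (Nat.one_div_le_one_div hkn))
  have hestimate : ∀ ε > 0, ∃ C > 0, ∀ k m n : ℕ, k ≤ m → k ≤ n →
      I (x m - x n) ≤ ε * (2 * (M + 1)) + C * (D + 1 / ((k : ℝ) + 1) - d k) := by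
    intro ε hε
    obtain ⟨C, hC, hpt⟩ := exists_norm_sub_rpow_le (E := Space N) hp hε
    refine ⟨C, hC, fun k m n hm hn => ?_⟩
    have hmidS := hmid k _ (hanti hm (hxS m)) _ (hanti hn (hxS n))
    have hdk : d k ≤ I fun y => (1 / 2 : ℝ) • (x m y + x n y) :=
      csInf_le (hbdd k) ⟨_, hmidS, rfl⟩
    have i1 := hint (hxm m)
    have i2 := hint (hxm n)
    have i3 := hint (hmem k _ hmidS)
    have i12 : Integrable fun y => ‖x m y‖ ^ p + ‖x n y‖ ^ p := i1.add i2
    have i4 : Integrable fun y => midpointDefect p (x m y) (x n y) := (i12.div_const 2).sub i3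
    have hle : I (x m - x n) ≤ ∫ y, (ε * (‖x m y‖ ^ p + ‖x n y‖ ^ p) +
        C * midpointDefect p (x m y) (x n y)) :=
      integral_mono (hint ((hxm m).sub (hxm n))) ((i12.const_mul ε).add (i4.const_mul C))
        fun y => hpt (x m y) (x n y)
    have e1 : ∫ y, midpointDefect p (x m y) (x n y) =
        (I (x m) + I (x n)) / 2 - I fun y => (1 / 2 : ℝ) • (x m y + x n y) := by
      unfold midpointDefect
      rw [integral_sub (i12.div_const 2) i3, integral_div, integral_add i1 i2]
    have e2 : ∫ y, (ε * (‖x m y‖ ^ p + ‖x n y‖ ^ p) + C * midpointDefect p (x m y) (x n y)) =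
        ε * (I (x m) + I (x n)) + C * ∫ y, midpointDefect p (x m y) (x n y) := by
      rw [integral_add (i12.const_mul ε) (i4.const_mul C), integral_const_mul,
        integral_const_mul, integral_add i1 i2]
    rw [e2, e1] at hle
    have h1 := hIx hm
    have h2 := hIx hn
    have hk1 : 1 / ((k : ℝ) + 1) ≤ 1 := by
      rw [div_le_one (by positivity)]
      linarith [(k.cast_nonneg : (0 : ℝ) ≤ k)]
    refine hle.trans (add_le_add (mul_le_mul_of_nonneg_left (by linarith) hε.le)
      (mul_le_mul_of_nonneg_left (by linarith) hC.le))
  have hsmall : ∀ η > 0, ∃ k : ℕ, ∀ m ≥ k, ∀ n ≥ k, I (x m - x n) < η := by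
    intro η hη
    have hM1 : 0 < 2 * (M + 1) := by
      obtain ⟨g, -, hg⟩ := hne 0
      have := (hI0 g).trans hg
      linarith
    obtain ⟨C, hC, h⟩ := hestimate (η / 2 / (2 * (M + 1))) (by positivity)
    have hlim : Tendsto (fun k : ℕ => C * (D + 1 / ((k : ℝ) + 1) - d k)) atTop (𝓝 0) := by
      have := ((tendsto_one_div_add_atTop_nhds_zero_nat.const_add D).sub hdlim).const_mul C
      simpa using this
    obtain ⟨k, hk⟩ := (hlim.eventually (gt_mem_nhds (half_pos hη))).exists
    refine ⟨k, fun m hm n hn => (h k m n hm hn).trans_lt ?_⟩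
    rw [div_mul_cancel₀ _ hM1.ne']
    linarith
  have hcauchy : CauchySeq fun n => (hxm n).toLp (x n) := by
    refine EMetric.cauchySeq_iff.2 fun ε hε => ?_
    obtain ⟨r, -, hr0, hrε⟩ := ENNReal.lt_iff_exists_real_btwn.1 hε
    have hr : 0 < r := by simpa using hr0
    obtain ⟨k, hk⟩ := hsmall (r ^ p) (Real.rpow_pos_of_pos hr p)
    refine ⟨k, fun m hm n hn => ?_⟩
    rw [Lp.edist_toLp_toLp, ((hxm m).sub (hxm n)).eLpNorm_eq_integral_rpow_norm hq0 hqt, hqr]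
    refine lt_of_le_of_lt (ENNReal.ofReal_le_ofReal ?_) hrε
    calc (I (x m - x n)) ^ p⁻¹ ≤ (r ^ p) ^ p⁻¹ :=
          Real.rpow_le_rpow (hI0 _) (hk m hm n hn).le (inv_nonneg.2 hp0.le)
      _ = r := Real.rpow_rpow_inv hr.le hp0.ne'
  obtain ⟨w, hw⟩ := cauchySeq_tendsto_of_complete hcauchy
  refine ⟨w, Lp.memLp w, (tendsto_iff_edist_tendsto_0.1 hw).congr fun n => ?_⟩
  rw [Lp.edist_def]
  refine eLpNorm_congr_ae ?_
  filter_upwards [(hxm n).coeFn_toLp] with y hy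
  simp [hy]

/-! ### Weak convergence in `W^{1,p}` -/

section Duality

variable {E : Type*} [NormedAddCommGroup E] [InnerProductSpace ℝ E]

theorem lintegral_enorm_inner_le {p q : ℝ≥0∞} [ENNReal.HolderConjugate p q] {g h : Space N → E}
    (hg : AEStronglyMeasurable g volume) (hh : AEStronglyMeasurable h volume) :
    ∫⁻ x, ‖(inner ℝ (g x) (h x) : ℝ)‖ₑ ≤ eLpNorm g p volume * eLpNorm h q volume := by
  rw [← eLpNorm_one_eq_lintegral_enorm]
  have := eLpNorm_le_eLpNorm_mul_eLpNorm'_of_norm (p := p) (q := q) (r := 1) hg hh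
    (fun a b => (inner ℝ a b : ℝ)) 1 (Eventually.of_forall fun x => by
      simpa using norm_inner_le_norm (𝕜 := ℝ) (g x) (h x))
  simpa using this

theorem integrable_inner {p q : ℝ≥0∞} [ENNReal.HolderConjugate p q] {g h : Space N → E}
    (hg : MemLp g p volume) (hh : MemLp h q volume) :
    Integrable fun x => (inner ℝ (g x) (h x) : ℝ) :=
  ⟨hg.1.inner hh.1, (lintegral_enorm_inner_le hg.1 hh.1).trans_lt (ENNReal.mul_lt_top hg.2 hh.2)⟩

theorem tendsto_integral_inner {p q : ℝ≥0∞} [ENNReal.HolderConjugate p q]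
    {g : ℕ → Space N → E} {g₀ h : Space N → E} (hg : ∀ n, MemLp (g n) p volume)
    (hg₀ : MemLp g₀ p volume) (hh : MemLp h q volume)
    (hlim : Tendsto (fun n => eLpNorm (g n - g₀) p volume) atTop (𝓝 0)) :
    Tendsto (fun n => ∫ x, (inner ℝ (g n x) (h x) : ℝ)) atTop
      (𝓝 (∫ x, (inner ℝ (g₀ x) (h x) : ℝ))) := by
  refine tendsto_integral_of_L1 _ (integrable_inner hg₀ hh).aestronglyMeasurable
    (Eventually.of_forall fun n => integrable_inner (hg n) hh) ?_
  have hprod := ENNReal.Tendsto.mul_const (b := eLpNorm h q volume) hlim (Or.inr hh.2.ne)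
  rw [zero_mul] at hprod
  refine tendsto_of_tendsto_of_tendsto_of_le_of_le tendsto_const_nhds hprod
    (fun _ => zero_le) fun n => ?_
  simp only [← inner_sub_left]
  exact lintegral_enorm_inner_le ((hg n).sub hg₀).1 hh.1

end Duality

theorem tendsto_integral_mul {p q : ℝ≥0∞} [ENNReal.HolderConjugate p q]
    {u : ℕ → Space N → ℝ} {v h : Space N → ℝ} (hu : ∀ n, MemLp (u n) p volume)
    (hv : MemLp v p volume) (hh : MemLp h q volume)
    (hlim : Tendsto (fun n => eLpNorm (u n - v) p volume) atTop (𝓝 0)) :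
    Tendsto (fun n => ∫ x, u n x * h x) atTop (𝓝 (∫ x, v x * h x)) := by
  simpa [mul_comm] using tendsto_integral_inner hu hv hh hlim

/-- Weak gradients are closed under convergence in `L^p`. -/
theorem hasWeakGradient_of_tendsto {p q : ℝ≥0∞} [ENNReal.HolderConjugate p q]
    {u : ℕ → Space N → ℝ} {v : Space N → ℝ} {G : ℕ → Space N → Space N} {g : Space N → Space N}
    (hG : ∀ n, HasWeakGradient (u n) (G n)) (hu : ∀ n, MemLp (u n) p volume)
    (hv : MemLp v p volume) (hGp : ∀ n, MemLp (G n) p volume) (hg : MemLp g p volume)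
    (hlim : Tendsto (fun n => eLpNorm (u n - v) p volume) atTop (𝓝 0))
    (hlimG : Tendsto (fun n => eLpNorm (G n - g) p volume) atTop (𝓝 0)) :
    HasWeakGradient v g := by
  have hp1 : 1 ≤ p := ENNReal.HolderConjugate.one_le p q
  refine ⟨hv.locallyIntegrable hp1, hg.locallyIntegrable hp1, fun φ hφ hs i => ?_⟩
  have hφc := continuous_fderiv_apply (by simp) hφ (EuclideanSpace.single i (1 : ℝ))
  have l1 := tendsto_integral_mul (q := q) hu hv
    (hφc.memLp_of_hasCompactSupport (hs.fderiv_apply ℝ _)) hlim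
  have hψ : Continuous fun x => φ x • (EuclideanSpace.single i (1 : ℝ) : Space N) :=
    hφ.continuous.smul continuous_const
  have l2 := tendsto_integral_inner (q := q) hGp hg
    (hψ.memLp_of_hasCompactSupport hs.smul_right) hlimG
  have e : ∀ f : Space N → Space N, ∫ x, (inner ℝ (f x)
      (φ x • (EuclideanSpace.single i (1 : ℝ) : Space N)) : ℝ) = ∫ x, f x i * φ x := fun f => by
    congr 1
    funext x
    rw [inner_smul_right, EuclideanSpace.inner_single_right]
    simp [mul_comm]
  simp only [e] at l2
  exact tendsto_nhds_unique l1 (l2.neg.congr fun n => ((hG n).2.2 φ hφ hs i).symm)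

theorem HasWeakGradient.midpoint {u v : Space N → ℝ} {g h : Space N → Space N}
    (hu : HasWeakGradient u g) (hv : HasWeakGradient v h) :
    HasWeakGradient (fun x => (1 / 2 : ℝ) * (u x + v x)) fun x => (1 / 2 : ℝ) • (g x + h x) := by
  have key := fun e => ((hu.hasWeakDeriv e).add (hv.hasWeakDeriv e)).const_mul (1 / 2)
  refine hasWeakGradient_of_hasWeakDeriv (key 0).1 ((hu.2.1.add hv.2.1).smul (1 / 2 : ℝ))
    fun e => ?_
  simpa only [inner_smul_left, inner_add_left, conj_trivial] using key e

/-- A limit in `L^p`, `1 < p < ∞`, of functions whose gradients are bounded in `L^p` has a gradient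
in `L^p`. -/
theorem exists_hasWeakGradient_of_tendsto {p : ℝ} (hp : 1 < p) {u : ℕ → Space N → ℝ}
    {v : Space N → ℝ} {G : ℕ → Space N → Space N} (hG : ∀ n, HasWeakGradient (u n) (G n))
    (hu : ∀ n, MemLp (u n) (ENNReal.ofReal p) volume) (hv : MemLp v (ENNReal.ofReal p) volume)
    {C : ℝ≥0∞} (hC : C ≠ ⊤) (hGC : ∀ n, eLpNorm (G n) (ENNReal.ofReal p) volume ≤ C)
    (hlim : Tendsto (fun n => eLpNorm (u n - v) (ENNReal.ofReal p) volume) atTop (𝓝 0)) :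
    ∃ g, HasWeakGradient v g ∧ MemLp g (ENNReal.ofReal p) volume := by
  have hp0 : 0 < p := by linarith
  have hconj := (Real.HolderConjugate.conjExponent hp).ennrealOfReal
  set q := ENNReal.ofReal p with hq
  have hq0 : q ≠ 0 := by simpa [hq] using hp0
  have hqt : q ≠ ⊤ := ENNReal.ofReal_ne_top
  have hqr : q.toReal = p := ENNReal.toReal_ofReal hp0.le
  have hq1 : 1 ≤ q := ENNReal.HolderConjugate.one_le q (ENNReal.ofReal p.conjExponent)
  -- the gradients of the functions at distance at most `1 / (n + 1)` from `v`
  let S : ℕ → Set (Space N → Space N) := fun n => {g | MemLp g q volume ∧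
    ∃ w, HasWeakGradient w g ∧ MemLp w q volume ∧ eLpNorm (w - v) q volume ≤ (n + 1 : ℝ≥0∞)⁻¹}
  have hanti : Antitone S := fun m n hmn g ⟨hg, w, hw, hwm, hwv⟩ =>
    ⟨hg, w, hw, hwm, hwv.trans (ENNReal.inv_le_inv.2 (by gcongr))⟩
  have hmid : ∀ n, ∀ g ∈ S n, ∀ h ∈ S n, (fun x => (1 / 2 : ℝ) • (g x + h x)) ∈ S n := by
    rintro n g ⟨hg, w, hw, hwm, hwv⟩ h ⟨hh, z, hz, hzm, hzv⟩
    refine ⟨(hg.add hh).const_smul (1 / 2 : ℝ), _, hw.midpoint hz,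
      (hwm.add hzm).const_mul (1 / 2 : ℝ), ?_⟩
    have e : ((fun x => (1 / 2 : ℝ) * (w x + z x)) - v) =
        (1 / 2 : ℝ) • ((w - v) + (z - v)) := by
      funext x
      simp only [Pi.sub_apply, Pi.smul_apply, Pi.add_apply, smul_eq_mul]
      ring
    rw [e, eLpNorm_const_smul]
    have e2 : ‖(1 / 2 : ℝ)‖ₑ = 2⁻¹ := by
      rw [one_div, enorm_inv two_ne_zero, ← ofReal_norm, Real.norm_of_nonneg two_pos.le]
      simp
    rw [e2]
    calc 2⁻¹ * eLpNorm ((w - v) + (z - v)) q volume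
        ≤ 2⁻¹ * ((n + 1 : ℝ≥0∞)⁻¹ + (n + 1 : ℝ≥0∞)⁻¹) := by
          gcongr
          exact (eLpNorm_add_le (hwm.sub hv).1 (hzm.sub hv).1 hq1).trans (add_le_add hwv hzv)
      _ = (n + 1 : ℝ≥0∞)⁻¹ := by
          rw [← two_mul, ← mul_assoc, ENNReal.inv_mul_cancel two_ne_zero ENNReal.ofNat_ne_top,
            one_mul]
  have hGm : ∀ n, MemLp (G n) q volume := fun n =>
    ⟨(hG n).2.1.aestronglyMeasurable, (hGC n).trans_lt hC.lt_top⟩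
  have hne : ∀ n, ∃ g ∈ S n, ∫ x, ‖g x‖ ^ p ≤ C.toReal ^ p := by
    intro n
    have hpos : (0 : ℝ≥0∞) < (n + 1 : ℝ≥0∞)⁻¹ := by simp
    obtain ⟨m, hm⟩ := (hlim.eventually (ge_mem_nhds hpos)).exists
    refine ⟨G m, ⟨hGm m, u m, hG m, hu m, hm⟩, ?_⟩
    have h1 := hGC m
    rw [(hGm m).eLpNorm_eq_integral_rpow_norm hq0 hqt, hqr] at h1
    have h2 := ENNReal.ofReal_le_iff_le_toReal hC |>.1 h1
    have h3 : 0 ≤ ∫ x, ‖G m x‖ ^ p :=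
      integral_nonneg fun x => Real.rpow_nonneg (norm_nonneg _) _
    calc ∫ x, ‖G m x‖ ^ p = ((∫ x, ‖G m x‖ ^ p) ^ p⁻¹) ^ p := (Real.rpow_inv_rpow h3 hp0.ne').symm
      _ ≤ C.toReal ^ p := Real.rpow_le_rpow (Real.rpow_nonneg h3 _) h2 hp0.le
  obtain ⟨x, hxS, g, hg, hxg⟩ :=
    exists_tendsto_of_antitone_midpointConvex hp hanti hmid (fun n g hg => hg.1) hne
  choose hxm w hw hwm hwv using hxS
  refine ⟨g, hasWeakGradient_of_tendsto (q := ENNReal.ofReal p.conjExponent) hw hwm hv hxm hg ?_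
    hxg, hg⟩
  refine tendsto_of_tendsto_of_tendsto_of_le_of_le tendsto_const_nhds ?_ (fun _ => zero_le) hwv
  simpa using (tendsto_add_atTop_iff_nat 1).2 ENNReal.tendsto_inv_nat_nhds_zero

/-- Pairings with test fields are determined by integration by parts. -/
theorem HasWeakGradient.integral_inner_eq {u : Space N → ℝ} {g : Space N → Space N}
    (h : HasWeakGradient u g) {k : Space N → Space N} (hk : ContDiff ℝ ∞ k)
    (hs : HasCompactSupport k) :
    ∫ x, (inner ℝ (g x) (k x) : ℝ) =
      -∫ x, u x * ∑ i, fderiv ℝ (fun y => k y i) x (EuclideanSpace.single i 1) := by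
  have hki : ∀ i, ContDiff ℝ ∞ fun y => k y i := fun i => contDiff_euclidean.1 hk i
  have hsi : ∀ i, HasCompactSupport fun y => k y i := fun i =>
    hs.comp_left (g := fun z : Space N => z i) rfl
  have hgi : ∀ i, LocallyIntegrable (fun x => g x i) volume := fun i => by
    simpa [EuclideanSpace.inner_single_right] using
      LocallyIntegrable.inner_const h.2.1 (EuclideanSpace.single i (1 : ℝ))
  have e1 : ∀ x, (inner ℝ (g x) (k x) : ℝ) = ∑ i, g x i * k x i := fun x => by
    rw [PiLp.inner_apply]
    exact Finset.sum_congr rfl fun i _ => by simp [mul_comm]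
  simp only [e1, Finset.mul_sum]
  rw [integral_finsetSum _ fun i _ =>
      integrable_mul_of_hasCompactSupport (hgi i) (hki i).continuous (hsi i),
    integral_finsetSum _ fun i _ => integrable_mul_fderiv h.1 (hki i) (hsi i) _,
    ← Finset.sum_neg_distrib]
  exact Finset.sum_congr rfl fun i _ => by rw [h.2.2 _ (hki i) (hsi i) i, neg_neg]

/-- Bounded gradients of a sequence converging in `L^p` converge weakly. -/
theorem tendsto_integral_inner_of_tendsto {p q : ℝ≥0∞} [ENNReal.HolderConjugate p q] (hq : q ≠ ⊤)
    {u : ℕ → Space N → ℝ} {v : Space N → ℝ} {G : ℕ → Space N → Space N} {g : Space N → Space N}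
    (hG : ∀ n, HasWeakGradient (u n) (G n)) (hg : HasWeakGradient v g)
    (hu : ∀ n, MemLp (u n) p volume) (hv : MemLp v p volume) (hgp : MemLp g p volume)
    {C : ℝ≥0∞} (hC : C ≠ ⊤) (hGC : ∀ n, eLpNorm (G n) p volume ≤ C)
    (hlim : Tendsto (fun n => eLpNorm (u n - v) p volume) atTop (𝓝 0))
    {h : Space N → Space N} (hh : MemLp h q volume) :
    Tendsto (fun n => ∫ x, (inner ℝ (G n x) (h x) : ℝ)) atTop
      (𝓝 (∫ x, (inner ℝ (g x) (h x) : ℝ))) := by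
  have hq1 : 1 ≤ q := ENNReal.HolderConjugate.one_le q p
  have hGm : ∀ n, MemLp (G n) p volume := fun n =>
    ⟨(hG n).2.1.aestronglyMeasurable, (hGC n).trans_lt hC.lt_top⟩
  set B := max C (eLpNorm g p volume) with hB
  have hBt : B ≠ ⊤ := (max_lt hC.lt_top hgp.2).ne
  have hest : ∀ f : Space N → Space N, MemLp f p volume → eLpNorm f p volume ≤ B →
      ∀ k : Space N → Space N, MemLp k q volume → ∀ ε : ℝ, 0 ≤ ε →
      eLpNorm (h - k) q volume ≤ ENNReal.ofReal ε →
      |(∫ x, (inner ℝ (f x) (h x) : ℝ)) - ∫ x, (inner ℝ (f x) (k x) : ℝ)| ≤ B.toReal * ε := by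
    intro f hf hfB k hk ε hε hhk
    rw [← integral_sub (integrable_inner hf hh) (integrable_inner hf hk)]
    simp only [← inner_sub_right]
    rw [← Real.norm_eq_abs, ← ENNReal.ofReal_le_ofReal_iff (by positivity), ofReal_norm,
      ENNReal.ofReal_mul ENNReal.toReal_nonneg, ENNReal.ofReal_toReal hBt]
    exact (enorm_integral_le_lintegral_enorm _).trans
      ((lintegral_enorm_inner_le (p := p) (q := q) hf.1 (hh.sub hk).1).trans (mul_le_mul' hfB hhk))
  rw [Metric.tendsto_atTop]
  intro η hη
  set ε := η / (4 * (B.toReal + 1)) with hε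
  have hB0 : 0 ≤ B.toReal := ENNReal.toReal_nonneg
  have hε0 : 0 < ε := by positivity
  have hBε : B.toReal * ε ≤ η / 4 := by
    rw [hε, mul_div_assoc', div_le_div_iff₀ (by positivity) (by positivity)]
    nlinarith
  obtain ⟨k, hks, hk, hhk⟩ := hh.exist_eLpNorm_sub_le hq hq1 hε0
  have hkm : MemLp k q volume := hk.continuous.memLp_of_hasCompactSupport hks
  have hki : ∀ i, ContDiff ℝ ∞ fun y => k y i := fun i => contDiff_euclidean.1 hk i
  have hsi : ∀ i, HasCompactSupport fun y => k y i := fun i =>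
    hks.comp_left (g := fun z : Space N => z i) rfl
  have hdiv : MemLp (fun x => ∑ i, fderiv ℝ (fun y => k y i) x (EuclideanSpace.single i (1 : ℝ)))
      q volume :=
    memLp_finsetSum _ fun i _ => (continuous_fderiv_apply (by simp) (hki i) _).memLp_of_hasCompactSupport
      ((hsi i).fderiv_apply ℝ _)
  have hlimk : Tendsto (fun n => ∫ x, (inner ℝ (G n x) (k x) : ℝ)) atTop
      (𝓝 (∫ x, (inner ℝ (g x) (k x) : ℝ))) := by
    rw [hg.integral_inner_eq hk hks]
    exact (tendsto_integral_mul hu hv hdiv hlim).neg.congr fun n =>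
      ((hG n).integral_inner_eq hk hks).symm
  obtain ⟨n₀, hn₀⟩ := Metric.tendsto_atTop.1 hlimk (η / 4) (by positivity)
  refine ⟨n₀, fun n hn => ?_⟩
  have a1 := abs_le.1 ((hest (G n) (hGm n) ((hGC n).trans (le_max_left _ _)) k hkm ε hε0.le hhk).trans
    hBε)
  have a2 := abs_le.1 ((hest g hgp (le_max_right _ _) k hkm ε hε0.le hhk).trans hBε)
  have a3 := abs_lt.1 (hn₀ n hn)
  rw [Real.dist_eq, abs_lt]
  constructor <;> linarith [a1.1, a1.2, a2.1, a2.2, a3.1, a3.2]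

/-! ### The polarization sequence in `W^{1,p}` -/

theorem schwarz_congr_ae {u v : Space N → ℝ} (h : u =ᵐ[volume] v) : schwarz u = schwarz v := by
  have hvol : ∀ t : ℝ, volume {y | t < u y} = volume {y | t < v y} := fun t =>
    measure_congr (h.mono fun y hy => propext (show t < u y ↔ t < v y by rw [hy]))
  funext x
  simp only [schwarz, hvol]

/-- Functions in `W^{1,p}_+` have Borel measurable representatives that are nonnegative
everywhere. -/
theorem MemW1pPos.exists_measurable {p : ℝ} {u : Space N → ℝ} (hu : MemW1pPos p u) :
    ∃ v : Space N → ℝ, Measurable v ∧ (∀ x, 0 ≤ v x) ∧ u =ᵐ[volume] v := by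
  have hm := hu.1.1.1
  refine ⟨fun x => max (hm.mk u x) 0, hm.stronglyMeasurable_mk.measurable.max measurable_const,
    fun x => le_max_right _ _, ?_⟩
  filter_upwards [hm.ae_eq_mk, hu.2] with x hx h0
  exact hx ▸ (max_eq_left h0).symm

theorem tendsto_polarizationSeq {p : ℝ} (hN : 1 ≤ N) (hp : 1 < p) {H : ℕ → HalfSpace N}
    (hH : IsDenseHalfSpaceSeq H) {u : Space N → ℝ} (hu : MemW1pPos p u) :
    MemLp (schwarz u) (ENNReal.ofReal p) volume ∧ 0 ≤ᵐ[volume] schwarz u ∧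
      Tendsto (fun n => eLpNorm (polarizationSeq H u n - schwarz u) (ENNReal.ofReal p) volume)
        atTop (𝓝 0) := by
  obtain ⟨v, hvm, hv0, huv⟩ := hu.exists_measurable
  obtain ⟨h1, h2, h3⟩ := tendsto_polarizationSeq_schwarz hN hH hp.le hvm hv0
    ((memLp_congr_ae huv).1 hu.1.1)
  rw [schwarz_congr_ae huv]
  exact ⟨h1, h2, h3.congr fun n => eLpNorm_congr_ae
    ((polarizationSeq_congr_ae H huv.symm n).sub (EventuallyEq.refl _ _))⟩

/-- Polarizations preserve the norm of the gradient. -/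
theorem exists_hasWeakGradient_polarizationSeq_gradNorm {p : ℝ} (H : ℕ → HalfSpace N)
    {u : Space N → ℝ} (hu : MemW1pPos p u) (n : ℕ) :
    ∃ G, HasWeakGradient (polarizationSeq H u n) G ∧
      eLpNorm G (ENNReal.ofReal p) volume = gradNorm p u := by
  obtain ⟨v, hvm, -, huv⟩ := hu.exists_measurable
  obtain ⟨g, hg, -⟩ := hu.1.2
  obtain ⟨G, hG, hGn⟩ := exists_hasWeakGradient_polarizationSeq H hvm
    (hg.congr_ae huv (EventuallyEq.refl _ _)) (ENNReal.ofReal p) n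
  exact ⟨G, hG.congr_ae (polarizationSeq_congr_ae H huv.symm n) (EventuallyEq.refl _ _),
    hGn.trans (eLpNorm_congr_ae hg.weakGrad_ae_eq.symm)⟩

theorem MemW1p.hasWeakGradient {p : ℝ} {u : Space N → ℝ} (hu : MemW1p p u) :
    HasWeakGradient u (weakGrad u) := by
  obtain ⟨g, hg, -⟩ := hu.2
  exact hg.congr_ae (EventuallyEq.refl _ _) hg.weakGrad_ae_eq.symm

theorem MemW1p.memLp_weakGrad {p : ℝ} {u : Space N → ℝ} (hu : MemW1p p u) :
    MemLp (weakGrad u) (ENNReal.ofReal p) volume := by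
  obtain ⟨g, hg, hgp⟩ := hu.2
  exact (memLp_congr_ae hg.weakGrad_ae_eq).2 hgp

theorem gradNorm_polarizationSeq {p : ℝ} (H : ℕ → HalfSpace N)
    {u : Space N → ℝ} (hu : MemW1pPos p u) (n : ℕ) :
    gradNorm p (polarizationSeq H u n) = gradNorm p u := by
  obtain ⟨G, hG, hGn⟩ := exists_hasWeakGradient_polarizationSeq_gradNorm H hu n
  rw [← hGn]
  exact eLpNorm_congr_ae hG.weakGrad_ae_eq

theorem memW1p_polarizationSeq {p : ℝ} (H : ℕ → HalfSpace N)
    {u : Space N → ℝ} (hu : MemW1pPos p u) (n : ℕ) : MemW1p p (polarizationSeq H u n) := by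
  obtain ⟨v, hvm, -, huv⟩ := hu.exists_measurable
  obtain ⟨G, hG, hGn⟩ := exists_hasWeakGradient_polarizationSeq_gradNorm H hu n
  refine ⟨?_, G, hG, hG.2.1.aestronglyMeasurable, hGn.trans_lt hu.1.memLp_weakGrad.2⟩
  have hv : Measurable v ∧ MemLp v (ENNReal.ofReal p) volume :=
    ⟨hvm, (memLp_congr_ae huv).1 hu.1.1⟩
  refine (memLp_congr_ae (polarizationSeq_congr_ae H huv n)).2
    (polarizationSeq_induction
      (fun w => Measurable w ∧ MemLp w (ENNReal.ofReal p) volume)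
      (fun k w hw => ⟨measurable_polarize (H k) hw.1, memLp_polarize (H k) hw.1 hw.2⟩) hv n).2

theorem memW1pPos_schwarz {p : ℝ} (hN : 1 ≤ N) (hp : 1 < p) {H : ℕ → HalfSpace N}
    (hH : IsDenseHalfSpaceSeq H) {u : Space N → ℝ} (hu : MemW1pPos p u) :
    MemW1pPos p (schwarz u) := by
  obtain ⟨h1, h2, h3⟩ := tendsto_polarizationSeq hN hp hH hu
  have hw := memW1p_polarizationSeq H hu
  exact ⟨⟨h1, exists_hasWeakGradient_of_tendsto hp (fun n => (hw n).hasWeakGradient)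
    (fun n => (hw n).1) h1 hu.1.memLp_weakGrad.2.ne
    (fun n => (gradNorm_polarizationSeq H hu n).le) h3⟩, h2⟩

theorem weakTendstoW1p_polarizationSeq {p : ℝ} (hN : 1 ≤ N) (hp : 1 < p) {H : ℕ → HalfSpace N}
    (hH : IsDenseHalfSpaceSeq H) {u : Space N → ℝ} (hu : MemW1pPos p u) :
    WeakTendstoW1p p (polarizationSeq H u) (schwarz u) := by
  have hconj := (Real.HolderConjugate.conjExponent hp).ennrealOfReal
  obtain ⟨h1, -, h3⟩ := tendsto_polarizationSeq hN hp hH hu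
  have hw := memW1p_polarizationSeq H hu
  have hv := (memW1pPos_schwarz hN hp hH hu).1
  exact ⟨hw, hv, fun h hh => tendsto_integral_mul (fun n => (hw n).1) h1 hh h3, fun h hh =>
    tendsto_integral_inner_of_tendsto ENNReal.ofReal_ne_top (fun n => (hw n).hasWeakGradient)
      hv.hasWeakGradient (fun n => (hw n).1) h1 hv.memLp_weakGrad hu.1.memLp_weakGrad.2.ne
      (fun n => (gradNorm_polarizationSeq H hu n).le) h3 hh⟩

/-- The `lim inf` of a sequence is the limit of a subsequence, if it is neither the least nor the
greatest element. -/
theorem exists_strictMono_tendsto_of_liminf_eq {β : Type*} [CompleteLinearOrder β]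
    [TopologicalSpace β] [OrderTopology β] [FirstCountableTopology β] {f : ℕ → β} {a : β}
    (ha : liminf f atTop = a) (hbot : ⊥ < a) (htop : a < ⊤) :
    ∃ k : ℕ → ℕ, StrictMono k ∧ Tendsto (fun n => f (k n)) atTop (𝓝 a) := by
  have hc : MapClusterPt a atTop f := by
    rw [(nhds_basis_Ioo' ⟨⊥, hbot⟩ ⟨⊤, htop⟩).mapClusterPt_iff_frequently]
    intro b hb
    exact ((frequently_lt_of_liminf_lt (by isBoundedDefault) (ha.trans_lt hb.2)).and_eventually
      (eventually_lt_of_lt_liminf (hb.1.trans_eq ha.symm))).mono fun n hn => ⟨hn.2, hn.1⟩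
  exact hc.tendsto_subseq

theorem TendstoD1p.gradNorm_eq {p : ℝ} (hp : 1 ≤ p) {w : ℕ → Space N → ℝ} {v : Space N → ℝ}
    (h : TendstoD1p p w v) (hw : ∀ n, MemW1p p (w n)) (hv : MemW1p p v) {c : ℝ≥0∞}
    (hc : ∀ n, gradNorm p (w n) = c) : c = gradNorm p v := by
  have hp1 : 1 ≤ ENNReal.ofReal p := ENNReal.one_le_ofReal.2 hp
  have hwm := fun n => (hw n).memLp_weakGrad.1
  have hvm := hv.memLp_weakGrad.1
  refine le_antisymm ?_ ?_
  · have hlim : Tendsto (fun n => gradNorm p v +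
        eLpNorm (weakGrad (w n) - weakGrad v) (ENNReal.ofReal p) volume) atTop
        (𝓝 (gradNorm p v)) := by simpa using h.const_add (gradNorm p v)
    refine ge_of_tendsto' hlim fun n => ?_
    have := eLpNorm_add_le hvm ((hwm n).sub hvm) hp1
    rwa [add_sub_cancel, ← gradNorm, ← gradNorm, hc n] at this
  · have hlim : Tendsto (fun n => c +
        eLpNorm (weakGrad (w n) - weakGrad v) (ENNReal.ofReal p) volume) atTop
        (𝓝 c) := by simpa using h.const_add c
    refine ge_of_tendsto' hlim fun n => ?_
    have := eLpNorm_sub_le (hwm n) ((hwm n).sub hvm) hp1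
    rwa [sub_sub_cancel, ← gradNorm, ← gradNorm, hc n] at this

end PolyaSzego

end

theorem theorem3p6 (N : ℕ) (hN : 1 ≤ N) (p : ℝ) (hp : 1 < p)
    (ϱ : ℝ≥0 × PolyaSzego.Space N → ℝ) (hϱ : Measurable ϱ)
    (H : ℕ → PolyaSzego.HalfSpace N) (hH : PolyaSzego.IsDenseHalfSpaceSeq H)
    (u : PolyaSzego.Space N → ℝ) (hu : PolyaSzego.MemW1pPos p u)
    -- `J(u)` is finite
    (h_bot : ⊥ < PolyaSzego.energy ϱ u) (h_top : PolyaSzego.energy ϱ u < ⊤)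
    -- `liminf J(uₙ) ≤ J(u)`
    (h_mono : liminf (fun n => PolyaSzego.energy ϱ (PolyaSzego.polarizationSeq H u n)) atTop
      ≤ PolyaSzego.energy ϱ u)
    -- lower semicontinuity along `(uₙ)`
    (h_lsc : ∀ v : PolyaSzego.Space N → ℝ, PolyaSzego.MemW1pPos p v →
      PolyaSzego.WeakTendstoW1p p (PolyaSzego.polarizationSeq H u) v →
      PolyaSzego.energy ϱ v ≤
        liminf (fun n => PolyaSzego.energy ϱ (PolyaSzego.polarizationSeq H u n)) atTop)
    -- convergence of `J` to `J(u*)`, along `(uₙ)` or a subsequence, forces convergence in `D^{1,p}`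
    (h_strict : ∀ k : ℕ → ℕ, StrictMono k →
      Tendsto (fun n => PolyaSzego.energy ϱ (PolyaSzego.polarizationSeq H u (k n))) atTop
        (𝓝 (PolyaSzego.energy ϱ (PolyaSzego.schwarz u))) →
      PolyaSzego.TendstoD1p p (fun n => PolyaSzego.polarizationSeq H u (k n))
        (PolyaSzego.schwarz u)) :
    PolyaSzego.MemW1pPos p (PolyaSzego.schwarz u) ∧
      (PolyaSzego.energy ϱ u = PolyaSzego.energy ϱ (PolyaSzego.schwarz u) →
        PolyaSzego.gradNorm p u = PolyaSzego.gradNorm p (PolyaSzego.schwarz u)) := by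
  have hw := PolyaSzego.memW1p_polarizationSeq H hu
  have hv := PolyaSzego.memW1pPos_schwarz hN hp hH hu
  refine ⟨hv, fun heq => ?_⟩
  have hlim : liminf (fun n => PolyaSzego.energy ϱ (PolyaSzego.polarizationSeq H u n)) atTop =
      PolyaSzego.energy ϱ (PolyaSzego.schwarz u) :=
    le_antisymm (h_mono.trans_eq heq)
      (h_lsc _ hv (PolyaSzego.weakTendstoW1p_polarizationSeq hN hp hH hu))
  obtain ⟨k, hk, hkJ⟩ := PolyaSzego.exists_strictMono_tendsto_of_liminf_eq hlim
    (heq ▸ h_bot) (heq ▸ h_top)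
  exact (h_strict k hk hkJ).gradNorm_eq hp.le (fun n => hw (k n)) hv.1
    fun n => PolyaSzego.gradNorm_polarizationSeq H hu (k n)
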